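/- **Notation.** Let $S$ be a finite set of primes, $\mathcal O_S=\mathbb Z[p^{-1}:p\in S]$, and for a ring $R$ let $\mathrm{PGL}_2(R)=\mathrm{GL}_2(R)/R^\times$. Put $\Gamma_\infty=\mathrm{PGL}_2(\mathbb Z)$, $X_\infty=\Gamma_\infty\backslash \mathrm{PGL}_2(\mathbb R)$, $G_S=\prod_{p\in S}\mathrm{PGL}_2(\mathbb Q_p)$, $K_S=\prod_{p\in S}\mathrm{PGL}_2(\mathbb Z_p)$, $\Gamma_S=\mathrm{PGL}_2(\mathcal O_S)$ embedded diagonally in $\mathrm{PGL}_2(\mathbb R)\times G_S$, and $X_S=\Gamma_S\backslash(\mathrm{PGL}_2(\mathbb R)\times G_S)$. Every point of $X_S$ has the form $\Gamma_S(g,k)$ with $k\in K_S$, and $\pi:X_S\to X_\infty$, $\Gamma_S(g,k)\mapsto\Gamma_\infty g$, is well defined. Write $a_\infty(t)=\mathrm{diag}(e^t,1)$ and $A_\infty=\{a_\infty(t):t\in\mathbb R\}$, acting on $X_\infty$ by right translation. A point $x=\Gamma_\infty g$ of $X_\infty$ (a *class*) is identified with the homothety class of the lattice in $\mathbb R^2$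 spanned by the rows of $g$. For classes $x,x'$ such that some lattice in $x'$ is contained in some lattice in $x$, let $\mathrm{ind}(x,x')$ be the minimal index $[\Lambda:\Lambda']$ over $\Lambda\in x$, $\Lambda'\in x'$ with $\Lambda'\le\Lambda$. The elements $h$ of $\mathcal O_S^\times\cap\mathbb N$ are called *admissible radii*. The $S$-Hecke graph of $x$ is the set $\mathcal G_S(x)$ of all such $x'$ with $\mathrm{ind}(x,x')\in\mathcal O_S^\times$, and its sphere of admissible radius $h$ is $\mathcal S_h(x)=\{x'\in\mathcal G_S(x):\mathrm{ind}(x,x')=h\}$. For $x=\Gamma_\infty g$ and $\omega\in K_S$ put $x_{\omega,h}=\pi\big(\Gamma_S(g,\omega)\,a_f(h)\big)$, where $a_f(h)$ is the identity at $\infty$ and $\mathrm{diag}(1,h)$ at every $p\in S$. The *generalized branch* is $\mathcal L_{g,\omega}=\{x_{\omega,h}: h \text{ an admissible radius}\}$. The orbit $xA_\infty$ is *periodic* if $xa_\infty(t)=x$ for some $t>0$; the minimal such $t$ is the length $t_x$ of the orbit. For such $x=\Gamma_\infty g$, let $\gamma_x\in\Gamma_\infty$ be the element with $\gamma_x^{-1}g=g\,a_\infty(t_x)$,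 and let $\mathbb F_x$ be the real quadratic field generated by the eigenvalues of $\gamma_x$. The branch $\mathcal L_{g,\omega}$ is *degenerate* if for some $p\in S$ and some integer $n>0$ the element $\omega_p^{-1}\gamma_x^n\omega_p$ is upper triangular. The class $x$ is *split* for $S$ if some $p\in S$ splits in $\mathbb F_x$. Finally, $\mathbf t_x(h)$ is the total length of the union of the orbits $x'A_\infty$, $x'\in\mathcal S_h(x)$, each distinct orbit being counted once. **Lemma (total growth).** Let $x\in X_\infty$ be a class with a periodic $A_\infty$-orbit. For every generalized branch $\mathcal L=\mathcal L_{g,\omega}$ ($\Gamma_\infty g=x$, $\omega\in K_S$) and every admissible radius $h$, the intersection $\mathcal L\cap\mathcal S_h(x)$ consists of the single class $x_h=x_{\omega,h}$; put $c_{\mathcal L}(h)=t_{x_h}/h$. 1. There are constants $c,C>0$, depending only on $x$ and $S$, with $c\,h\le\mathbf t_x(h)\le C\,h$ for all admissible radii $h$. 2. If $\mathcal L$ is non-degenerate, then $c_{\mathcal L}(h)$ attains only finitely many values as $h$ runs over the admissible radii, and for every sequence $(h_n)$ of admissible radii with $h_n\mid h_{n+1}$ for all $n$, the sequence $c_{\mathcal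 L}(h_n)$ is eventually constant. 3. The class $x$ is non-split for $S$ if and only if $$\inf\{c_{\mathcal L}(h): \mathcal L \text{ a non-degenerate generalized branch through } x,\ h\in\mathcal O_S^\times\cap\mathbb N\}>0.$$ -/

import Mathlib

open scoped MatrixGroups
open Matrix (ProjGenLinGroup)

noncomputable section

namespace HeckeGraph

instance factPrime (p : Nat.Primes) : Fact (p : ℕ).Prime := ⟨p.2⟩

/-! ### Right coset spaces `Γ \ G` with the action of `G` by right translation -/

/-- The space `Γ \ G` of cosets `Γ g`. -/
abbrev CosetSpace {G : Type*} [Group G] (Γ : Subgroup G) : Type _ :=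
  Quotient (QuotientGroup.rightRel Γ)

/-- The coset `Γ g`. -/
def coset {G : Type*} [Group G] (Γ : Subgroup G) (g : G) : CosetSpace Γ :=
  Quotient.mk (QuotientGroup.rightRel Γ) g

/-- Right translation `Γ g ↦ Γ g u`. -/
def translate {G : Type*} [Group G] {Γ : Subgroup G} (x : CosetSpace Γ) (u : G) : CosetSpace Γ :=
  Quotient.map (· * u) (by
    intro a b h
    have h' := QuotientGroup.rightRel_apply.mp h
    exact QuotientGroup.rightRel_apply.mpr (by simpa [mul_assoc] using h')) x

theorem translate_coset {G : Type*} [Group G] {Γ : Subgroup G} (g u : G) :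
    translate (coset Γ g) u = coset Γ (g * u) := rfl

theorem translate_translate {G : Type*} [Group G] {Γ : Subgroup G} (x : CosetSpace Γ) (u v : G) :
    translate (translate x u) v = translate x (u * v) := by
  induction x using Quotient.inductionOn with
  | h g => exact congrArg (coset Γ) (mul_assoc g u v)

/-- The invertible matrix `diag(a, b)`. -/
def diagGL {F : Type*} [CommRing F] (a b : Fˣ) : GL (Fin 2) F where
  val := !![(a : F), 0; 0, (b : F)]
  inv := !![((a⁻¹ : Fˣ) : F), 0; 0, ((b⁻¹ : Fˣ) : F)]
  val_inv := by simp [Matrix.one_fin_two]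
  inv_val := by simp [Matrix.one_fin_two]

/-- The class of `diag(a, b)` in `PGL₂`. -/
def diagPGL {F : Type*} [CommRing F] (a b : Fˣ) : PGL(2, F) := ProjGenLinGroup.mk (diagGL a b)

/-- An element of `PGL₂` is upper triangular if it is represented by an upper triangular matrix. -/
def IsUpperTriangular {F : Type*} [CommRing F] (g : PGL(2, F)) : Prop :=
  ∃ m : GL (Fin 2) F, ProjGenLinGroup.mk m = g ∧ (m : Matrix (Fin 2) (Fin 2) F) 1 0 = 0

/-! ### The real quotient `X_∞ = PGL₂(ℤ) \ PGL₂(ℝ)` and periodic orbits -/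

/-- `Γ_∞ = PGL₂(ℤ)` as a subgroup of `PGL₂(ℝ)`. -/
def GammaInf : Subgroup PGL(2, ℝ) := (ProjGenLinGroup.map (n := Fin 2) (Int.castRingHom ℝ)).range

/-- `X_∞ = Γ_∞ \ G_∞`. -/
abbrev XInf : Type := CosetSpace GammaInf

/-- `a_∞(t) = diag(e^t, 1)`. -/
def aInf (t : ℝ) : PGL(2, ℝ) := diagPGL (Units.mk0 (Real.exp t) (Real.exp_ne_zero t)) 1

theorem aInf_mul_comm (s t : ℝ) : aInf s * aInf t = aInf t * aInf s := by
  have h : diagGL (Units.mk0 (Real.exp s) (Real.exp_ne_zero s)) 1 *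
      diagGL (Units.mk0 (Real.exp t) (Real.exp_ne_zero t)) 1 =
      diagGL (Units.mk0 (Real.exp t) (Real.exp_ne_zero t)) 1 *
      diagGL (Units.mk0 (Real.exp s) (Real.exp_ne_zero s)) 1 := by
    apply Units.ext
    simp [diagGL, mul_comm]
  simp only [aInf, diagPGL, ← map_mul, h]

theorem aInf_zero : aInf 0 = 1 := by
  have h : diagGL (Units.mk0 (Real.exp 0) (Real.exp_ne_zero 0)) 1 = 1 := by
    apply Units.ext
    simp [diagGL, Matrix.one_fin_two]
  simp only [aInf, diagPGL, h, map_one]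

/-- The orbit `x A_∞`. -/
def orbit (x : XInf) : Set XInf := Set.range fun t : ℝ => translate x (aInf t)

/-- The orbit `x A_∞` is periodic. -/
def IsPeriodic (x : XInf) : Prop := ∃ t : ℝ, 0 < t ∧ translate x (aInf t) = x

/-- `t_x`: the minimal positive `t` with `x a_∞(t) = x`. -/
def period (x : XInf) : ℝ := sInf {t : ℝ | 0 < t ∧ translate x (aInf t) = x}

theorem period_eq_of_orbit_eq (x y : XInf) (h : orbit x = orbit y) : period x = period y := by
  have key : ∀ x y : XInf, orbit x = orbit y →
      ∀ t : ℝ, translate y (aInf t) = y → translate x (aInf t) = x := by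
    intro x y h t ht
    have hx : x ∈ orbit y := by
      rw [← h]
      refine ⟨0, ?_⟩
      induction x using Quotient.inductionOn with
      | h g =>
        change translate (coset GammaInf g) (aInf 0) = coset GammaInf g
        rw [aInf_zero, translate_coset, mul_one]
    obtain ⟨s, rfl⟩ := hx
    simp only [translate_translate]
    rw [aInf_mul_comm, ← translate_translate, ht]
  have hset : {t : ℝ | 0 < t ∧ translate x (aInf t) = x} =
      {t : ℝ | 0 < t ∧ translate y (aInf t) = y} := by
    ext t
    exact and_congr_right fun _ => ⟨key y x h.symm t, key x y h t⟩
  rw [period, period, hset]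

/-- Two classes are equivalent if they give rise to the same `A_∞`-orbit. -/
def orbitSetoid : Setoid XInf := Setoid.ker orbit

/-- The length `t_x` of an orbit `x A_∞`, as a function on the set of orbits. -/
def orbitLength : Quotient orbitSetoid → ℝ := Quotient.lift period period_eq_of_orbit_eq

/-- `γ = γ_x`: the element of `PGL₂(ℤ)` with `γ⁻¹ g = g a_∞(t_x)`, where `x = Γ_∞ g`. (It is
unique, and it exists if the orbit of `x` is periodic.) -/
def IsGammaOf (g : PGL(2, ℝ)) (γ : PGL(2, ℤ)) : Prop :=
  (ProjGenLinGroup.map (Int.castRingHom ℝ) γ)⁻¹ * g = g * aInf (period (coset GammaInf g))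

/-- `𝔽_x`: the subfield of `ℝ` generated over `ℚ` by the eigenvalues of `γ_x` (that is, of the
integral matrices representing `γ_x`). -/
def fieldOf (x : XInf) : IntermediateField ℚ ℝ :=
  IntermediateField.adjoin ℚ {l : ℝ | ∃ (g : PGL(2, ℝ)) (m : GL (Fin 2) ℤ),
    coset GammaInf g = x ∧ IsGammaOf g (ProjGenLinGroup.mk m) ∧
    l ∈ spectrum ℝ ((m : Matrix (Fin 2) (Fin 2) ℤ).map (Int.cast : ℤ → ℝ))}

/-- The class `x` is split for `S`: some `p ∈ S` splits in the quadratic field `𝔽_x`, i.e. there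
are exactly two primes of its ring of integers above `p`. -/
def IsSplit (S : Finset Nat.Primes) (x : XInf) : Prop :=
  ∃ p ∈ S, ((Ideal.span {((p : ℕ) : ℤ)}).primesOver
    (NumberField.RingOfIntegers (fieldOf x))).ncard = 2

/-! ### Hecke friends and spheres -/

/-- The lattice in `ℝ²` spanned by the rows of `g`. -/
def rowLattice (g : GL (Fin 2) ℝ) : AddSubgroup (Fin 2 → ℝ) :=
  AddSubgroup.closure (Set.range fun i => (g : Matrix (Fin 2) (Fin 2) ℝ) i)

/-- The homothety class of lattices that is the point `x` of `X_∞`. -/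
def lattices (x : XInf) : Set (AddSubgroup (Fin 2 → ℝ)) :=
  {L | ∃ g : GL (Fin 2) ℝ, coset GammaInf (ProjGenLinGroup.mk g) = x ∧ rowLattice g = L}

/-- `x` and `y` are Hecke friends: a lattice in `y` is contained in a lattice in `x`. -/
def HeckeFriends (x y : XInf) : Prop := ∃ L ∈ lattices x, ∃ L' ∈ lattices y, L' ≤ L

/-- `ind(x, y)`: the minimal index `[L : L']` for lattices `L' ≤ L` in the classes `y`, `x`. -/
def ind (x y : XInf) : ℕ :=
  sInf {n : ℕ | ∃ L ∈ lattices x, ∃ L' ∈ lattices y, L' ≤ L ∧ L'.relIndex L = n}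

/-- The ring of `S`-integers `𝒪_S = ℤ[p⁻¹ : p ∈ S]`. -/
def SInt (S : Finset Nat.Primes) : Subring ℚ :=
  Subring.closure {q : ℚ | ∃ p ∈ S, q = ((p : ℕ) : ℚ)⁻¹}

/-- `n ∈ 𝒪_S^×`. -/
def IsSUnit (S : Finset Nat.Primes) (n : ℕ) : Prop := ∃ u : (SInt S)ˣ, ((u : SInt S) : ℚ) = n

/-- The admissible radii, i.e. the elements of `𝒪_S^× ∩ ℕ`. -/
def radii (S : Finset Nat.Primes) : Set ℕ+ := {h | IsSUnit S h}

/-- The vertex set `𝒢_S(x)` of the `S`-Hecke graph: the `S`-Hecke friends of `x`. -/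
def heckeGraph (S : Finset Nat.Primes) (x : XInf) : Set XInf :=
  {y | HeckeFriends x y ∧ IsSUnit S (ind x y)}

/-- The sphere `𝒮_h(x)`. -/
def sphere (S : Finset Nat.Primes) (x : XInf) (h : ℕ+) : Set XInf :=
  {y | y ∈ heckeGraph S x ∧ ind x y = h}

/-- The total length of the union of the orbits through the sphere of radius `h`: every orbit that
meets the sphere contributes its length once. -/
def totalLength (S : Finset Nat.Primes) (x : XInf) (h : ℕ+) : ℝ :=
  ∑ᶠ q ∈ Quotient.mk orbitSetoid '' sphere S x h, orbitLength q

/-! ### The extension `X_S` and generalized branches -/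

/-- `G_S = ∏_{p ∈ S} PGL₂(ℚ_p)`. -/
abbrev GS (S : Finset Nat.Primes) : Type := (p : S) → PGL(2, ℚ_[p.1])

/-- `G_{S^*} = PGL₂(ℝ) × G_S`. -/
abbrev GSStar (S : Finset Nat.Primes) : Type := PGL(2, ℝ) × GS S

/-- `K_S = ∏_{p ∈ S} PGL₂(ℤ_p)`, a subgroup of `G_S`. -/
def KS (S : Finset Nat.Primes) : Subgroup (GS S) :=
  Subgroup.pi Set.univ fun p : S =>
    (ProjGenLinGroup.map (n := Fin 2) (algebraMap ℤ_[p.1] ℚ_[p.1])).range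

/-- The diagonal embedding of `PGL₂(𝒪_S)` into `G_{S^*}`. -/
def diagonalEmbedding (S : Finset Nat.Primes) : PGL(2, SInt S) →* GSStar S :=
  MonoidHom.prod
    (ProjGenLinGroup.map ((algebraMap ℚ ℝ).comp (SInt S).subtype))
    (MonoidHom.pi fun p : S =>
      ProjGenLinGroup.map ((algebraMap ℚ ℚ_[p.1]).comp (SInt S).subtype))

/-- `Γ_S`, embedded diagonally in `G_{S^*}`. -/
def GammaS (S : Finset Nat.Primes) : Subgroup (GSStar S) := (diagonalEmbedding S).range

/-- `X_S = Γ_S \ G_{S^*}`. -/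
abbrev XS (S : Finset Nat.Primes) : Type := CosetSpace (GammaS S)

/-- The projection `π : X_S → X_S / K_S = X_∞`. As `G_S = Γ_S K_S` and `Γ_∞ = Γ_S ∩ K_S`, every
point of `X_S` is of the form `Γ_S (g, k)` with `k ∈ K_S`, and its projection `Γ_∞ g` does not
depend on the choice of `g` and `k`. -/
def proj (S : Finset Nat.Primes) (y : XS S) : XInf :=
  @Classical.epsilon XInf ⟨coset GammaInf 1⟩ fun x =>
    ∃ (g : PGL(2, ℝ)) (k : GS S), k ∈ KS S ∧ coset (GammaS S) (g, k) = y ∧ coset GammaInf g = x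

/-- `a_f(h)`: the identity at `∞`, and `diag(1, h)` at every `p ∈ S`. -/
def aFin (S : Finset Nat.Primes) (h : ℕ+) : GSStar S :=
  (1, fun p => diagPGL 1 (Units.mk0 ((h : ℕ) : ℚ_[p.1]) (Nat.cast_ne_zero.mpr h.ne_zero)))

/-- `x_{ω,h} = π(Γ_S (g, ω) a_f(h))`. -/
def branchPoint (S : Finset Nat.Primes) (g : PGL(2, ℝ)) (ω : GS S) (h : ℕ+) : XInf :=
  proj S (translate (coset (GammaS S) (g, ω)) (aFin S h))

/-- The generalized branch `ℒ_{g,ω}`. -/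
def branch (S : Finset Nat.Primes) (g : PGL(2, ℝ)) (ω : GS S) : Set XInf :=
  branchPoint S g ω '' radii S

/-- The generalized branch `ℒ_{g,ω}` is degenerate: for some `p ∈ S` and some `n > 0` the element
`ω_p⁻¹ γ_x^n ω_p` is upper triangular. -/
def IsDegenerate (S : Finset Nat.Primes) (g : PGL(2, ℝ)) (ω : GS S) : Prop :=
  ∃ γ : PGL(2, ℤ), IsGammaOf g γ ∧ ∃ (p : S) (n : ℕ), 0 < n ∧
    IsUpperTriangular ((ω p)⁻¹ * (ProjGenLinGroup.map (Int.castRingHom ℚ_[p.1]) γ) ^ n * ω p)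

/-- `c_ℒ(h) = t_{x_h} / h` for `ℒ = ℒ_{g,ω}`. -/
def ratio (S : Finset Nat.Primes) (g : PGL(2, ℝ)) (ω : GS S) (h : ℕ+) : ℝ :=
  period (branchPoint S g ω h) / (h : ℕ)

end HeckeGraph

end

open HeckeGraph

/-!
Why the theorem is true.

Let `x = Γ_∞ g`. By strong approximation each point of a generalized branch has the form
`Γ_∞ diag(h, 1) η⁻¹ g` with `η ∈ GL₂(ℤ)` close to `ω_p` for all `p ∈ S` (`exists_frame`). Hence it
lies on the sphere of radius `h` (`branch_inter_sphere`), and `a_∞(t)` stabilizes it exactly if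
`g a_∞(t) g⁻¹` is given by some `δ ∈ PGL₂(𝒪_S)` with `ω_p⁻¹ δ ω_p` in the stabilizer of the vertex
at level `h` for all `p ∈ S` (`translate_branchPoint_iff`). For such `δ` the number `tr² / det` is
an integer, so all these `t` are multiples of a single `u`, with `g a_∞(u) g⁻¹` given by an element
`D` (`exists_generator`), and the period of the branch point is `j_h u`, where `j_h` is the least
common multiple over `p ∈ S` of the exponents with which a power of `ω_p⁻¹ D ω_p` first fixes the
level `p ^ v_p(h)` (`period_branchPoint`).

Locally at `p`, some power of `ω_p⁻¹ D ω_p` is, up to scalars, a matrix `E ≡ 1 mod p²` of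
determinant one, and the lower left entry of `E ^ i` has norm `‖E 1 0‖ ‖i‖`
(`NearOne.norm_pow_apply`). If the branch is non-degenerate, then `E 1 0 ≠ 0`, so the local
exponents are eventually multiplied by `p` from level to level (`eventually_relOrder_levelPow`).
Therefore `j_h / h` only depends on the greatest common divisor of `h` with a fixed number
(`exists_ratio_eq_gcd`), which gives the statement on individual growth
(`finite_and_eventually_const`).

For the total growth, the sphere is contained in the set of classes of the sublattices of index
`h`, which is stable under `a_∞(t_x)` and has at most `∑_{d ∣ h} d ≤ C h` elements by the Hermite
normal form. By the pigeonhole principle an orbit is at most `t_x` times as long as the number of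
points of this set on it (`exists_totalLength_le`). The orbit through the point of one
non-degenerate branch gives the lower bound (`exists_le_totalLength`).

For the criterion, `𝔽_x` is generated by the square root of `tr(γ_x)² - 4`, and `p` splits in it
if and only if this number is a square in `ℚ_p` (`ncard_primesOver_eq_two_iff`), that is, if and
only if `γ_x` has an eigenvector in `ℚ_p²`. The lower left entry of `k⁻¹ A k` is, up to a unit,
the quadratic form `lowerForm A` at the first column of `k`. In the non-split case the forms that
occur have no zeros on the compact set of primitive vectors, so their values are bounded below,
and `j_h ≥ ε h` uniformly over all branches (`exists_le_ratio`). In the split case there are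
primitive vectors close to an eigenvector that are not eigenvectors themselves; on the
corresponding non-degenerate branches `γ_x` still fixes the point of radius `p ^ N`, so the ratio
is at most `t_x / p ^ N` (`exists_ratio_le_of_sq`).
-/

namespace HeckeGraph

/-! ### Projective linear groups over rings, fields and `p`-adic fields -/

theorem pgl_map_injective {R T : Type*} [CommRing R] [CommRing T] (f : R →+* T)
    (hf : Function.Injective f) : Function.Injective (ProjGenLinGroup.map (n := Fin 2) f) := by
  rw [injective_iff_map_eq_one]
  intro a ha
  induction a using ProjGenLinGroup.induction_on with | mk M =>
  rw [ProjGenLinGroup.map_mk, ← map_one ProjGenLinGroup.mk, ProjGenLinGroup.mk_eq_mk_iff] at ha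
  obtain ⟨u, hu⟩ := ha
  have key : ∀ i j, f ((M : Matrix (Fin 2) (Fin 2) R) i j) * (u : T) =
      (1 : Matrix (Fin 2) (Fin 2) T) i j := by
    intro i j
    have := congrArg (fun N : GL (Fin 2) T => (N : Matrix (Fin 2) (Fin 2) T) i j) hu
    simpa using this
  have h01 : (M : Matrix (Fin 2) (Fin 2) R) 0 1 = 0 := by
    apply hf; have := key 0 1; simpa using this
  have h10 : (M : Matrix (Fin 2) (Fin 2) R) 1 0 = 0 := by
    apply hf; have := key 1 0; simpa using this
  have h11 : (M : Matrix (Fin 2) (Fin 2) R) 0 0 = (M : Matrix (Fin 2) (Fin 2) R) 1 1 := by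
    apply hf
    have h0 := key 0 0
    have h1 := key 1 1
    simp only [Matrix.one_apply_eq] at h0 h1
    exact (Units.mul_left_inj u).1 (h0.trans h1.symm)
  rw [← map_one ProjGenLinGroup.mk]
  have hdet : IsUnit (M : Matrix (Fin 2) (Fin 2) R).det := by
    simp
  rw [Matrix.det_fin_two, h01, h10, h11] at hdet
  have h1 : IsUnit ((M : Matrix (Fin 2) (Fin 2) R) 1 1) := by
    rw [zero_mul, sub_zero] at hdet
    exact isUnit_of_mul_isUnit_left hdet
  symm
  rw [ProjGenLinGroup.mk_eq_mk_iff]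
  refine ⟨h1.unit, ?_⟩
  ext i j
  fin_cases i <;> fin_cases j <;> simp [h01, h10, h11]

theorem mk_eq_mk_iff_smul {K : Type*} [Field K] {M N : GL (Fin 2) K} :
    (ProjGenLinGroup.mk M = ProjGenLinGroup.mk N) ↔
      ∃ c : K, c ≠ 0 ∧ (N : Matrix (Fin 2) (Fin 2) K) = c • (M : Matrix (Fin 2) (Fin 2) K) := by
  rw [ProjGenLinGroup.mk_eq_mk_iff]
  constructor
  · rintro ⟨u, rfl⟩
    refine ⟨u, u.ne_zero, ?_⟩
    ext i j
    simp [mul_comm]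
  · rintro ⟨c, hc, h⟩
    refine ⟨Units.mk0 c hc, ?_⟩
    ext i j
    simp [h, mul_comm]

theorem det_ne_zero_GL {K : Type*} [Field K] (M : GL (Fin 2) K) :
    (M : Matrix (Fin 2) (Fin 2) K).det ≠ 0 := by
  have := M.det.ne_zero
  simpa using this

/-- `PGL₂(ℤ_p)` as a subgroup of `PGL₂(ℚ_p)`. -/
noncomputable def intPGL (p : ℕ) [Fact p.Prime] : Subgroup PGL(2, ℚ_[p]) :=
  (ProjGenLinGroup.map (n := Fin 2) (algebraMap ℤ_[p] ℚ_[p])).range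

theorem mk_mem_intPGL_iff {p : ℕ} [Fact p.Prime] (M : GL (Fin 2) ℚ_[p]) :
    (ProjGenLinGroup.mk M ∈ intPGL p) ↔ ∃ c : ℚ_[p],
      (∀ i j, ‖c * (M : Matrix (Fin 2) (Fin 2) ℚ_[p]) i j‖ ≤ 1) ∧
      ‖c ^ 2 * (M : Matrix (Fin 2) (Fin 2) ℚ_[p]).det‖ = 1 := by
  constructor
  · rintro ⟨N, hN⟩
    induction N using ProjGenLinGroup.induction_on with | mk N =>
    rw [ProjGenLinGroup.map_mk, eq_comm, mk_eq_mk_iff_smul] at hN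
    obtain ⟨c, hc, h⟩ := hN
    refine ⟨c, fun i j => ?_, ?_⟩
    · have := congrFun (congrFun h i) j
      simp only [Matrix.smul_apply, smul_eq_mul] at this
      rw [← this]
      exact ((N : Matrix (Fin 2) (Fin 2) ℤ_[p]) i j).2
    · have h2 := congrArg Matrix.det h
      rw [Matrix.det_smul, Fintype.card_fin] at h2
      rw [← h2]
      have h3 : IsUnit (N : Matrix (Fin 2) (Fin 2) ℤ_[p]).det := by
        simp
      rw [PadicInt.isUnit_iff] at h3
      have h4 : ((Matrix.GeneralLinearGroup.map (algebraMap ℤ_[p] ℚ_[p]) N :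
          GL (Fin 2) ℚ_[p]) : Matrix (Fin 2) (Fin 2) ℚ_[p]).det =
          ((N : Matrix (Fin 2) (Fin 2) ℤ_[p]).det : ℚ_[p]) := by
        rw [Matrix.det_fin_two, Matrix.det_fin_two]
        push_cast
        rfl
      rw [h4]
      exact h3
  · rintro ⟨c, hc, hd⟩
    let N : Matrix (Fin 2) (Fin 2) ℤ_[p] := Matrix.of fun i j => ⟨_, hc i j⟩
    have hN : (N.det : ℚ_[p]) = c ^ 2 * (M : Matrix (Fin 2) (Fin 2) ℚ_[p]).det := by
      rw [Matrix.det_fin_two, Matrix.det_fin_two]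
      change c * _ * (c * _) - c * _ * (c * _) = _
      ring
    have hu : IsUnit N.det := by
      rw [PadicInt.isUnit_iff, PadicInt.norm_def, hN]
      exact hd
    have hc0 : c ≠ 0 := by
      rintro rfl
      simp at hd
    refine ⟨ProjGenLinGroup.mk (Matrix.GeneralLinearGroup.mk'' N hu), ?_⟩
    rw [ProjGenLinGroup.map_mk, eq_comm, mk_eq_mk_iff_smul]
    refine ⟨c, hc0, ?_⟩
    ext i j
    rfl

/-- Conjugation by `diag(1, h)` turns the integrality condition on the entries `a, b, c, d` into
a condition on `a, h b, c / h, d`. -/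
theorem diag_conj_mem_intPGL_iff {p : ℕ} [Fact p.Prime] (h : (ℚ_[p])ˣ) (M : GL (Fin 2) ℚ_[p]) :
    ((diagPGL 1 h)⁻¹ * ProjGenLinGroup.mk M * diagPGL 1 h ∈ intPGL p) ↔ ∃ c : ℚ_[p],
      ‖c * (M : Matrix (Fin 2) (Fin 2) ℚ_[p]) 0 0‖ ≤ 1 ∧
      ‖c * (M : Matrix (Fin 2) (Fin 2) ℚ_[p]) 0 1‖ * ‖(h : ℚ_[p])‖ ≤ 1 ∧
      ‖c * (M : Matrix (Fin 2) (Fin 2) ℚ_[p]) 1 0‖ ≤ ‖(h : ℚ_[p])‖ ∧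
      ‖c * (M : Matrix (Fin 2) (Fin 2) ℚ_[p]) 1 1‖ ≤ 1 ∧
      ‖c ^ 2 * (M : Matrix (Fin 2) (Fin 2) ℚ_[p]).det‖ = 1 := by
  have h0 : 0 < ‖(h : ℚ_[p])‖ := norm_pos_iff.2 h.ne_zero
  rw [diagPGL, ← map_inv, ← map_mul, ← map_mul, mk_mem_intPGL_iff]
  refine exists_congr fun c => ?_
  have e00 : (((diagGL 1 h)⁻¹ * M * diagGL 1 h : GL (Fin 2) ℚ_[p]) :
      Matrix (Fin 2) (Fin 2) ℚ_[p]) = !![(M : Matrix (Fin 2) (Fin 2) ℚ_[p]) 0 0,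
        (M : Matrix (Fin 2) (Fin 2) ℚ_[p]) 0 1 * h;
        (h : ℚ_[p])⁻¹ * (M : Matrix (Fin 2) (Fin 2) ℚ_[p]) 1 0,
        (M : Matrix (Fin 2) (Fin 2) ℚ_[p]) 1 1] := by
    change !![(((1 : (ℚ_[p])ˣ)⁻¹ : (ℚ_[p])ˣ) : ℚ_[p]), 0; 0, ((h⁻¹ : (ℚ_[p])ˣ) : ℚ_[p])] *
      (M : Matrix (Fin 2) (Fin 2) ℚ_[p]) * !![((1 : (ℚ_[p])ˣ) : ℚ_[p]), 0; 0, (h : ℚ_[p])] = _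
    conv_lhs => rw [Matrix.eta_fin_two (M : Matrix (Fin 2) (Fin 2) ℚ_[p])]
    have := h.ne_zero
    rw [Matrix.mul_fin_two, Matrix.mul_fin_two]
    ext i j
    fin_cases i <;> fin_cases j <;> simp
    rw [mul_right_comm, inv_mul_cancel₀ h.ne_zero, one_mul]
  have hd : (((diagGL 1 h)⁻¹ * M * diagGL 1 h : GL (Fin 2) ℚ_[p]) :
      Matrix (Fin 2) (Fin 2) ℚ_[p]).det = (M : Matrix (Fin 2) (Fin 2) ℚ_[p]).det := by
    rw [e00, Matrix.det_fin_two, Matrix.det_fin_two]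
    simp
    field_simp
  rw [hd, e00]
  simp only [Fin.forall_fin_two]
  simp only [Matrix.of_apply, Matrix.cons_val', Matrix.cons_val_zero, Matrix.cons_val_one,
    Matrix.cons_val_fin_one]
  have h1 : ‖c * ((M : Matrix (Fin 2) (Fin 2) ℚ_[p]) 0 1 * h)‖ =
      ‖c * (M : Matrix (Fin 2) (Fin 2) ℚ_[p]) 0 1‖ * ‖(h : ℚ_[p])‖ := by
    rw [← mul_assoc, norm_mul]
  have h2 : ‖c * ((h : ℚ_[p])⁻¹ * (M : Matrix (Fin 2) (Fin 2) ℚ_[p]) 1 0)‖ =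
      ‖c * (M : Matrix (Fin 2) (Fin 2) ℚ_[p]) 1 0‖ / ‖(h : ℚ_[p])‖ := by
    simp only [norm_mul, norm_inv]; ring
  rw [h1, h2, div_le_one h0]
  tauto

/-! ### Gluing: `PGL₂(𝒪_S) ∩ ∏ PGL₂(ℤ_p) = PGL₂(ℤ)` -/

theorem SInt_norm_le {S : Finset Nat.Primes} {q : ℚ} (hq : q ∈ SInt S) (p : Nat.Primes)
    (hp : p ∉ S) : ‖(q : ℚ_[p])‖ ≤ 1 := by
  have hle : SInt S ≤ (PadicInt.subring (p : ℕ)).comap (algebraMap ℚ ℚ_[p]) := by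
    rw [SInt, Subring.closure_le]
    rintro _ ⟨r, hr, rfl⟩
    change ‖((((r : ℕ) : ℚ)⁻¹ : ℚ) : ℚ_[p])‖ ≤ 1
    push_cast
    rw [norm_inv]
    have : ‖((r : ℕ) : ℚ_[p])‖ = 1 := by
      rw [Padic.norm_natCast_eq_one_iff]
      refine (Nat.coprime_primes p.2 r.2).2 fun h => hp ?_
      rwa [Subtype.ext h]
    rw [this, inv_one]
  exact hle hq

/-- A rational number that is `p`-integral for all `p` is an integer. -/
theorem exists_int_of_norm_le {q : ℚ} (h : ∀ p : Nat.Primes, ‖(q : ℚ_[p])‖ ≤ 1) :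
    ∃ n : ℤ, (n : ℚ) = q := by
  have : q.den = 1 := by
    by_contra hd
    obtain ⟨p, hp, hpd⟩ := Nat.exists_prime_and_dvd hd
    have : Fact p.Prime := ⟨hp⟩
    have h1 := h ⟨p, hp⟩
    have h2 := PadicInt.isUnit_iff.1 (PadicInt.isUnit_den q h1)
    rw [PadicInt.norm_natCast_eq_one_iff] at h2
    exact (Nat.Prime.coprime_iff_not_dvd hp).1 h2 hpd
  exact ⟨q.num, Rat.coe_int_num_of_den_eq_one this⟩

theorem norm_eq_one_of_mem_inv_mem {S : Finset Nat.Primes} {q : ℚ} (hq : q ∈ SInt S)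
    (hq' : q⁻¹ ∈ SInt S) (hq0 : q ≠ 0) (p : Nat.Primes) (hp : p ∉ S) : ‖(q : ℚ_[p])‖ = 1 := by
  have h1 := SInt_norm_le hq p hp
  have h2 := SInt_norm_le hq' p hp
  have hne : (q : ℚ_[p]) ≠ 0 := by exact_mod_cast hq0
  rw [Rat.cast_inv, norm_inv] at h2
  exact le_antisymm h1 ((inv_le_one₀ (norm_pos_iff.2 hne)).1 h2)

theorem SInt_unit_norm {S : Finset Nat.Primes} (u : (SInt S)ˣ) (p : Nat.Primes) (hp : p ∉ S) :
    ‖(((u : SInt S) : ℚ) : ℚ_[p])‖ = 1 := by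
  have h : ((u : SInt S) : ℚ) * ((u⁻¹ : (SInt S)ˣ) : SInt S) = 1 := by
    exact_mod_cast congrArg (Subtype.val : SInt S → ℚ) u.mul_inv
  have hu0 : ((u : SInt S) : ℚ) ≠ 0 := left_ne_zero_of_mul_eq_one h
  refine norm_eq_one_of_mem_inv_mem (u : SInt S).2 ?_ hu0 p hp
  rw [← eq_inv_of_mul_eq_one_right h]
  exact ((u⁻¹ : (SInt S)ˣ) : SInt S).2

theorem inv_prime_mem_SInt {S : Finset Nat.Primes} {p : Nat.Primes} (hp : p ∈ S) :
    (((p : ℕ) : ℚ))⁻¹ ∈ SInt S := Subring.subset_closure ⟨p, hp, rfl⟩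

/-- The admissible radii are the positive integers all of whose prime factors lie in `S`. -/
theorem mem_radii_iff {S : Finset Nat.Primes} {h : ℕ+} :
    h ∈ radii S ↔ ∀ p : Nat.Primes, (p : ℕ) ∣ h → p ∈ S := by
  constructor
  · rintro ⟨u, hu⟩ p hp
    by_contra hpS
    have h1 := SInt_unit_norm u p hpS
    rw [hu] at h1
    push_cast at h1
    rw [Padic.norm_natCast_eq_one_iff] at h1
    exact (Nat.Prime.coprime_iff_not_dvd p.2).1 h1 hp
  · intro hh
    have key : ∀ n : ℕ, n ≠ 0 → (∀ p : Nat.Primes, (p : ℕ) ∣ n → p ∈ S) →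
        ((n : ℚ))⁻¹ ∈ SInt S := by
      intro n
      induction n using Nat.recOnMul with
      | zero => simp
      | one => intro _ _; simp [one_mem]
      | prime p hp =>
        intro _ h
        exact inv_prime_mem_SInt (p := ⟨p, hp⟩) (h _ dvd_rfl)
      | mul a b iha ihb =>
        intro hab h
        have ha := iha (left_ne_zero_of_mul hab) fun p hp => h p (hp.mul_right _)
        have hb := ihb (right_ne_zero_of_mul hab) fun p hp => h p (hp.mul_left _)
        push_cast
        rw [mul_inv]
        exact mul_mem ha hb
    have h0 : ((h : ℕ) : ℚ) ≠ 0 := by exact_mod_cast h.ne_zero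
    refine ⟨⟨⟨(h : ℕ), natCast_mem _ _⟩, ⟨((h : ℕ) : ℚ)⁻¹, key h h.ne_zero hh⟩, ?_, ?_⟩, rfl⟩
    · exact Subtype.ext (mul_inv_cancel₀ h0)
    · exact Subtype.ext (inv_mul_cancel₀ h0)

/-- Rational numbers with prescribed valuations at the primes of `S` and trivial ones elsewhere. -/
theorem exists_rat_norm_eq (S : Finset Nat.Primes) (v : Nat.Primes → ℤ) :
    ∃ c : ℚ, c ≠ 0 ∧ (∀ p ∈ S, ‖(c : ℚ_[p])‖ = (p : ℝ) ^ (-v p)) ∧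
      ∀ p ∉ S, ‖(c : ℚ_[p])‖ = 1 := by
  classical
  have hpow : ∀ p q : Nat.Primes, ‖((((p : ℕ) : ℚ) ^ v p : ℚ) : ℚ_[q])‖ =
      if p = q then (p : ℝ) ^ (-v p) else 1 := by
    intro p q
    push_cast
    rw [norm_zpow]
    split_ifs with h
    · subst h
      rw [Padic.norm_p, inv_zpow, zpow_neg]
    · have : ‖((p : ℕ) : ℚ_[q])‖ = 1 := by
        rw [Padic.norm_natCast_eq_one_iff]
        exact (Nat.coprime_primes q.2 p.2).2 fun h' => h (Subtype.ext h'.symm)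
      rw [this, one_zpow]
  refine ⟨∏ p ∈ S, ((p : ℕ) : ℚ) ^ v p, ?_, ?_, ?_⟩
  · exact Finset.prod_ne_zero_iff.2 fun p _ => zpow_ne_zero _ (by exact_mod_cast p.2.ne_zero)
  · intro q hq
    rw [Rat.cast_prod, norm_prod, Finset.prod_congr rfl fun p _ => hpow p q,
      Finset.prod_ite_eq' S q, if_pos hq]
  · intro q hq
    rw [Rat.cast_prod, norm_prod, Finset.prod_congr rfl fun p _ => hpow p q,
      Finset.prod_ite_eq' S q, if_neg hq]

theorem det_map_GL {R T : Type*} [CommRing R] [CommRing T] (f : R →+* T) (M : GL (Fin 2) R) :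
    ((Matrix.GeneralLinearGroup.map f M : GL (Fin 2) T) : Matrix (Fin 2) (Fin 2) T).det =
      f (M : Matrix (Fin 2) (Fin 2) R).det := by
  rw [Matrix.det_fin_two, Matrix.det_fin_two]
  simp

/-- An element of `PGL₂(𝒪_S)` that is integral at every `p ∈ S` comes from `PGL₂(ℤ)`. -/
theorem exists_int_of_forall_mem_intPGL {S : Finset Nat.Primes} (d : PGL(2, SInt S))
    (hd : ∀ p ∈ S, ProjGenLinGroup.map ((algebraMap ℚ ℚ_[p]).comp (SInt S).subtype) d ∈
      intPGL p) :
    ∃ r : PGL(2, ℤ), ProjGenLinGroup.map (Int.castRingHom (SInt S)) r = d := by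
  induction d using ProjGenLinGroup.induction_on with | mk M =>
  simp only [ProjGenLinGroup.map_mk, mk_mem_intPGL_iff] at hd
  let m : Fin 2 → Fin 2 → ℚ := fun i j => ((M : Matrix (Fin 2) (Fin 2) (SInt S)) i j : ℚ)
  let D : ℚ := ((M : Matrix (Fin 2) (Fin 2) (SInt S)).det : ℚ)
  have hDm : D = m 0 0 * m 1 1 - m 0 1 * m 1 0 := by
    simp only [D, m]
    rw [Matrix.det_fin_two]
    push_cast
    rfl
  have hd1 : ∀ p ∈ S, ∃ v : ℤ, ∀ c : ℚ, ‖(c : ℚ_[p])‖ = (p : ℝ) ^ (-v) →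
      (∀ i j, ‖((c * m i j : ℚ) : ℚ_[p])‖ ≤ 1) ∧ ‖((c ^ 2 * D : ℚ) : ℚ_[p])‖ = 1 := by
    intro p hp
    obtain ⟨c, h1, h2⟩ := hd p hp
    have hc0 : c ≠ 0 := by rintro rfl; simp at h2
    refine ⟨c.valuation, fun c' hc' => ?_⟩
    rw [← Padic.norm_eq_zpow_neg_valuation hc0] at hc'
    refine ⟨fun i j => ?_, ?_⟩
    · have := h1 i j
      push_cast
      rw [norm_mul] at this ⊢
      rw [hc']
      exact this
    · rw [det_map_GL] at h2
      push_cast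
      rw [norm_mul, norm_pow] at h2 ⊢
      rw [hc']
      exact h2
  choose! v hv using hd1
  obtain ⟨c, hc0, hcS, hcN⟩ := exists_rat_norm_eq S v
  have hall : ∀ p : Nat.Primes, (∀ i j, ‖((c * m i j : ℚ) : ℚ_[p])‖ ≤ 1) ∧
      ‖((c ^ 2 * D : ℚ) : ℚ_[p])‖ = 1 := by
    intro p
    by_cases hp : p ∈ S
    · exact hv p hp c (hcS p hp)
    · have hdet : IsUnit (M : Matrix (Fin 2) (Fin 2) (SInt S)).det := by simp
      have h1 := SInt_unit_norm hdet.unit p hp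
      constructor
      · intro i j
        push_cast
        rw [norm_mul, hcN p hp, one_mul]
        exact SInt_norm_le (Subtype.property _) p hp
      · push_cast
        rw [norm_mul, norm_pow, hcN p hp, one_pow, one_mul]
        exact h1
  choose n hn using fun i j => exists_int_of_norm_le fun p => (hall p).1 i j
  let N : Matrix (Fin 2) (Fin 2) ℤ := Matrix.of n
  have hNd : ((N.det : ℤ) : ℚ) = c ^ 2 * D := by
    rw [Matrix.det_fin_two, hDm]
    push_cast
    simp only [N, Matrix.of_apply, hn]
    ring
  have hNu : IsUnit N.det := by
    rw [Int.isUnit_iff_natAbs_eq]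
    by_contra hne
    obtain ⟨p, hp, hpd⟩ := Nat.exists_prime_and_dvd hne
    have := (hall ⟨p, hp⟩).2
    rw [← hNd] at this
    have hF : Fact p.Prime := ⟨hp⟩
    rw [Rat.cast_intCast] at this
    have h2 : ‖((N.det : ℤ) : ℚ_[p])‖ < 1 :=
      Padic.norm_intCast_lt_one_iff.2 (Int.natCast_dvd.2 hpd)
    exact h2.ne this
  refine ⟨ProjGenLinGroup.mk (Matrix.GeneralLinearGroup.mk'' N hNu), ?_⟩
  apply pgl_map_injective (SInt S).subtype Subtype.val_injective
  rw [← MonoidHom.comp_apply, ← ProjGenLinGroup.map_comp, ProjGenLinGroup.map_mk,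
    ProjGenLinGroup.map_mk, eq_comm, mk_eq_mk_iff_smul]
  refine ⟨c, hc0, ?_⟩
  ext i j
  exact hn i j

/-! ### Branch points and their stabilizers -/

theorem coset_eq_iff {G : Type*} [Group G] {Γ : Subgroup G} {a b : G} :
    coset Γ a = coset Γ b ↔ ∃ γ ∈ Γ, γ * a = b := by
  rw [coset, coset, Quotient.eq, QuotientGroup.rightRel_apply]
  constructor
  · intro h
    exact ⟨_, h, by group⟩
  · rintro ⟨γ, h, rfl⟩
    simpa using h

/-- The embedding of `PGL₂(𝒪_S)` at the real place. -/
noncomputable def realPlace (S : Finset Nat.Primes) : PGL(2, SInt S) →* PGL(2, ℝ) :=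
  ProjGenLinGroup.map ((algebraMap ℚ ℝ).comp (SInt S).subtype)

/-- The embedding of `PGL₂(𝒪_S)` at the place `p`. -/
noncomputable def padicPlace (S : Finset Nat.Primes) (p : Nat.Primes) :
    PGL(2, SInt S) →* PGL(2, ℚ_[p]) :=
  ProjGenLinGroup.map ((algebraMap ℚ ℚ_[p]).comp (SInt S).subtype)

/-- The inclusion of `PGL₂(ℤ)` in `PGL₂(𝒪_S)`. -/
noncomputable def ofIntPGL (S : Finset Nat.Primes) : PGL(2, ℤ) →* PGL(2, SInt S) :=
  ProjGenLinGroup.map (Int.castRingHom (SInt S))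

theorem realPlace_injective (S : Finset Nat.Primes) : Function.Injective (realPlace S) :=
  pgl_map_injective _ ((algebraMap ℚ ℝ).injective.comp Subtype.val_injective)

theorem realPlace_ofIntPGL (S : Finset Nat.Primes) (r : PGL(2, ℤ)) :
    realPlace S (ofIntPGL S r) = ProjGenLinGroup.map (Int.castRingHom ℝ) r := by
  rw [realPlace, ofIntPGL, ← MonoidHom.comp_apply, ← ProjGenLinGroup.map_comp]
  congr 2

theorem padicPlace_ofIntPGL (S : Finset Nat.Primes) (p : Nat.Primes) (r : PGL(2, ℤ)) :
    padicPlace S p (ofIntPGL S r) = ProjGenLinGroup.map (Int.castRingHom ℚ_[p]) r := by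
  rw [padicPlace, ofIntPGL, ← MonoidHom.comp_apply, ← ProjGenLinGroup.map_comp]
  congr 2

theorem map_int_mem_intPGL {p : ℕ} [Fact p.Prime] (r : PGL(2, ℤ)) :
    ProjGenLinGroup.map (Int.castRingHom ℚ_[p]) r ∈ intPGL p := by
  refine ⟨ProjGenLinGroup.map (Int.castRingHom ℤ_[p]) r, ?_⟩
  rw [← MonoidHom.comp_apply, ← ProjGenLinGroup.map_comp]
  congr 2

theorem realPlace_mem_GammaInf_iff {S : Finset Nat.Primes} {d : PGL(2, SInt S)} :
    realPlace S d ∈ GammaInf ↔ ∀ p ∈ S, padicPlace S p d ∈ intPGL p := by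
  constructor
  · rintro ⟨r, hr⟩ p _
    rw [← realPlace_ofIntPGL S] at hr
    rw [← realPlace_injective S hr, padicPlace_ofIntPGL]
    exact map_int_mem_intPGL r
  · intro h
    obtain ⟨r, rfl⟩ := exists_int_of_forall_mem_intPGL d h
    exact ⟨r, (realPlace_ofIntPGL S r).symm⟩

theorem mem_KS_iff {S : Finset Nat.Primes} {k : GS S} :
    k ∈ KS S ↔ ∀ p : S, k p ∈ intPGL p.1 := by
  simp [KS, Subgroup.mem_pi, intPGL]

theorem coset_GammaS_eq_iff {S : Finset Nat.Primes} {a b : GSStar S} :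
    coset (GammaS S) a = coset (GammaS S) b ↔
      ∃ d : PGL(2, SInt S), realPlace S d * a.1 = b.1 ∧
        ∀ p : S, padicPlace S p d * a.2 p = b.2 p := by
  rw [coset_eq_iff]
  constructor
  · rintro ⟨_, ⟨d, rfl⟩, h⟩
    refine ⟨d, congrArg Prod.fst h, fun p => congrFun (congrArg Prod.snd h) p⟩
  · rintro ⟨d, h1, h2⟩
    exact ⟨_, ⟨d, rfl⟩, Prod.ext h1 (funext h2)⟩

theorem proj_coset {S : Finset Nat.Primes} (g : PGL(2, ℝ)) {k : GS S} (hk : k ∈ KS S) :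
    proj S (coset (GammaS S) (g, k)) = coset GammaInf g := by
  have hex : ∃ x : XInf, ∃ (g' : PGL(2, ℝ)) (k' : GS S), k' ∈ KS S ∧
      coset (GammaS S) (g', k') = coset (GammaS S) (g, k) ∧ coset GammaInf g' = x :=
    ⟨_, g, k, hk, rfl, rfl⟩
  obtain ⟨g', k', hk', h1, h2⟩ := Classical.epsilon_spec hex
  rw [proj, ← h2]
  obtain ⟨d, hd1, hd2⟩ := coset_GammaS_eq_iff.1 h1
  rw [coset_eq_iff]
  refine ⟨realPlace S d, ?_, hd1⟩
  rw [realPlace_mem_GammaInf_iff]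
  intro p hp
  have := hd2 ⟨p, hp⟩
  rw [← eq_mul_inv_iff_mul_eq] at this
  change padicPlace S p d = _ at this
  rw [this]
  exact mul_mem (mem_KS_iff.1 hk ⟨p, hp⟩) (inv_mem (mem_KS_iff.1 hk' ⟨p, hp⟩))

/-- The radius `h` as a unit of a field of characteristic zero. -/
noncomputable def radiusUnit (K : Type*) [Field K] [CharZero K] (h : ℕ+) : Kˣ :=
  Units.mk0 ((h : ℕ) : K) (Nat.cast_ne_zero.mpr h.ne_zero)

theorem map_diagPGL {R T : Type*} [CommRing R] [CommRing T] (f : R →+* T) (a b : Rˣ) :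
    ProjGenLinGroup.map f (diagPGL a b) = diagPGL (Units.map f a) (Units.map f b) := by
  rw [diagPGL, diagPGL, ProjGenLinGroup.map_mk]
  congr 1
  ext i j
  fin_cases i <;> fin_cases j <;> simp [diagGL]

theorem exists_radius_diag {S : Finset Nat.Primes} {h : ℕ+} (hh : h ∈ radii S) :
    ∃ d : PGL(2, SInt S), realPlace S d = diagPGL 1 (radiusUnit ℝ h) ∧
      ∀ p, padicPlace S p d = diagPGL 1 (radiusUnit ℚ_[p] h) := by
  obtain ⟨u, hu⟩ := hh
  refine ⟨diagPGL 1 u, ?_, fun p => ?_⟩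
  · rw [realPlace, map_diagPGL, map_one]
    congr 1
    ext
    simp [radiusUnit, hu]
  · rw [padicPlace, map_diagPGL, map_one]
    congr 1
    ext
    simp [radiusUnit, hu]

theorem level_of_int {p : ℕ} [Fact p.Prime] (h : (ℚ_[p])ˣ) (hh : ‖(h : ℚ_[p])‖ ≤ 1)
    (N : GL (Fin 2) ℤ_[p])
    (hN : ‖(N : Matrix (Fin 2) (Fin 2) ℤ_[p]) 1 0‖ ≤ ‖(h : ℚ_[p])‖) :
    (diagPGL 1 h)⁻¹ * ProjGenLinGroup.map (algebraMap ℤ_[p] ℚ_[p]) (ProjGenLinGroup.mk N) *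
      diagPGL 1 h ∈ intPGL p := by
  rw [ProjGenLinGroup.map_mk, diag_conj_mem_intPGL_iff]
  refine ⟨1, ?_, ?_, ?_, ?_, ?_⟩
  · rw [one_mul]; exact PadicInt.norm_le_one _
  · rw [one_mul]
    exact mul_le_one₀ (PadicInt.norm_le_one _) (norm_nonneg _) hh
  · rw [one_mul]; exact hN
  · rw [one_mul]; exact PadicInt.norm_le_one _
  · have : IsUnit (N : Matrix (Fin 2) (Fin 2) ℤ_[p]).det := by simp
    rw [PadicInt.isUnit_iff] at this
    rw [one_pow, one_mul, det_map_GL]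
    exact this

theorem norm_radius_le_one (p : ℕ) [Fact p.Prime] (h : ℕ+) :
    ‖(radiusUnit ℚ_[p] h : ℚ_[p])‖ ≤ 1 := by
  have := Padic.norm_int_le_one (p := p) (h : ℕ)
  simpa [radiusUnit] using this

/-- Simultaneous approximation of `p`-adic integers by an integer. -/
theorem exists_int_approx (S : Finset Nat.Primes) (a : (p : Nat.Primes) → ℤ_[p]) (n : ℕ) :
    ∃ x : ℤ, ∀ p ∈ S, ‖((x : ℤ) : ℤ_[p]) - a p‖ ≤ (p : ℝ) ^ (-n : ℤ) := by
  have hprime : ∀ p : Nat.Primes, Prime (Ideal.span {((p : ℕ) : ℤ)}) := by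
    intro p
    have hp := Nat.prime_iff_prime_int.1 p.2
    exact Ideal.prime_of_isPrime (by simpa using hp.ne_zero)
      ((Ideal.span_singleton_prime hp.ne_zero).2 hp)
  obtain ⟨x, hx⟩ := IsDedekindDomain.exists_forall_sub_mem_ideal (R := ℤ) (s := S)
    (fun p : Nat.Primes => Ideal.span {((p : ℕ) : ℤ)}) (fun _ => n) (fun p _ => hprime p)
    (fun p _ q _ hpq h => hpq (by
      rw [Ideal.span_singleton_eq_span_singleton, Int.associated_iff_natAbs] at h
      exact Subtype.ext (by simpa using h)))
    (fun p => ((a p).appr n : ℤ))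
  refine ⟨x, fun p hp => ?_⟩
  have h1 := hx p hp
  rw [Ideal.span_singleton_pow, Ideal.mem_span_singleton] at h1
  have h2 := PadicInt.norm_int_le_pow_iff_dvd.2 h1
  have h3 := (PadicInt.norm_le_pow_iff_mem_span_pow _ n).2 (PadicInt.appr_spec n (a p))
  have h4 : ((x : ℤ) : ℤ_[p]) - a p = ((x - ((a p).appr n : ℤ) : ℤ) : ℤ_[p]) -
      (a p - ((a p).appr n : ℕ)) := by
    push_cast; ring
  rw [h4, sub_eq_add_neg]
  refine (PadicInt.nonarchimedean _ _).trans (max_le h2 ?_)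
  rwa [norm_neg]

theorem pow_neg_le_norm_radius (p : ℕ) [hp : Fact p.Prime] (h : ℕ+) :
    (p : ℝ) ^ (-((h : ℕ) : ℤ)) ≤ ‖(radiusUnit ℚ_[p] h : ℚ_[p])‖ := by
  by_contra! hlt
  have h1 : ((p : ℤ) ^ (h : ℕ)) ∣ ((h : ℕ) : ℤ) := by
    rw [← Padic.norm_int_le_pow_iff_dvd (p := p)]
    simpa [radiusUnit] using hlt.le
  have h2 : p ^ (h : ℕ) ∣ (h : ℕ) := by exact_mod_cast h1
  exact absurd (Nat.le_of_dvd h.pos h2) (not_le.2 (Nat.lt_pow_self hp.1.one_lt))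

/-- Strong approximation: the column lattice `ω_p diag(1, h) ℤ_p²` is, for all `p` at once, of the
form `η diag(1, h) ℤ_p²` with `η ∈ GL₂(ℤ)`. -/
theorem exists_int_frame {S : Finset Nat.Primes} {ω : GS S} (hω : ω ∈ KS S) (h : ℕ+) :
    ∃ η : GL (Fin 2) ℤ, ∀ p : S, (diagPGL 1 (radiusUnit ℚ_[p.1] h))⁻¹ *
      ((ProjGenLinGroup.map (Int.castRingHom ℚ_[p.1]) (ProjGenLinGroup.mk η))⁻¹ * ω p) *
      diagPGL 1 (radiusUnit ℚ_[p.1] h) ∈ intPGL p.1 := by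
  rcases S.eq_empty_or_nonempty with rfl | hS
  · exact ⟨1, fun p => absurd p.2 (Finset.notMem_empty _)⟩
  have hlift : ∀ p : Nat.Primes, ∃ N : GL (Fin 2) ℤ_[p], ∀ hp : p ∈ S,
      ProjGenLinGroup.map (algebraMap ℤ_[p] ℚ_[p]) (ProjGenLinGroup.mk N) = ω ⟨p, hp⟩ := by
    intro p
    by_cases hp : p ∈ S
    · obtain ⟨N, hN⟩ := mem_KS_iff.1 hω ⟨p, hp⟩
      obtain ⟨N, rfl⟩ := ProjGenLinGroup.mk_surjective N
      exact ⟨N, fun _ => hN⟩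
    · exact ⟨1, fun hp' => absurd hp' hp⟩
  choose N hN using hlift
  obtain ⟨x, hx⟩ := exists_int_approx S
    (fun p => (N p : Matrix (Fin 2) (Fin 2) ℤ_[p]) 0 0) h
  obtain ⟨y, hy⟩ := exists_int_approx S
    (fun p => (N p : Matrix (Fin 2) (Fin 2) ℤ_[p]) 1 0) h
  -- at least one of the two coordinates of the primitive vector is a unit
  have hprim : ∀ p ∈ S, ¬ (((p : ℕ) : ℤ) ∣ x ∧ ((p : ℕ) : ℤ) ∣ y) := by
    rintro p hp ⟨hpx, hpy⟩
    have hlt : ((p : ℕ) : ℝ) ^ (-((h : ℕ) : ℤ)) < 1 :=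
      zpow_lt_one_of_neg₀ (by exact_mod_cast p.2.one_lt) (by have := h.pos; lia)
    have small : ∀ (z : ℤ) (a : ℤ_[p]), ((p : ℕ) : ℤ) ∣ z →
        ‖((z : ℤ) : ℤ_[p]) - a‖ ≤ ((p : ℕ) : ℝ) ^ (-((h : ℕ) : ℤ)) → ‖a‖ < 1 := by
      intro z a hz hza
      have e : a = z + -(z - a) := by ring
      rw [e]
      refine PadicInt.norm_lt_one_add (PadicInt.norm_intCast_lt_one_iff.2 hz) ?_
      rw [norm_neg]
      exact hza.trans_lt hlt
    have h1 := small x _ hpx (hx p hp)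
    have h2 := small y _ hpy (hy p hp)
    have h3 : IsUnit (N p : Matrix (Fin 2) (Fin 2) ℤ_[p]).det := by simp
    rw [PadicInt.isUnit_iff] at h3
    refine h3.not_lt ?_
    rw [Matrix.det_fin_two, sub_eq_add_neg]
    refine PadicInt.norm_lt_one_add ?_ ?_
    · rw [mul_comm]; exact PadicInt.norm_lt_one_mul h1
    · rw [norm_neg]; exact PadicInt.norm_lt_one_mul h2
  have hgpos : 0 < Int.gcd x y := by
    rw [Nat.pos_iff_ne_zero]
    intro h0
    obtain ⟨p, hp⟩ := hS
    rw [Int.gcd_eq_zero_iff] at h0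
    exact hprim p hp ⟨h0.1 ▸ dvd_zero _, h0.2 ▸ dvd_zero _⟩
  obtain ⟨x', y', hcop, hx', hy'⟩ := Int.exists_gcd_one hgpos
  set k : ℕ := Int.gcd x y with hk
  have hunit : ∀ p ∈ S, ‖((k : ℤ) : ℤ_[p])‖ = 1 := by
    intro p hp
    rw [PadicInt.norm_intCast_eq_one_iff, Int.isCoprime_iff_gcd_eq_one, Int.gcd_natCast_natCast]
    rw [Nat.coprime_comm.1]
    rw [Nat.Prime.coprime_iff_not_dvd p.2]
    intro hd
    refine hprim p hp ⟨?_, ?_⟩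
    · exact (Int.natCast_dvd_natCast.2 hd).trans (Int.gcd_dvd_left ..)
    · exact (Int.natCast_dvd_natCast.2 hd).trans (Int.gcd_dvd_right ..)
  have hbez : x' * Int.gcdA x' y' + y' * Int.gcdB x' y' = 1 := by
    rw [← Int.gcd_eq_gcd_ab, hcop]; rfl
  set u := Int.gcdA x' y'
  set v := Int.gcdB x' y'
  let η : GL (Fin 2) ℤ :=
    { val := !![x', -v; y', u]
      inv := !![u, v; -y', x']
      val_inv := by
        rw [Matrix.mul_fin_two, Matrix.one_fin_two]
        ext i j
        fin_cases i <;> fin_cases j <;> simp <;> first | ring1 | linear_combination hbez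
      inv_val := by
        rw [Matrix.mul_fin_two, Matrix.one_fin_two]
        ext i j
        fin_cases i <;> fin_cases j <;> simp <;> first | ring1 | linear_combination hbez }
  refine ⟨η, fun p => ?_⟩
  rw [← hN p.1 p.2]
  have e : (ProjGenLinGroup.map (Int.castRingHom ℚ_[p.1]) (ProjGenLinGroup.mk η))⁻¹ *
      ProjGenLinGroup.map (algebraMap ℤ_[p.1] ℚ_[p.1]) (ProjGenLinGroup.mk (N p.1)) =
      ProjGenLinGroup.map (algebraMap ℤ_[p.1] ℚ_[p.1])
        (ProjGenLinGroup.mk (Matrix.GeneralLinearGroup.map (Int.castRingHom ℤ_[p.1]) η⁻¹ *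
          N p.1)) := by
    have e1 : ProjGenLinGroup.map (n := Fin 2) (Int.castRingHom ℚ_[p.1]) =
        (ProjGenLinGroup.map (algebraMap ℤ_[p.1] ℚ_[p.1])).comp
          (ProjGenLinGroup.map (Int.castRingHom ℤ_[p.1])) := by
      rw [← ProjGenLinGroup.map_comp]
      congr 1
    rw [e1, map_mul ProjGenLinGroup.mk, map_mul, map_inv, map_inv, map_inv,
      MonoidHom.comp_apply, ProjGenLinGroup.map_mk (Int.castRingHom ℤ_[p.1])]
  rw [e]
  refine level_of_int _ (norm_radius_le_one _ _) _ ?_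
  refine le_trans ?_ (pow_neg_le_norm_radius p.1 h)
  have e10 : ((Matrix.GeneralLinearGroup.map (Int.castRingHom ℤ_[p.1]) η⁻¹ * N p.1 :
      GL (Fin 2) ℤ_[p.1]) : Matrix (Fin 2) (Fin 2) ℤ_[p.1]) 1 0 =
      -(y' : ℤ_[p.1]) * (N p.1 : Matrix (Fin 2) (Fin 2) ℤ_[p.1]) 0 0 +
        x' * (N p.1 : Matrix (Fin 2) (Fin 2) ℤ_[p.1]) 1 0 := by
    rw [Units.val_mul, Matrix.mul_apply, Fin.sum_univ_two]
    have a1 : ((Matrix.GeneralLinearGroup.map (Int.castRingHom ℤ_[p.1]) η⁻¹ :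
      GL (Fin 2) ℤ_[p.1]) : Matrix (Fin 2) (Fin 2) ℤ_[p.1]) 1 0 = ((-y' : ℤ) : ℤ_[p.1]) := rfl
    have a2 : ((Matrix.GeneralLinearGroup.map (Int.castRingHom ℤ_[p.1]) η⁻¹ :
      GL (Fin 2) ℤ_[p.1]) : Matrix (Fin 2) (Fin 2) ℤ_[p.1]) 1 1 = ((x' : ℤ) : ℤ_[p.1]) := rfl
    rw [a1, a2]
    push_cast
    ring
  rw [e10]
  -- multiplying by the unit `k` turns `(x', y')` into the approximation `(x, y)`
  have ek : ∀ t : ℤ_[p.1], ‖t‖ = ‖((k : ℤ) : ℤ_[p.1]) * t‖ := fun t => by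
    rw [norm_mul, hunit p.1 p.2, one_mul]
  rw [ek]
  have e2 : ((k : ℤ) : ℤ_[p.1]) * (-(y' : ℤ_[p.1]) * (N p.1 : Matrix (Fin 2) (Fin 2) ℤ_[p.1]) 0 0 +
        x' * (N p.1 : Matrix (Fin 2) (Fin 2) ℤ_[p.1]) 1 0) =
      (y : ℤ_[p.1]) * (x - (N p.1 : Matrix (Fin 2) (Fin 2) ℤ_[p.1]) 0 0) +
      -(x * (y - (N p.1 : Matrix (Fin 2) (Fin 2) ℤ_[p.1]) 1 0)) := by
    have hxc : (x : ℤ_[p.1]) = x' * (k : ℤ) := by rw [← Int.cast_mul, ← hx']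
    have hyc : (y : ℤ_[p.1]) = y' * (k : ℤ) := by rw [← Int.cast_mul, ← hy']
    rw [hxc, hyc]
    ring
  rw [e2]
  refine (PadicInt.nonarchimedean _ _).trans (max_le ?_ ?_)
  · rw [norm_mul]
    exact (mul_le_of_le_one_left (norm_nonneg _) (PadicInt.norm_le_one _)).trans (hx p.1 p.2)
  · rw [norm_neg, norm_mul]
    exact (mul_le_of_le_one_left (norm_nonneg _) (PadicInt.norm_le_one _)).trans (hy p.1 p.2)

theorem branchPoint_eq_of_frame {S : Finset Nat.Primes} (g : PGL(2, ℝ)) (ω : GS S) (h : ℕ+)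
    (d : PGL(2, SInt S))
    (hd : ∀ p : S, padicPlace S p d * (ω p * diagPGL 1 (radiusUnit ℚ_[p.1] h)) ∈ intPGL p.1) :
    branchPoint S g ω h = coset GammaInf (realPlace S d * g) := by
  have e : translate (coset (GammaS S) (g, ω)) (aFin S h) = coset (GammaS S)
      (realPlace S d * g,
        fun p : S => padicPlace S p d * (ω p * diagPGL 1 (radiusUnit ℚ_[p.1] h))) := by
    rw [translate_coset, coset_GammaS_eq_iff]
    refine ⟨d, ?_, fun p => rfl⟩
    change realPlace S d * (g * 1) = _
    rw [mul_one]
  rw [branchPoint, e]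
  exact proj_coset _ (mem_KS_iff.2 hd)

theorem exists_frame {S : Finset Nat.Primes} {ω : GS S} (hω : ω ∈ KS S) {h : ℕ+}
    (hh : h ∈ radii S) : ∃ (d : PGL(2, SInt S)) (η : GL (Fin 2) ℤ),
    (∀ p : S, padicPlace S p d * (ω p * diagPGL 1 (radiusUnit ℚ_[p.1] h)) ∈ intPGL p.1) ∧
    realPlace S d = (diagPGL 1 (radiusUnit ℝ h))⁻¹ *
      (ProjGenLinGroup.map (Int.castRingHom ℝ) (ProjGenLinGroup.mk η))⁻¹ := by
  obtain ⟨η, hη⟩ := exists_int_frame hω h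
  obtain ⟨δ, hδ, hδp⟩ := exists_radius_diag hh
  refine ⟨δ⁻¹ * (ofIntPGL S (ProjGenLinGroup.mk η))⁻¹, η, fun p => ?_, ?_⟩
  · rw [map_mul, map_inv, map_inv, hδp, padicPlace_ofIntPGL]
    simpa [mul_assoc] using hη p
  · rw [map_mul, map_inv, map_inv, hδ, realPlace_ofIntPGL]

/-- `t` stabilizes the branch point `x_{ω,h}` if and only if `g a_∞(t) g⁻¹` is given by an element
of `PGL₂(𝒪_S)` that lies in `ω_p diag(1, h) PGL₂(ℤ_p) diag(1, h)⁻¹ ω_p⁻¹` for all `p ∈ S`. -/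
theorem translate_branchPoint_iff {S : Finset Nat.Primes} (g : PGL(2, ℝ)) {ω : GS S}
    (hω : ω ∈ KS S) {h : ℕ+} (hh : h ∈ radii S) (t : ℝ) :
    translate (branchPoint S g ω h) (aInf t) = branchPoint S g ω h ↔
      ∃ δ : PGL(2, SInt S), realPlace S δ * g = g * aInf t ∧
        ∀ p : S, (diagPGL 1 (radiusUnit ℚ_[p.1] h))⁻¹ * ((ω p)⁻¹ * padicPlace S p δ * ω p) *
          diagPGL 1 (radiusUnit ℚ_[p.1] h) ∈ intPGL p.1 := by
  obtain ⟨d, -, hd, -⟩ := exists_frame hω hh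
  rw [branchPoint_eq_of_frame g ω h d hd, translate_coset, eq_comm, coset_eq_iff]
  constructor
  · rintro ⟨_, ⟨r, rfl⟩, hr⟩
    rw [← realPlace_ofIntPGL S] at hr
    refine ⟨d⁻¹ * ofIntPGL S r * d, ?_, fun p => ?_⟩
    · rw [map_mul, map_mul, map_inv, mul_assoc, mul_assoc, hr]
      group
    · have h1 := hd p
      have h2 : padicPlace S p (ofIntPGL S r) ∈ intPGL (p.1 : ℕ) := by
        rw [padicPlace_ofIntPGL]; exact map_int_mem_intPGL r
      have h3 := mul_mem (mul_mem (inv_mem h1) h2) h1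
      convert h3 using 1
      simp only [map_mul, map_inv]
      group
  · rintro ⟨δ, h1, h2⟩
    refine ⟨realPlace S (d * δ * d⁻¹), ?_, ?_⟩
    · rw [realPlace_mem_GammaInf_iff]
      intro p hp
      have h3 := mul_mem (mul_mem (hd ⟨p, hp⟩) (h2 ⟨p, hp⟩)) (inv_mem (hd ⟨p, hp⟩))
      convert h3 using 1
      simp only [map_mul, map_inv]
      group
    · simp only [map_mul, map_inv]
      rw [mul_assoc, inv_mul_cancel_left, mul_assoc, h1, mul_assoc]

/-! ### Powers of `2 × 2` matrices near the identity -/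

/-- The powers of a `2 × 2` matrix are linear combinations of `1` and the matrix itself; the
coefficients are in the first column of the powers of the companion matrix. -/
theorem pow_eq_companion {A K : Type*} [CommRing A] [CommRing K] (f : A →+* K) (t d : A)
    (c : Matrix (Fin 2) (Fin 2) K) (ht : c.trace = f t) (hd : c.det = f d) (n : ℕ) :
    c ^ n = f ((!![0, -d; 1, t] ^ n : Matrix (Fin 2) (Fin 2) A) 0 0) • (1 : Matrix _ _ K) +
      f ((!![0, -d; 1, t] ^ n : Matrix (Fin 2) (Fin 2) A) 1 0) • c := by
  induction n with
  | zero => simp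
  | succ n ih =>
    have hc : c * c = f t • c - f d • (1 : Matrix (Fin 2) (Fin 2) K) := by
      rw [← ht, ← hd, Matrix.trace_fin_two, Matrix.det_fin_two]
      ext i j
      fin_cases i <;> fin_cases j <;> simp [Matrix.mul_apply, Fin.sum_univ_two] <;> ring
    rw [pow_succ, ih, pow_succ', Matrix.mul_apply, Matrix.mul_apply, Fin.sum_univ_two,
      Fin.sum_univ_two, add_mul, smul_mul_assoc, smul_mul_assoc, hc, one_mul]
    simp only [Matrix.of_apply, Matrix.cons_val', Matrix.cons_val_zero, Matrix.cons_val_one,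
      Matrix.cons_val_fin_one, zero_mul, zero_add, one_mul, map_add, map_mul, map_neg]
    module

theorem exists_pow_eq_smul_one_add_smul {K : Type*} [CommRing K]
    (c : Matrix (Fin 2) (Fin 2) K) (n : ℕ) :
    ∃ r s : K, c ^ n = r • (1 : Matrix (Fin 2) (Fin 2) K) + s • c :=
  ⟨_, _, pow_eq_companion (RingHom.id K) c.trace c.det c rfl rfl n⟩

section Padic

variable {p : ℕ} [hp : Fact p.Prime]

/-- `E ≡ 1` modulo `p²`, the congruence that makes the valuations of the powers of `E` regular,
for `p = 2` as well. -/
def NearOne (E : Matrix (Fin 2) (Fin 2) ℚ_[p]) : Prop :=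
  ∀ i j, ‖(E - 1) i j‖ ≤ (p : ℝ) ^ (-2 : ℤ)

theorem norm_add_le_of_le {x y : ℚ_[p]} {e : ℝ} (hx : ‖x‖ ≤ e) (hy : ‖y‖ ≤ e) : ‖x + y‖ ≤ e :=
  (Padic.nonarchimedean x y).trans (max_le hx hy)

theorem zpow_neg_lt_one {k : ℤ} (hk : k < 0) : (p : ℝ) ^ k < 1 :=
  zpow_lt_one_of_neg₀ (by exact_mod_cast hp.1.one_lt) hk

theorem zpow_pos' (k : ℤ) : 0 < (p : ℝ) ^ k := zpow_pos (by exact_mod_cast hp.1.pos) k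

theorem NearOne.norm_le_one {E : Matrix (Fin 2) (Fin 2) ℚ_[p]} (hE : NearOne E) (i j : Fin 2) :
    ‖E i j‖ ≤ 1 := by
  have e : E i j = (E - 1) i j + (1 : Matrix (Fin 2) (Fin 2) ℚ_[p]) i j := by simp
  rw [e]
  refine norm_add_le_of_le ((hE i j).trans (zpow_neg_lt_one (by norm_num)).le) ?_
  rw [Matrix.one_apply]
  split_ifs <;> simp

theorem NearOne.mul {E F : Matrix (Fin 2) (Fin 2) ℚ_[p]} (hE : NearOne E) (hF : NearOne F) :
    NearOne (E * F) := by
  intro i j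
  have e : E * F - 1 = (E - 1) * F + (F - 1) := by noncomm_ring
  rw [e, Matrix.add_apply, Matrix.mul_apply, Fin.sum_univ_two]
  have key : ∀ k, ‖(E - 1) i k * F k j‖ ≤ (p : ℝ) ^ (-2 : ℤ) := fun k => by
    rw [norm_mul]
    exact (mul_le_of_le_one_right (norm_nonneg _) (hF.norm_le_one k j)).trans (hE i k)
  exact norm_add_le_of_le (norm_add_le_of_le (key 0) (key 1)) (hF i j)

theorem nearOne_one : NearOne (1 : Matrix (Fin 2) (Fin 2) ℚ_[p]) := by
  intro i j
  simp

theorem NearOne.pow {E : Matrix (Fin 2) (Fin 2) ℚ_[p]} (hE : NearOne E) (n : ℕ) :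
    NearOne (E ^ n) := by
  induction n with
  | zero => simpa using nearOne_one
  | succ n ih => rw [pow_succ]; exact ih.mul hE

theorem NearOne.exists_pow_apply {E : Matrix (Fin 2) (Fin 2) ℚ_[p]} (hE : NearOne E) (n : ℕ) :
    ∃ q : ℚ_[p], (E ^ n) 1 0 = E 1 0 * q ∧ ‖q - n‖ ≤ (p : ℝ) ^ (-2 : ℤ) := by
  induction n with
  | zero => exact ⟨0, by simp, by simp⟩
  | succ n ih =>
    obtain ⟨q, h1, h2⟩ := ih
    refine ⟨q * E 0 0 + (E ^ n) 1 1, ?_, ?_⟩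
    · rw [pow_succ, Matrix.mul_apply, Fin.sum_univ_two, h1]
      ring
    · have e : q * E 0 0 + (E ^ n) 1 1 - ((n + 1 : ℕ) : ℚ_[p]) =
          (q - n) * E 0 0 + n * (E - 1) 0 0 + (E ^ n - 1) 1 1 := by
        push_cast
        simp
        ring
      rw [e]
      refine norm_add_le_of_le (norm_add_le_of_le ?_ ?_) (hE.pow n 1 1)
      · rw [norm_mul]
        exact (mul_le_of_le_one_right (norm_nonneg _) (hE.norm_le_one 0 0)).trans h2
      · rw [norm_mul]
        have := Padic.norm_int_le_one (p := p) n
        exact (mul_le_of_le_one_left (norm_nonneg _) (by simpa using this)).trans (hE 0 0)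

/-- Lifting the exponent: for `E ≡ 1` modulo `p²` the lower left entry of `E ^ n` has the
valuation of `n` times that of `E`. -/
theorem NearOne.norm_pow_apply {E : Matrix (Fin 2) (Fin 2) ℚ_[p]} (hE : NearOne E) (n : ℕ) :
    ‖(E ^ n) 1 0‖ = ‖E 1 0‖ * ‖(n : ℚ_[p])‖ := by
  induction n using Nat.recOnMul generalizing E with
  | zero => simp
  | one => simp
  | prime ℓ hℓ =>
    obtain ⟨q, h1, h2⟩ := hE.exists_pow_apply ℓ
    rw [h1, norm_mul]
    congr 1
    refine Padic.norm_eq_of_norm_sub_lt_right (h2.trans_lt ?_)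
    rcases eq_or_ne ℓ p with rfl | hne
    · rw [Padic.norm_p, ← zpow_neg_one]
      exact zpow_lt_zpow_right₀ (by exact_mod_cast hℓ.one_lt) (by norm_num)
    · have : ‖(ℓ : ℚ_[p])‖ = 1 :=
        Padic.norm_natCast_eq_one_iff.2 ((Nat.coprime_primes hp.1 hℓ).2 hne.symm)
      rw [this]
      exact zpow_neg_lt_one (by norm_num)
  | mul a b iha ihb =>
    rw [pow_mul, ihb (hE.pow a), iha hE, Nat.cast_mul, norm_mul, mul_assoc]

/-- Some power of a matrix of determinant `1` and integral trace is close to the identity. -/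
theorem exists_pow_nearOne (c : Matrix (Fin 2) (Fin 2) ℚ_[p]) (ht : ‖c.trace‖ ≤ 1)
    (hd : c.det = 1) : ∃ J : ℕ, 0 < J ∧ NearOne (c ^ J) := by
  let τ : ℤ_[p] := ⟨c.trace, ht⟩
  obtain ⟨N, hN⟩ : ∃ N : ℕ, ∀ i j, (p : ℝ) ^ (-N : ℤ) * max 1 ‖c i j‖ ≤ (p : ℝ) ^ (-2 : ℤ) := by
    have hone : ∀ i j, ∃ N : ℕ, (p : ℝ) ^ (-N : ℤ) * max 1 ‖c i j‖ ≤ (p : ℝ) ^ (-2 : ℤ) := by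
      intro i j
      have hm : 0 < max 1 ‖c i j‖ := lt_of_lt_of_le one_pos (le_max_left _ _)
      obtain ⟨N, hN⟩ := PadicInt.exists_pow_neg_lt (p := p)
        (div_pos (zpow_pos' (p := p) (-2)) hm)
      exact ⟨N, ((lt_div_iff₀ hm).1 hN).le⟩
    choose N hN using hone
    refine ⟨∑ i, ∑ j, N i j, fun i j => le_trans ?_ (hN i j)⟩
    have hle : N i j ≤ ∑ i, ∑ j, N i j :=
      (Finset.single_le_sum (f := fun j => N i j) (fun _ _ => Nat.zero_le _)
        (Finset.mem_univ j)).trans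
      (Finset.single_le_sum (f := fun i => ∑ j, N i j) (fun _ _ => Nat.zero_le _)
        (Finset.mem_univ i))
    gcongr
    · exact_mod_cast hp.1.one_lt.le
  have hne : NeZero (p ^ N) := ⟨pow_ne_zero _ hp.1.ne_zero⟩
  let C : Matrix.SpecialLinearGroup (Fin 2) ℤ_[p] := ⟨!![0, -1; 1, τ], by simp [Matrix.det_fin_two]⟩
  let Cb : Matrix.SpecialLinearGroup (Fin 2) (ZMod (p ^ N)) :=
    Matrix.SpecialLinearGroup.map (PadicInt.toZModPow N) C
  have hfin : Finite (Matrix.SpecialLinearGroup (Fin 2) (ZMod (p ^ N))) :=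
    Subtype.finite
  obtain ⟨J, hJ, hCJ⟩ := (isOfFinOrder_of_finite Cb).exists_pow_eq_one
  refine ⟨J, hJ, ?_⟩
  have hcoe : ((C ^ J : Matrix.SpecialLinearGroup (Fin 2) ℤ_[p]) : Matrix (Fin 2) (Fin 2) ℤ_[p]) =
      !![0, -1; 1, τ] ^ J := by
    rw [Matrix.SpecialLinearGroup.coe_pow]
  have hmod : ∀ i j, PadicInt.toZModPow N ((!![0, -1; 1, τ] ^ J : Matrix _ _ ℤ_[p]) i j) =
      (1 : Matrix (Fin 2) (Fin 2) (ZMod (p ^ N))) i j := by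
    intro i j
    rw [← hcoe]
    have h1 : Matrix.SpecialLinearGroup.map (PadicInt.toZModPow N) (C ^ J) = 1 := by
      rw [map_pow]; exact hCJ
    have h2 := congrArg (fun M : Matrix.SpecialLinearGroup (Fin 2) (ZMod (p ^ N)) =>
      (M : Matrix (Fin 2) (Fin 2) (ZMod (p ^ N))) i j) h1
    exact h2
  set r := (!![0, -1; 1, τ] ^ J : Matrix _ _ ℤ_[p]) 0 0 with hr
  set s := (!![0, -1; 1, τ] ^ J : Matrix _ _ ℤ_[p]) 1 0 with hs
  have hsmall : ∀ z : ℤ_[p], PadicInt.toZModPow N z = 0 → ‖z‖ ≤ (p : ℝ) ^ (-N : ℤ) := by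
    intro z hz
    rw [PadicInt.norm_le_pow_iff_mem_span_pow, ← PadicInt.ker_toZModPow]
    exact hz
  have hr1 : ‖r - 1‖ ≤ (p : ℝ) ^ (-N : ℤ) := hsmall _ (by
    rw [map_sub, map_one, hr, hmod]; simp)
  have hs1 : ‖s‖ ≤ (p : ℝ) ^ (-N : ℤ) := hsmall _ (by rw [hs, hmod]; simp)
  have hcJ := pow_eq_companion (algebraMap ℤ_[p] ℚ_[p]) τ 1 c rfl (by rw [hd, map_one]) J
  rw [← hr, ← hs] at hcJ
  intro i j
  have e : (c ^ J - 1) i j = ((r - 1 : ℤ_[p]) : ℚ_[p]) * (1 : Matrix (Fin 2) (Fin 2) ℚ_[p]) i j +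
      (s : ℚ_[p]) * c i j := by
    rw [hcJ]
    simp only [Matrix.sub_apply, Matrix.add_apply, Matrix.smul_apply, smul_eq_mul,
      PadicInt.algebraMap_apply]
    push_cast
    ring
  rw [e]
  refine norm_add_le_of_le ?_ ?_ <;> refine le_trans ?_ (hN i j) <;> rw [norm_mul]
  · refine mul_le_mul hr1 (le_trans ?_ (le_max_left _ _)) (norm_nonneg _) (zpow_pos' _).le
    rw [Matrix.one_apply]
    split_ifs <;> simp
  · exact mul_le_mul hs1 (le_max_right _ _) (norm_nonneg _) (zpow_pos' _).le

/-- If `tr(b)² / det(b)` is integral, then a multiple of a power of `b` is close to `1`. -/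
theorem exists_smul_pow_nearOne (b : GL (Fin 2) ℚ_[p])
    (hb : ‖(b : Matrix (Fin 2) (Fin 2) ℚ_[p]).trace ^ 2 /
      (b : Matrix (Fin 2) (Fin 2) ℚ_[p]).det‖ ≤ 1) :
    ∃ (r : ℕ) (a : ℚ_[p]), 0 < r ∧
      NearOne (a • (b : Matrix (Fin 2) (Fin 2) ℚ_[p]) ^ r) ∧
      (a • (b : Matrix (Fin 2) (Fin 2) ℚ_[p]) ^ r).det = 1 := by
  set B := (b : Matrix (Fin 2) (Fin 2) ℚ_[p]) with hB
  have hd0 : B.det ≠ 0 := det_ne_zero_GL b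
  have htr : (B.det⁻¹ • B ^ 2).trace = B.trace ^ 2 / B.det + -2 := by
    rw [Matrix.trace_smul, sq, Matrix.trace_fin_two, Matrix.mul_apply, Matrix.mul_apply,
      Fin.sum_univ_two, Fin.sum_univ_two, smul_eq_mul]
    field_simp
    rw [Matrix.trace_fin_two, Matrix.det_fin_two]
    ring
  have hdet : (B.det⁻¹ • B ^ 2).det = 1 := by
    rw [Matrix.det_smul, Matrix.det_pow, Fintype.card_fin, ← mul_pow, inv_mul_cancel₀ hd0, one_pow]
  obtain ⟨J, hJ, hnear⟩ := exists_pow_nearOne (B.det⁻¹ • B ^ 2) (by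
    rw [htr]
    refine norm_add_le_of_le hb ?_
    have := Padic.norm_int_le_one (p := p) (-2)
    simpa using this) hdet
  have e : B.det⁻¹ ^ J • B ^ (2 * J) = (B.det⁻¹ • B ^ 2) ^ J := by
    rw [smul_pow, pow_mul]
  refine ⟨2 * J, B.det⁻¹ ^ J, by lia, ?_, ?_⟩
  · rw [e]; exact hnear
  · rw [e, Matrix.det_pow, hdet, one_pow]

end Padic

/-! ### The exponents of the powers that fix a vertex of a `p`-adic branch -/

/-- The least positive `j` such that `b ^ j` lies in the subgroup `H`, and `0` if there is none. -/
noncomputable def relOrder {G : Type*} [Group G] (H : Subgroup G) (b : G) : ℕ :=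
  Function.minimalPeriod (b • ·) (QuotientGroup.mk 1 : G ⧸ H)

theorem pow_mem_iff_relOrder_dvd {G : Type*} [Group G] (H : Subgroup G) (b : G) (j : ℕ) :
    b ^ j ∈ H ↔ relOrder H b ∣ j := by
  rw [relOrder, ← MulAction.pow_smul_eq_iff_minimalPeriod_dvd, MulAction.Quotient.smul_mk,
    eq_comm, QuotientGroup.eq]
  simp

theorem exists_forall_eq_of_monotone_of_le {G : ℕ → ℕ} (hG : Monotone G) {r : ℕ}
    (hb : ∀ k, G k ≤ r) : ∃ k₁, ∀ k, k₁ ≤ k → G k = G k₁ := by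
  have hA : (Set.range G).Finite :=
    (Set.finite_Iic r).subset (by rintro _ ⟨k, rfl⟩; exact hb k)
  obtain ⟨m, ⟨k₁, hk₁⟩, hm⟩ := hA.exists_maximal (Set.range_nonempty G)
  refine ⟨k₁, fun k hk => le_antisymm ?_ (hG hk)⟩
  exact hk₁ ▸ hm ⟨k, rfl⟩ (hk₁ ▸ hG hk)

/-- By the first condition, `f n` is `p ^ (n - κ)` times a divisor of `r` for `n > κ`. If eventually
`f n ∣ f (n + 1)`, these divisors stabilize. -/
theorem eventually_mul_of_dvd_iff {p : ℕ} [hp : Fact p.Prime] (f : ℕ → ℕ) (r κ : ℕ) (hr : 0 < r)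
    (hf : ∀ n i, 0 < i → (f n ∣ r * i ↔ n ≤ padicValNat p i + κ))
    (hmono : ∃ n₀, ∀ n, n₀ ≤ n → f n ∣ f (n + 1)) :
    ∃ n₁, ∀ n, n₁ ≤ n → f (n + 1) = p * f n := by
  obtain ⟨n₀, hn₀⟩ := hmono
  have hpow : ∀ n, κ ≤ n → ∀ i, 0 < i → (f n ∣ r * i ↔ p ^ (n - κ) ∣ i) := by
    intro n hn i hi
    rw [hf n i hi, padicValNat_dvd_iff_le hi.ne']
    lia
  have hlcm : ∀ n, κ ≤ n → Nat.lcm (f n) r = r * p ^ (n - κ) := by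
    intro n hn
    have hpos : 0 < p ^ (n - κ) := pow_pos hp.1.pos _
    apply Nat.dvd_antisymm
    · exact Nat.lcm_dvd ((hpow n hn _ hpos).2 dvd_rfl) (dvd_mul_right _ _)
    · obtain ⟨i, hi⟩ := Nat.dvd_lcm_right (f n) r
      have hfpos : 0 < f n := Nat.pos_of_dvd_of_pos ((hpow n hn _ hpos).2 dvd_rfl)
        (mul_pos hr hpos)
      have hi0 : 0 < i := by
        rw [Nat.pos_iff_ne_zero]
        rintro rfl
        exact (Nat.lcm_pos hfpos hr).ne' (by rw [hi, mul_zero])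
      rw [hi]
      exact mul_dvd_mul_left r ((hpow n hn i hi0).1 (hi ▸ Nat.dvd_lcm_left (f n) r))
  have hg : ∀ n, κ ≤ n → f n = Nat.gcd (f n) r * p ^ (n - κ) := by
    intro n hn
    have h1 := Nat.gcd_mul_lcm (f n) r
    rw [hlcm n hn] at h1
    refine Nat.eq_of_mul_eq_mul_right hr ?_
    rw [← h1]
    ring
  -- the greatest common divisors with `r` grow and are bounded by `r`
  let G : ℕ → ℕ := fun k => Nat.gcd (f (n₀ + k)) r
  have hGm : Monotone G := monotone_nat_of_le_succ fun k =>
    Nat.le_of_dvd (Nat.gcd_pos_of_pos_right _ hr)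
      (Nat.gcd_dvd_gcd_of_dvd_left _ (hn₀ (n₀ + k) (Nat.le_add_right _ _)))
  obtain ⟨k₁, hk₁⟩ := exists_forall_eq_of_monotone_of_le hGm
    fun k => Nat.le_of_dvd hr (Nat.gcd_dvd_right _ _)
  refine ⟨n₀ + k₁ + κ, fun n hn => ?_⟩
  obtain ⟨k, rfl⟩ : ∃ k, n = n₀ + k := ⟨n - n₀, by lia⟩
  rw [hg (n₀ + k + 1) (by lia), hg (n₀ + k) (by lia)]
  have e1 : Nat.gcd (f (n₀ + k + 1)) r = Nat.gcd (f (n₀ + k)) r :=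
    (hk₁ (k + 1) (by lia)).trans (hk₁ k (by lia)).symm
  rw [e1, show n₀ + k + 1 - κ = (n₀ + k - κ) + 1 by lia, pow_succ]
  ring

section Padic

variable {p : ℕ} [hp : Fact p.Prime]

/-- The subgroup `diag(1, h) PGL₂(ℤ_p) diag(1, h)⁻¹`. -/
noncomputable def levelGroup (h : (ℚ_[p])ˣ) : Subgroup PGL(2, ℚ_[p]) :=
  (intPGL p).map (MulAut.conj (diagPGL 1 h)).toMonoidHom

theorem mem_levelGroup_iff {h : (ℚ_[p])ˣ} {x : PGL(2, ℚ_[p])} :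
    x ∈ levelGroup h ↔ (diagPGL 1 h)⁻¹ * x * diagPGL 1 h ∈ intPGL p := by
  constructor
  · rintro ⟨y, hy, rfl⟩
    have : (diagPGL 1 h)⁻¹ * (diagPGL 1 h * y * (diagPGL 1 h)⁻¹) * diagPGL 1 h = y := by group
    change (diagPGL 1 h)⁻¹ * (diagPGL 1 h * y * (diagPGL 1 h)⁻¹) * diagPGL 1 h ∈ intPGL p
    rw [this]
    exact hy
  · intro hx
    refine ⟨_, hx, ?_⟩
    change diagPGL 1 h * ((diagPGL 1 h)⁻¹ * x * diagPGL 1 h) * (diagPGL 1 h)⁻¹ = x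
    group

theorem levelGroup_eq_of_norm_eq {h h' : (ℚ_[p])ˣ} (hh : ‖(h : ℚ_[p])‖ = ‖(h' : ℚ_[p])‖) :
    levelGroup h = levelGroup h' := by
  ext x
  induction x using ProjGenLinGroup.induction_on with | mk M =>
  rw [mem_levelGroup_iff, mem_levelGroup_iff, diag_conj_mem_intPGL_iff, diag_conj_mem_intPGL_iff,
    hh]

/-- The group `diag(1, p ^ n) PGL₂(ℤ_p) diag(1, p ^ n)⁻¹`. -/
noncomputable def levelPow (p : ℕ) [hp : Fact p.Prime] (n : ℕ) : Subgroup PGL(2, ℚ_[p]) :=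
  levelGroup (Units.mk0 ((p : ℚ_[p]) ^ n) (pow_ne_zero _ (by exact_mod_cast hp.1.ne_zero)))

theorem norm_radiusUnit (h : ℕ+) :
    ‖(radiusUnit ℚ_[p] h : ℚ_[p])‖ = (p : ℝ) ^ (-(padicValNat p h : ℤ)) := by
  have h0 : ((h : ℕ) : ℚ_[p]) ≠ 0 := by exact_mod_cast h.ne_zero
  rw [radiusUnit, Units.val_mk0, Padic.norm_eq_zpow_neg_valuation h0, Padic.valuation_natCast]

theorem levelGroup_radiusUnit (h : ℕ+) :
    levelGroup (radiusUnit ℚ_[p] h) = levelPow p (padicValNat p h) := by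
  apply levelGroup_eq_of_norm_eq
  rw [norm_radiusUnit, Units.val_mk0, norm_pow, Padic.norm_p, inv_pow, zpow_neg, zpow_natCast]

theorem mk_mem_levelPow_iff (n : ℕ) (M : GL (Fin 2) ℚ_[p]) :
    (ProjGenLinGroup.mk M ∈ levelPow p n) ↔ ∃ c : ℚ_[p],
      ‖c * (M : Matrix (Fin 2) (Fin 2) ℚ_[p]) 0 0‖ ≤ 1 ∧
      ‖c * (M : Matrix (Fin 2) (Fin 2) ℚ_[p]) 0 1‖ * (p : ℝ) ^ (-n : ℤ) ≤ 1 ∧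
      ‖c * (M : Matrix (Fin 2) (Fin 2) ℚ_[p]) 1 0‖ ≤ (p : ℝ) ^ (-n : ℤ) ∧
      ‖c * (M : Matrix (Fin 2) (Fin 2) ℚ_[p]) 1 1‖ ≤ 1 ∧
      ‖c ^ 2 * (M : Matrix (Fin 2) (Fin 2) ℚ_[p]).det‖ = 1 := by
  rw [levelPow, mem_levelGroup_iff, diag_conj_mem_intPGL_iff]
  simp only [Units.val_mk0, norm_pow, Padic.norm_p, inv_pow, zpow_neg, zpow_natCast]

/-- A scalar multiple `E` of determinant `1` and congruent to `1` fixes exactly the levels that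
divide its lower left entry. -/
theorem NearOne.mk_mem_levelPow_iff {M : GL (Fin 2) ℚ_[p]} {a : ℚ_[p]}
    (hE : NearOne (a • (M : Matrix (Fin 2) (Fin 2) ℚ_[p])))
    (hd : (a • (M : Matrix (Fin 2) (Fin 2) ℚ_[p])).det = 1) (n : ℕ) :
    (ProjGenLinGroup.mk M ∈ levelPow p n) ↔
      ‖(a • (M : Matrix (Fin 2) (Fin 2) ℚ_[p])) 1 0‖ ≤ (p : ℝ) ^ (-n : ℤ) := by
  rw [HeckeGraph.mk_mem_levelPow_iff]
  rw [Matrix.det_smul, Fintype.card_fin] at hd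
  have hnorm := congrArg norm hd
  rw [norm_one, norm_mul, norm_pow] at hnorm
  constructor
  · rintro ⟨c, -, -, h10, -, hdet⟩
    rw [norm_mul, norm_pow] at hdet
    have hD : ‖(M : Matrix (Fin 2) (Fin 2) ℚ_[p]).det‖ ≠ 0 := norm_ne_zero_iff.2 (det_ne_zero_GL M)
    have hca : ‖c‖ = ‖a‖ := by
      have := mul_right_cancel₀ hD (hdet.trans hnorm.symm)
      exact (pow_left_inj₀ (norm_nonneg _) (norm_nonneg _) two_ne_zero).1 this
    rw [norm_mul, hca] at h10
    rwa [Matrix.smul_apply, smul_eq_mul, norm_mul]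
  · intro h
    refine ⟨a, hE.norm_le_one 0 0, ?_, h, hE.norm_le_one 1 1, ?_⟩
    · refine mul_le_one₀ (hE.norm_le_one 0 1) (zpow_pos' _).le ?_
      exact zpow_le_one_of_nonpos₀ (by exact_mod_cast hp.1.one_lt.le) (by lia)
    · rw [norm_mul, norm_pow, hnorm]

theorem relOrder_levelPow_dvd_iff {b : GL (Fin 2) ℚ_[p]} {r : ℕ} {a : ℚ_[p]}
    (hE : NearOne (a • (b : Matrix (Fin 2) (Fin 2) ℚ_[p]) ^ r))
    (hd : (a • (b : Matrix (Fin 2) (Fin 2) ℚ_[p]) ^ r).det = 1) (n i : ℕ) :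
    relOrder (levelPow p n) (ProjGenLinGroup.mk b) ∣ r * i ↔
      ‖(a • (b : Matrix (Fin 2) (Fin 2) ℚ_[p]) ^ r) 1 0‖ * ‖(i : ℚ_[p])‖ ≤ (p : ℝ) ^ (-n : ℤ) := by
  have e : a ^ i • ((b ^ (r * i) : GL (Fin 2) ℚ_[p]) : Matrix (Fin 2) (Fin 2) ℚ_[p]) =
      (a • (b : Matrix (Fin 2) (Fin 2) ℚ_[p]) ^ r) ^ i := by
    rw [smul_pow, ← pow_mul, Units.val_pow_eq_pow_val]
  have hpow := hE.pow i
  have hdp : ((a • (b : Matrix (Fin 2) (Fin 2) ℚ_[p]) ^ r) ^ i).det = 1 := by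
    rw [Matrix.det_pow, hd, one_pow]
  have h10 := hE.norm_pow_apply i
  rw [← e] at hpow hdp h10
  rw [← pow_mem_iff_relOrder_dvd, ← map_pow,
    NearOne.mk_mem_levelPow_iff hpow hdp, h10]

theorem relOrder_levelPow_pos {b : GL (Fin 2) ℚ_[p]} {r : ℕ} (hr : 0 < r) {a : ℚ_[p]}
    (hE : NearOne (a • (b : Matrix (Fin 2) (Fin 2) ℚ_[p]) ^ r))
    (hd : (a • (b : Matrix (Fin 2) (Fin 2) ℚ_[p]) ^ r).det = 1) (n : ℕ) :
    0 < relOrder (levelPow p n) (ProjGenLinGroup.mk b) := by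
  refine Nat.pos_of_dvd_of_pos ((relOrder_levelPow_dvd_iff hE hd n (p ^ n)).2 ?_)
    (mul_pos hr (pow_pos hp.1.pos n))
  rw [Nat.cast_pow, norm_pow, Padic.norm_p, inv_pow, zpow_neg, zpow_natCast]
  exact mul_le_of_le_one_left (by positivity) (hE.norm_le_one 1 0)

/-- Along a branch on which no power of `b` fixes the end, the least exponent of a power of `b`
that fixes the `n`-th vertex is eventually multiplied by `p` in every step. -/
theorem eventually_relOrder_levelPow {b : GL (Fin 2) ℚ_[p]} {r : ℕ} (hr : 0 < r) {a : ℚ_[p]}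
    (hE : NearOne (a • (b : Matrix (Fin 2) (Fin 2) ℚ_[p]) ^ r))
    (hd : (a • (b : Matrix (Fin 2) (Fin 2) ℚ_[p]) ^ r).det = 1)
    (h10 : (a • (b : Matrix (Fin 2) (Fin 2) ℚ_[p]) ^ r) 1 0 ≠ 0) :
    ∃ n₁, ∀ n, n₁ ≤ n → relOrder (levelPow p (n + 1)) (ProjGenLinGroup.mk b) =
      p * relOrder (levelPow p n) (ProjGenLinGroup.mk b) := by
  set E := a • (b : Matrix (Fin 2) (Fin 2) ℚ_[p]) ^ r with hEdef
  have hp1 : (1 : ℝ) < p := by exact_mod_cast hp.1.one_lt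
  obtain ⟨κ, hκ⟩ : ∃ κ : ℕ, ‖E 1 0‖ = (p : ℝ) ^ (-κ : ℤ) := by
    have h1 := hE.norm_le_one 1 0
    rw [Padic.norm_le_one_iff_val_nonneg] at h1
    refine ⟨(E 1 0).valuation.toNat, ?_⟩
    rw [Int.toNat_of_nonneg h1, Padic.norm_eq_zpow_neg_valuation h10]
  refine eventually_mul_of_dvd_iff (p := p)
    (fun n => relOrder (levelPow p n) (ProjGenLinGroup.mk b)) r κ hr (fun n i hi => ?_)
    ⟨κ, fun n hn => ?_⟩
  · have hi0 : (i : ℚ_[p]) ≠ 0 := by exact_mod_cast hi.ne'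
    rw [relOrder_levelPow_dvd_iff hE hd, hκ, Padic.norm_eq_zpow_neg_valuation hi0,
      Padic.valuation_natCast, ← zpow_add₀ (by positivity), zpow_le_zpow_iff_right₀ hp1]
    lia
  · rw [← pow_mem_iff_relOrder_dvd, ← map_pow, mk_mem_levelPow_iff]
    have hmem := (pow_mem_iff_relOrder_dvd (levelPow p (n + 1)) (ProjGenLinGroup.mk b) _).2 dvd_rfl
    rw [← map_pow, mk_mem_levelPow_iff] at hmem
    obtain ⟨c, c00, c01, c10, c11, cd⟩ := hmem
    set X := ((b ^ relOrder (levelPow p (n + 1)) (ProjGenLinGroup.mk b) : GL (Fin 2) ℚ_[p]) :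
      Matrix (Fin 2) (Fin 2) ℚ_[p]) with hX
    refine ⟨c, c00, ?_, c10.trans ?_, c11, cd⟩
    · -- the off-diagonal entries of commuting matrices are proportional
      have hcomm : X * E = E * X := by
        rw [hX, hEdef, Units.val_pow_eq_pow_val, mul_smul_comm, smul_mul_assoc, ← pow_add,
          ← pow_add, add_comm]
      have h00 := congrFun (congrFun hcomm 0) 0
      rw [Matrix.mul_apply, Matrix.mul_apply, Fin.sum_univ_two, Fin.sum_univ_two] at h00
      have hprop : (c * X 0 1) * E 1 0 = (c * X 1 0) * E 0 1 := by
        linear_combination c * h00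
      have hn2 := congrArg norm hprop
      rw [norm_mul, norm_mul (c * X 1 0), hκ] at hn2
      have hle : ‖c * X 0 1‖ * (p : ℝ) ^ (-κ : ℤ) ≤ (p : ℝ) ^ (-(n + 1 : ℕ) : ℤ) := by
        rw [hn2]
        exact (mul_le_of_le_one_right (norm_nonneg _) (hE.norm_le_one 0 1)).trans c10
      have hle2 : ‖c * X 0 1‖ * (p : ℝ) ^ (-n : ℤ) ≤ ‖c * X 0 1‖ * (p : ℝ) ^ (-κ : ℤ) := by
        gcongr
        · exact hp1.le
      exact hle2.trans (hle.trans (zpow_le_one_of_nonpos₀ hp1.le (by lia)))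
    · exact zpow_le_zpow_right₀ hp1.le (by lia)

end Padic

/-! ### The invariant `tr² / det` on `PGL₂` -/

/-- The function `tr² / det` on `PGL₂` of a field. -/
noncomputable def normTrace {K : Type*} [Field K] (x : PGL(2, K)) : K :=
  ((ProjGenLinGroup.mk_surjective x).choose : Matrix (Fin 2) (Fin 2) K).trace ^ 2 /
    ((ProjGenLinGroup.mk_surjective x).choose : Matrix (Fin 2) (Fin 2) K).det

theorem normTrace_mk {K : Type*} [Field K] (M : GL (Fin 2) K) :
    normTrace (ProjGenLinGroup.mk M) = (M : Matrix (Fin 2) (Fin 2) K).trace ^ 2 /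
      (M : Matrix (Fin 2) (Fin 2) K).det := by
  obtain ⟨c, hc, h⟩ := mk_eq_mk_iff_smul.1
    (ProjGenLinGroup.mk_surjective (ProjGenLinGroup.mk M)).choose_spec.symm
  rw [normTrace, h, Matrix.trace_smul, Matrix.det_smul, Fintype.card_fin, smul_eq_mul, mul_pow,
    mul_div_mul_left _ _ (pow_ne_zero 2 hc)]

theorem normTrace_conj {K : Type*} [Field K] (x y : PGL(2, K)) :
    normTrace (y⁻¹ * x * y) = normTrace x := by
  induction x using ProjGenLinGroup.induction_on with | mk M =>
  induction y using ProjGenLinGroup.induction_on with | mk N =>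
  rw [← map_inv, ← map_mul, ← map_mul, normTrace_mk, normTrace_mk]
  congr 1
  · rw [Units.val_mul, Units.val_mul, Matrix.trace_mul_comm, ← mul_assoc, ← Units.val_mul,
      mul_inv_cancel, Units.val_one, one_mul]
  · rw [Units.val_mul, Units.val_mul, Matrix.det_mul_comm, ← mul_assoc, ← Units.val_mul,
      mul_inv_cancel, Units.val_one, one_mul]

theorem trace_map_GL {R T : Type*} [CommRing R] [CommRing T] (f : R →+* T) (M : GL (Fin 2) R) :
    ((Matrix.GeneralLinearGroup.map f M : GL (Fin 2) T) : Matrix (Fin 2) (Fin 2) T).trace =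
      f (M : Matrix (Fin 2) (Fin 2) R).trace := by
  rw [Matrix.trace_fin_two, Matrix.trace_fin_two, map_add]
  rfl

theorem norm_normTrace_le_one {p : ℕ} [Fact p.Prime] {x : PGL(2, ℚ_[p])} (hx : x ∈ intPGL p) :
    ‖normTrace x‖ ≤ 1 := by
  obtain ⟨N, rfl⟩ := hx
  induction N using ProjGenLinGroup.induction_on with | mk N =>
  rw [ProjGenLinGroup.map_mk, normTrace_mk, det_map_GL, trace_map_GL, norm_div, norm_pow]
  have : IsUnit (N : Matrix (Fin 2) (Fin 2) ℤ_[p]).det := by simp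
  rw [PadicInt.isUnit_iff] at this
  rw [PadicInt.algebraMap_apply, PadicInt.algebraMap_apply, ← PadicInt.norm_def,
    ← PadicInt.norm_def, this, div_one]
  exact pow_le_one₀ (norm_nonneg _) (PadicInt.norm_le_one _)

theorem exists_rat_normTrace {S : Finset Nat.Primes} (d : PGL(2, SInt S)) :
    ∃ q : ℚ, normTrace (realPlace S d) = q ∧ (∀ p, normTrace (padicPlace S p d) = q) ∧
      ∀ p ∉ S, ‖(q : ℚ_[p])‖ ≤ 1 := by
  induction d using ProjGenLinGroup.induction_on with | mk M =>
  have hdet : IsUnit (M : Matrix (Fin 2) (Fin 2) (SInt S)).det := by simp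
  refine ⟨((M : Matrix (Fin 2) (Fin 2) (SInt S)).trace : ℚ) ^ 2 /
    ((M : Matrix (Fin 2) (Fin 2) (SInt S)).det : ℚ), ?_, fun p => ?_, fun p hp => ?_⟩
  · rw [realPlace, ProjGenLinGroup.map_mk, normTrace_mk, det_map_GL, trace_map_GL]
    push_cast
    rfl
  · rw [padicPlace, ProjGenLinGroup.map_mk, normTrace_mk, det_map_GL, trace_map_GL]
    push_cast
    rfl
  · have h1 := SInt_unit_norm hdet.unit p hp
    rw [IsUnit.unit_spec] at h1
    push_cast
    rw [norm_div, h1, div_one, norm_pow]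
    exact pow_le_one₀ (norm_nonneg _) (SInt_norm_le (Subtype.property _) p hp)

/-! ### The group of periods of the unit elements of `PGL₂(𝒪_S)` -/

theorem diagGL_mul {F : Type*} [CommRing F] (a b c d : Fˣ) :
    diagGL a b * diagGL c d = diagGL (a * c) (b * d) := by
  apply Units.ext
  simp [diagGL]

theorem aInf_add (s t : ℝ) : aInf (s + t) = aInf s * aInf t := by
  rw [aInf, aInf, aInf, diagPGL, diagPGL, diagPGL, ← map_mul, diagGL_mul, mul_one]
  congr 2
  ext
  simp [Real.exp_add]

theorem aInf_neg (t : ℝ) : aInf (-t) = (aInf t)⁻¹ := by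
  rw [eq_inv_iff_mul_eq_one, ← aInf_add, neg_add_cancel, aInf_zero]

theorem aInf_nsmul (n : ℕ) (t : ℝ) : aInf (n * t) = aInf t ^ n := by
  induction n with
  | zero => simp [aInf_zero]
  | succ n ih => rw [pow_succ, ← ih, ← aInf_add]; congr 1; push_cast; ring

theorem aInf_injective : Function.Injective aInf := by
  intro s t h
  rw [aInf, aInf, diagPGL, diagPGL, mk_eq_mk_iff_smul] at h
  obtain ⟨c, -, h⟩ := h
  have h0 := congrFun (congrFun h 0) 0
  have h1 := congrFun (congrFun h 1) 1
  simp [diagGL] at h0 h1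
  rw [← h1, one_mul, Real.exp_eq_exp] at h0
  exact h0.symm

theorem normTrace_aInf (t : ℝ) : normTrace (aInf t) = Real.exp t + 2 + Real.exp (-t) := by
  rw [aInf, diagPGL, normTrace_mk, Real.exp_neg]
  have := (Real.exp_pos t).ne'
  simp [diagGL, Matrix.trace_fin_two, Matrix.det_fin_two]
  field_simp
  ring

theorem normTrace_eq_exp {x g : PGL(2, ℝ)} {t : ℝ} (h : x * g = g * aInf t) :
    normTrace x = Real.exp t + 2 + Real.exp (-t) := by
  rw [← normTrace_aInf, ← normTrace_conj x g, mul_assoc, h, inv_mul_cancel_left]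

theorem isIntegral_exp_of_int {t : ℝ} {n : ℤ} (h : Real.exp t + 2 + Real.exp (-t) = n) :
    IsIntegral ℤ (Real.exp t) := by
  refine ⟨Polynomial.X ^ 2 - Polynomial.C (n - 2) * Polynomial.X + 1, ?_, ?_⟩
  · monicity!
  · simp only [Polynomial.eval₂_add, Polynomial.eval₂_sub, Polynomial.eval₂_pow,
      Polynomial.eval₂_mul, Polynomial.eval₂_X, Polynomial.eval₂_C, Polynomial.eval₂_one]
    have h2 : Real.exp t * Real.exp (-t) = 1 := by
      rw [← Real.exp_add, add_neg_cancel, Real.exp_zero]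
    simp only [algebraMap_int_eq, map_sub, eq_intCast, Int.cast_ofNat, ← h]
    linear_combination -h2

/-- The times `t` for which `g a_∞(t) g⁻¹` is the image of an element of `PGL₂(𝒪_S)` and the
quotient `e ^ t` of its eigenvalues is a unit of the ring of algebraic integers. It contains the
stabilizers of all branch points. -/
noncomputable def unitTimes (S : Finset Nat.Primes) (g : PGL(2, ℝ)) : AddSubgroup ℝ where
  carrier := {t | (∃ d : PGL(2, SInt S), realPlace S d * g = g * aInf t) ∧
    IsIntegral ℤ (Real.exp t) ∧ IsIntegral ℤ (Real.exp (-t))}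
  add_mem' := by
    rintro s t ⟨⟨d, hd⟩, hs, hs'⟩ ⟨⟨e, he⟩, ht, ht'⟩
    refine ⟨⟨d * e, ?_⟩, ?_, ?_⟩
    · rw [map_mul, mul_assoc, he, ← mul_assoc, hd, aInf_add, mul_assoc]
    · rw [Real.exp_add]; exact hs.mul ht
    · rw [neg_add, Real.exp_add]; exact hs'.mul ht'
  zero_mem' := by
    refine ⟨⟨1, by simp [aInf_zero]⟩, ?_, ?_⟩ <;> simp [isIntegral_one]
  neg_mem' := by
    rintro t ⟨⟨d, hd⟩, ht, ht'⟩
    refine ⟨⟨d⁻¹, ?_⟩, ht', by rwa [neg_neg]⟩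
    rw [map_inv, inv_mul_eq_iff_eq_mul, ← mul_assoc, hd, mul_assoc, ← aInf_add, add_neg_cancel,
      aInf_zero, mul_one]

theorem exists_int_normTrace_of_mem_unitTimes {S : Finset Nat.Primes} {g : PGL(2, ℝ)} {t : ℝ}
    (ht : t ∈ unitTimes S g) : ∃ n : ℤ, Real.exp t + 2 + Real.exp (-t) = n := by
  obtain ⟨⟨d, hd⟩, h1, h2⟩ := ht
  obtain ⟨q, hq, -, -⟩ := exists_rat_normTrace d
  rw [normTrace_eq_exp hd] at hq
  have hint : IsIntegral ℤ ((q : ℚ) : ℝ) := by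
    rw [← hq]
    exact (h1.add (by simpa using isIntegral_algebraMap (R := ℤ) (A := ℝ) (x := 2))).add h2
  have hint' : IsIntegral ℤ q :=
    (isIntegral_algebraMap_iff (algebraMap ℚ ℝ).injective).1 hint
  obtain ⟨n, hn⟩ := IsIntegrallyClosed.isIntegral_iff.1 hint'
  refine ⟨n, ?_⟩
  rw [hq, ← hn]
  simp

theorem unitTimes_isolated {S : Finset Nat.Primes} {g : PGL(2, ℝ)} :
    Disjoint (unitTimes S g : Set ℝ) (Set.Ioo 0 (Real.log 2)) := by
  rw [Set.disjoint_left]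
  rintro t ht ⟨h0, h1⟩
  obtain ⟨n, hn⟩ := exists_int_normTrace_of_mem_unitTimes ht
  have hy1 : 1 < Real.exp t := Real.one_lt_exp_iff.2 h0
  have hy2 : Real.exp t < 2 := by
    rw [← Real.exp_log (show (0 : ℝ) < 2 by norm_num)]
    exact Real.exp_lt_exp.2 h1
  have hmul : Real.exp t * Real.exp (-t) = 1 := by
    rw [← Real.exp_add, add_neg_cancel, Real.exp_zero]
  have hpos := Real.exp_pos (-t)
  have hlo : (4 : ℝ) < n := by rw [← hn]; nlinarith [mul_pos (sub_pos.2 hy1) (sub_pos.2 hy1)]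
  have hhi : (n : ℝ) < 5 := by
    rw [← hn]
    nlinarith
  have h4 : (4 : ℤ) < n := by exact_mod_cast hlo
  have h5 : n < (5 : ℤ) := by exact_mod_cast hhi
  lia

theorem mem_unitTimes_of_conj_mem {S : Finset Nat.Primes} {g : PGL(2, ℝ)} {t : ℝ}
    {d : PGL(2, SInt S)} (hd : realPlace S d * g = g * aInf t)
    (hp : ∀ p ∈ S, ∃ y, y⁻¹ * padicPlace S p d * y ∈ intPGL p) : t ∈ unitTimes S g := by
  obtain ⟨q, hq, hqp, hqS⟩ := exists_rat_normTrace d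
  obtain ⟨n, hn⟩ := exists_int_of_norm_le (q := q) fun p => by
    by_cases hpS : p ∈ S
    · obtain ⟨y, hy⟩ := hp p hpS
      rw [← hqp, ← normTrace_conj _ y]
      exact norm_normTrace_le_one hy
    · exact hqS p hpS
  rw [normTrace_eq_exp hd, ← hn, Rat.cast_intCast] at hq
  refine ⟨⟨d, hd⟩, isIntegral_exp_of_int hq, isIntegral_exp_of_int (n := n) ?_⟩
  rw [neg_neg, ← hq]
  ring

theorem exists_int_of_isPeriodic {g : PGL(2, ℝ)} {t : ℝ} :
    translate (coset GammaInf g) (aInf t) = coset GammaInf g ↔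
      ∃ r : PGL(2, ℤ), ProjGenLinGroup.map (Int.castRingHom ℝ) r * g = g * aInf t := by
  rw [translate_coset, eq_comm, coset_eq_iff]
  constructor
  · rintro ⟨_, ⟨r, rfl⟩, h⟩
    exact ⟨r, h⟩
  · rintro ⟨r, h⟩
    exact ⟨_, ⟨r, rfl⟩, h⟩

/-- The group of unit times of a periodic class is infinite cyclic. -/
theorem exists_generator (S : Finset Nat.Primes) {g : PGL(2, ℝ)}
    (hg : IsPeriodic (coset GammaInf g)) :
    ∃ (u : ℝ) (D : PGL(2, SInt S)), 0 < u ∧ realPlace S D * g = g * aInf u ∧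
      (∀ p, ‖normTrace (padicPlace S p D)‖ ≤ 1) ∧
      ∀ t ∈ unitTimes S g, 0 < t → ∃ j : ℕ, 0 < j ∧ t = j * u := by
  obtain ⟨t, ht0, ht⟩ := hg
  obtain ⟨r, hr⟩ := exists_int_of_isPeriodic.1 ht
  have htU : t ∈ unitTimes S g := by
    refine mem_unitTimes_of_conj_mem (d := ofIntPGL S r) (by rw [realPlace_ofIntPGL, hr])
      fun p _ => ⟨1, ?_⟩
    rw [inv_one, one_mul, mul_one, padicPlace_ofIntPGL]
    exact map_int_mem_intPGL r
  obtain ⟨v, hv⟩ := AddSubgroup.cyclic_of_isolated_zero (Real.log_pos one_lt_two)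
    (unitTimes_isolated (S := S) (g := g))
  have hmem : ∀ s, s ∈ unitTimes S g ↔ ∃ k : ℤ, (k : ℝ) * v = s := fun s => by
    rw [hv, AddSubgroup.mem_closure_singleton]
    simp
  have hv0 : v ≠ 0 := by
    rintro rfl
    obtain ⟨k, hk⟩ := (hmem t).1 htU
    rw [mul_zero] at hk
    exact ht0.ne hk
  have hvU : |v| ∈ unitTimes S g := by
    have h1 : v ∈ unitTimes S g := (hmem v).2 ⟨1, by simp⟩
    rcases abs_choice v with h | h <;> rw [h]
    · exact h1
    · exact neg_mem h1
  obtain ⟨n, hn⟩ := exists_int_normTrace_of_mem_unitTimes hvU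
  obtain ⟨⟨D, hD⟩, -, -⟩ := hvU
  refine ⟨|v|, D, abs_pos.2 hv0, hD, fun p => ?_, fun s hs hs0 => ?_⟩
  · obtain ⟨q, hq, hqp, -⟩ := exists_rat_normTrace D
    rw [normTrace_eq_exp hD, hn] at hq
    have hq' : q = n := by exact_mod_cast hq.symm
    rw [hqp, hq', Rat.cast_intCast]
    exact Padic.norm_int_le_one n
  · obtain ⟨k, hk⟩ := (hmem s).1 hs
    have hk0 : k ≠ 0 := by
      rintro rfl
      rw [Int.cast_zero, zero_mul] at hk
      exact hs0.ne hk
    refine ⟨k.natAbs, Int.natAbs_pos.2 hk0, ?_⟩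
    rw [Nat.cast_natAbs, Int.cast_abs, ← abs_mul, hk, abs_of_pos hs0]

theorem relOrder_levelPow_pos_of_normTrace {p : ℕ} [Fact p.Prime] {x : PGL(2, ℚ_[p])}
    (hx : ‖normTrace x‖ ≤ 1) (n : ℕ) : 0 < relOrder (levelPow p n) x := by
  induction x using ProjGenLinGroup.induction_on with | mk b =>
  rw [normTrace_mk] at hx
  obtain ⟨r, a, hr, hE, hd⟩ := exists_smul_pow_nearOne b hx
  exact relOrder_levelPow_pos hr hE hd n

theorem inv_conj_pow {G : Type*} [Group G] (a b : G) (n : ℕ) :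
    (b⁻¹ * a * b) ^ n = b⁻¹ * a ^ n * b := by
  have := conj_pow (i := n) (a := b⁻¹) (b := a)
  rwa [inv_inv] at this

theorem pow_mul_eq_mul_pow {G : Type*} [Group G] {a b g : G} (h : a * g = g * b) (n : ℕ) :
    a ^ n * g = g * b ^ n :=
  ((SemiconjBy.pow_right (show SemiconjBy g b a from h.symm) n).eq).symm

/-- The least exponent of a power of `D` that fixes the branch point of radius `h`. -/
noncomputable def branchExponent (S : Finset Nat.Primes) (D : PGL(2, SInt S)) (ω : GS S) (h : ℕ+) :
    ℕ :=
  Finset.univ.lcm fun p : S =>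
    relOrder (levelPow p.1 (padicValNat p.1 h)) ((ω p)⁻¹ * padicPlace S p D * ω p)

theorem branchExponent_pos {S : Finset Nat.Primes} {D : PGL(2, SInt S)}
    (hD : ∀ p, ‖normTrace (padicPlace S p D)‖ ≤ 1) (ω : GS S) (h : ℕ+) :
    0 < branchExponent S D ω h := by
  rw [Nat.pos_iff_ne_zero, branchExponent, Ne, Finset.lcm_eq_zero_iff]
  rintro ⟨p, -, hp⟩
  refine (relOrder_levelPow_pos_of_normTrace ?_ _).ne' hp
  rw [normTrace_conj]
  exact hD p

theorem branchExponent_dvd_iff {S : Finset Nat.Primes} (D : PGL(2, SInt S)) (ω : GS S) (h : ℕ+)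
    (j : ℕ) : branchExponent S D ω h ∣ j ↔
      ∀ p : S, (diagPGL 1 (radiusUnit ℚ_[p.1] h))⁻¹ * ((ω p)⁻¹ * padicPlace S p (D ^ j) * ω p) *
          diagPGL 1 (radiusUnit ℚ_[p.1] h) ∈ intPGL p.1 := by
  rw [branchExponent, Finset.lcm_dvd_iff]
  refine ⟨fun H p => ?_, fun H p _ => ?_⟩
  · have := H p (Finset.mem_univ p)
    rw [← pow_mem_iff_relOrder_dvd, ← levelGroup_radiusUnit, mem_levelGroup_iff] at this
    rw [map_pow]
    convert this using 3
    exact (inv_conj_pow _ _ _).symm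
  · have := H p
    rw [← pow_mem_iff_relOrder_dvd, ← levelGroup_radiusUnit, mem_levelGroup_iff]
    rw [map_pow] at this
    convert this using 3
    exact inv_conj_pow _ _ _

/-- The period of a branch point, in terms of the generator `D` of the unit elements. -/
theorem isLeast_period_branchPoint {S : Finset Nat.Primes} {g : PGL(2, ℝ)} {u : ℝ}
    {D : PGL(2, SInt S)} (hu : 0 < u) (hDu : realPlace S D * g = g * aInf u)
    (hD : ∀ p, ‖normTrace (padicPlace S p D)‖ ≤ 1)
    (hgen : ∀ t ∈ unitTimes S g, 0 < t → ∃ j : ℕ, 0 < j ∧ t = j * u)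
    {ω : GS S} (hω : ω ∈ KS S) {h : ℕ+} (hh : h ∈ radii S) :
    IsLeast {t : ℝ | 0 < t ∧ translate (branchPoint S g ω h) (aInf t) = branchPoint S g ω h}
      (branchExponent S D ω h * u) := by
  have hpow : ∀ j : ℕ, realPlace S (D ^ j) * g = g * aInf (j * u) := by
    intro j
    rw [aInf_nsmul, map_pow]
    exact pow_mul_eq_mul_pow hDu j
  constructor
  · refine ⟨mul_pos (by exact_mod_cast branchExponent_pos hD ω h) hu, ?_⟩
    rw [translate_branchPoint_iff g hω hh]
    exact ⟨D ^ branchExponent S D ω h, hpow _, (branchExponent_dvd_iff D ω h _).1 dvd_rfl⟩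
  · rintro t ⟨ht0, ht⟩
    rw [translate_branchPoint_iff g hω hh] at ht
    obtain ⟨δ, h1, h2⟩ := ht
    have htU : t ∈ unitTimes S g := by
      refine mem_unitTimes_of_conj_mem h1 fun p hp =>
        ⟨ω ⟨p, hp⟩ * diagPGL 1 (radiusUnit ℚ_[p] h), ?_⟩
      have h3 := h2 ⟨p, hp⟩
      convert h3 using 1
      simp only [mul_inv_rev, mul_assoc]
    obtain ⟨j, hj, rfl⟩ := hgen t htU ht0
    have hδ : δ = D ^ j := by
      apply realPlace_injective S
      exact mul_right_cancel (h1.trans (hpow j).symm)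
    subst hδ
    have hdvd := (branchExponent_dvd_iff D ω h j).2 h2
    have := Nat.le_of_dvd hj hdvd
    gcongr

theorem period_branchPoint {S : Finset Nat.Primes} {g : PGL(2, ℝ)} {u : ℝ}
    {D : PGL(2, SInt S)} (hu : 0 < u) (hDu : realPlace S D * g = g * aInf u)
    (hD : ∀ p, ‖normTrace (padicPlace S p D)‖ ≤ 1)
    (hgen : ∀ t ∈ unitTimes S g, 0 < t → ∃ j : ℕ, 0 < j ∧ t = j * u)
    {ω : GS S} (hω : ω ∈ KS S) {h : ℕ+} (hh : h ∈ radii S) :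
    period (branchPoint S g ω h) = branchExponent S D ω h * u :=
  (isLeast_period_branchPoint hu hDu hD hgen hω hh).csInf_eq

theorem one_mem_radii (S : Finset Nat.Primes) : (1 : ℕ+) ∈ radii S :=
  mem_radii_iff.2 fun p hp => absurd (Nat.dvd_one.1 hp) p.2.ne_one

theorem branchPoint_one (S : Finset Nat.Primes) (g : PGL(2, ℝ)) {ω : GS S} (hω : ω ∈ KS S) :
    branchPoint S g ω 1 = coset GammaInf g := by
  have := branchPoint_eq_of_frame g ω 1 1 fun p => by
    have e : diagPGL 1 (radiusUnit ℚ_[p.1] 1) = 1 := by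
      have : radiusUnit ℚ_[p.1] 1 = 1 := by ext; simp [radiusUnit]
      rw [this, diagPGL, ← map_one ProjGenLinGroup.mk]
      congr 1
      ext i j
      fin_cases i <;> fin_cases j <;> simp [diagGL]
    rw [e, map_one, one_mul, mul_one]
    exact mem_KS_iff.1 hω p
  rw [this, map_one, one_mul]

/-- The period of a periodic class is attained: this is the computation of the period of a branch
point, applied to `S = ∅` and `h = 1`. -/
theorem IsPeriodic.isLeast_period {x : XInf} (hx : IsPeriodic x) :
    IsLeast {t : ℝ | 0 < t ∧ translate x (aInf t) = x} (period x) := by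
  obtain ⟨g, rfl⟩ := Quotient.exists_rep x
  change IsPeriodic (coset GammaInf g) at hx
  obtain ⟨u, D, hu, hDu, hD, hgen⟩ := exists_generator ∅ hx
  have h1 := isLeast_period_branchPoint hu hDu hD hgen (one_mem (KS ∅)) (one_mem_radii ∅)
  rw [branchPoint_one ∅ g (one_mem _)] at h1
  have h2 : period (coset GammaInf g) = _ := h1.csInf_eq
  change IsLeast {t : ℝ | 0 < t ∧ translate (coset GammaInf g) (aInf t) = coset GammaInf g}
    (period (coset GammaInf g))
  rw [h2]
  exact h1

theorem IsPeriodic.period_pos {x : XInf} (hx : IsPeriodic x) : 0 < period x :=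
  hx.isLeast_period.1.1

theorem period_le {x : XInf} {t : ℝ} (ht : 0 < t) (h : translate x (aInf t) = x) : period x ≤ t :=
  csInf_le ⟨0, fun _ hs => hs.1.le⟩ ⟨ht, h⟩

theorem exists_isGammaOf {g : PGL(2, ℝ)} (hg : IsPeriodic (coset GammaInf g)) :
    ∃ γ : PGL(2, ℤ), IsGammaOf g γ := by
  obtain ⟨r, hr⟩ := exists_int_of_isPeriodic.1 hg.isLeast_period.1.2
  exact ⟨r⁻¹, by rw [IsGammaOf, map_inv, inv_inv, hr]⟩

/-- The generator of the unit elements has a power that is the inverse of `γ_x`. -/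
theorem exists_pow_eq_gamma {S : Finset Nat.Primes} {g : PGL(2, ℝ)} {u : ℝ}
    {D : PGL(2, SInt S)} (hg : IsPeriodic (coset GammaInf g))
    (hDu : realPlace S D * g = g * aInf u)
    (hgen : ∀ t ∈ unitTimes S g, 0 < t → ∃ j : ℕ, 0 < j ∧ t = j * u) {γ : PGL(2, ℤ)}
    (hγ : IsGammaOf g γ) : ∃ e : ℕ, 0 < e ∧ D ^ e = (ofIntPGL S γ)⁻¹ := by
  have hδ : realPlace S (ofIntPGL S γ)⁻¹ * g = g * aInf (period (coset GammaInf g)) := by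
    rw [map_inv, realPlace_ofIntPGL]
    exact hγ
  have hU : period (coset GammaInf g) ∈ unitTimes S g := by
    refine mem_unitTimes_of_conj_mem hδ fun p _ => ⟨1, ?_⟩
    rw [inv_one, one_mul, mul_one, map_inv, padicPlace_ofIntPGL]
    exact inv_mem (map_int_mem_intPGL γ)
  obtain ⟨e, he, ht⟩ := hgen _ hU hg.period_pos
  refine ⟨e, he, realPlace_injective S (mul_right_cancel (b := g) ?_)⟩
  rw [hδ, ht, aInf_nsmul, map_pow]
  exact pow_mul_eq_mul_pow hDu e

/-! ### Growth of the periods along a non-degenerate branch -/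

theorem dvd_of_dvd_prime_mul {p d M : ℕ} (hp : p.Prime) (hM : M ≠ 0) (hd : d ∣ p * M)
    (hv : padicValNat p d ≤ padicValNat p M) : d ∣ M := by
  have hF : Fact p.Prime := ⟨hp⟩
  rcases eq_or_ne d 0 with rfl | hd0
  · rw [zero_dvd_iff] at hd
    exact absurd hd (mul_ne_zero hp.ne_zero hM)
  obtain ⟨k, hk⟩ := (pow_padicValNat_dvd : p ^ padicValNat p d ∣ d)
  have hpk : ¬ p ∣ k := by
    intro h
    obtain ⟨l, rfl⟩ := h
    refine pow_succ_padicValNat_not_dvd (p := p) hd0 ⟨l, ?_⟩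
    rw [pow_succ, mul_assoc]
    exact hk
  have hcop : Nat.Coprime p k := (Nat.Prime.coprime_iff_not_dvd hp).2 hpk
  have h1 : k ∣ M := (hcop.symm.dvd_of_dvd_mul_left) ((Dvd.intro_left _ hk.symm).trans hd)
  have h2 : p ^ padicValNat p d ∣ M := (padicValNat_dvd_iff_le hM).2 hv
  rw [hk]
  exact (hcop.pow_left _).mul_dvd_of_dvd_of_dvd h2 h1

theorem lcm_prime_mul {p a b : ℕ} (hp : p.Prime) (ha : 0 < a) (hb : 0 < b)
    (hv : padicValNat p b ≤ padicValNat p a) : Nat.lcm (p * a) b = p * Nat.lcm a b := by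
  have hF : Fact p.Prime := ⟨hp⟩
  apply Nat.dvd_antisymm
  · exact Nat.lcm_dvd (mul_dvd_mul_left p (Nat.dvd_lcm_left a b))
      (dvd_mul_of_dvd_right (Nat.dvd_lcm_right a b) p)
  · obtain ⟨M, hM⟩ := (dvd_mul_right p a).trans (Nat.dvd_lcm_left (p * a) b)
    have hL : 0 < Nat.lcm (p * a) b := Nat.lcm_pos (mul_pos hp.pos ha) hb
    have hM0 : M ≠ 0 := by
      rintro rfl
      rw [mul_zero] at hM
      exact hL.ne' hM
    have haM : a ∣ M := by
      have := Nat.dvd_lcm_left (p * a) b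
      rw [hM] at this
      exact Nat.dvd_of_mul_dvd_mul_left hp.pos this
    have hbM : b ∣ M := by
      refine dvd_of_dvd_prime_mul hp hM0 (hM ▸ Nat.dvd_lcm_right (p * a) b) (hv.trans ?_)
      exact (padicValNat_dvd_iff_le hM0).1 (pow_padicValNat_dvd.trans haM)
    rw [hM]
    exact mul_dvd_mul_left p (Nat.lcm_dvd haM hbM)

theorem padicValNat_lcm_le {ι : Type*} {p : ℕ} (hp : p.Prime) {A : ℕ} (s : Finset ι) (F : ι → ℕ)
    (hF : ∀ i ∈ s, 0 < F i ∧ padicValNat p (F i) ≤ A) :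
    0 < s.lcm F ∧ padicValNat p (s.lcm F) ≤ A := by
  classical
  induction s using Finset.induction_on with
  | empty => simp
  | insert i s hi ih =>
    obtain ⟨h1, h2⟩ := ih fun j hj => hF j (Finset.mem_insert_of_mem hj)
    obtain ⟨h3, h4⟩ := hF i (Finset.mem_insert_self i s)
    rw [Finset.lcm_insert]
    change 0 < Nat.lcm (F i) (s.lcm F) ∧ padicValNat p (Nat.lcm (F i) (s.lcm F)) ≤ A
    refine ⟨Nat.lcm_pos h3 h1, ?_⟩
    rw [← Nat.factorization_def _ hp, Nat.factorization_lcm h3.ne' h1.ne', Finsupp.sup_apply,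
      Nat.factorization_def _ hp, Nat.factorization_def _ hp]
    exact max_le h4 h2

/-- If every `f p` is eventually multiplied by `p` in each step, then the least common multiple of
the `f p (v_p(h))` is multiplied by `p` when `h` is, as soon as `v_p(h)` is large. -/
theorem exists_lcm_mul_eq (S : Finset Nat.Primes) (f : S → ℕ → ℕ) (hpos : ∀ p n, 0 < f p n)
    (hf : ∀ p : S, ∃ n₁, ∀ n, n₁ ≤ n → f p (n + 1) = (p : ℕ) * f p n) :
    ∃ N : S → ℕ, ∀ (p : S) (h : ℕ), h ≠ 0 → N p ≤ padicValNat p h →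
      (Finset.univ.lcm fun q : S => f q (padicValNat q (p * h))) =
        p * Finset.univ.lcm fun q : S => f q (padicValNat q h) := by
  classical
  choose n₁ hn₁ using hf
  have hprime : ∀ p : S, ((p : Nat.Primes) : ℕ).Prime := fun p => p.1.2
  have hFact : ∀ p : S, Fact ((p : Nat.Primes) : ℕ).Prime := fun p => ⟨hprime p⟩
  have hne : ∀ p q : S, p ≠ q → ((p : Nat.Primes) : ℕ) ≠ ((q : Nat.Primes) : ℕ) :=
    fun p q h h' => h (Subtype.ext (Subtype.ext h'))
  have hpow : ∀ (p : S) (k : ℕ), f p (n₁ p + k) = (p : ℕ) ^ k * f p (n₁ p) := by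
    intro p k
    induction k with
    | zero => simp
    | succ k ih => rw [← add_assoc, hn₁ p _ (Nat.le_add_right _ _), ih, pow_succ]; ring
  -- the `p`-adic valuations of the other factors are bounded
  have hbound : ∀ p q : S, ∃ A, q ≠ p → ∀ m, padicValNat p (f q m) ≤ A := by
    intro p q
    refine ⟨∑ m ∈ Finset.range (n₁ q + 1), padicValNat p (f q m), fun hqp m => ?_⟩
    have hsmall : ∀ m, m ≤ n₁ q → padicValNat p (f q m) ≤
        ∑ m ∈ Finset.range (n₁ q + 1), padicValNat p (f q m) := fun m hm =>
      Finset.single_le_sum (f := fun m => padicValNat p (f q m)) (fun _ _ => Nat.zero_le _)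
        (Finset.mem_range.2 (by lia))
    rcases le_total m (n₁ q) with hm | hm
    · exact hsmall m hm
    · obtain ⟨k, rfl⟩ := Nat.exists_eq_add_of_le hm
      have := hFact p
      rw [hpow, padicValNat.mul (pow_ne_zero _ (hprime q).ne_zero) (hpos q _).ne',
        padicValNat.pow]
      have h0 : padicValNat p ((q : Nat.Primes) : ℕ) = 0 :=
        padicValNat.eq_zero_of_not_dvd fun hd =>
          hne p q hqp.symm ((Nat.prime_dvd_prime_iff_eq (hprime p) (hprime q)).1 hd)
      rw [h0, mul_zero, zero_add]
      exact hsmall _ le_rfl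
  choose A hA using hbound
  refine ⟨fun p => n₁ p + ∑ q, A p q, fun p h hh hN => ?_⟩
  have := hFact p
  obtain ⟨k, hk⟩ := Nat.exists_eq_add_of_le hN
  have hvp : padicValNat p (p * h) = padicValNat p h + 1 := by
    rw [padicValNat.mul (hprime p).ne_zero hh, padicValNat_self, add_comm]
  have hvq : ∀ q : S, q ≠ p → padicValNat q (p * h) = padicValNat q h := by
    intro q hq
    have := hFact q
    have h0 : padicValNat q ((p : Nat.Primes) : ℕ) = 0 :=
      padicValNat.eq_zero_of_not_dvd fun hd =>
        hne q p hq ((Nat.prime_dvd_prime_iff_eq (hprime q) (hprime p)).1 hd)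
    rw [padicValNat.mul (hprime p).ne_zero hh, h0, zero_add]
  rw [← Finset.insert_erase (Finset.mem_univ p), Finset.lcm_insert, Finset.lcm_insert, hvp,
    hn₁ p _ (by lia)]
  have hrest : ((Finset.univ.erase p).lcm fun q : S => f q (padicValNat q (p * h))) =
      (Finset.univ.erase p).lcm fun q : S => f q (padicValNat q h) :=
    Finset.lcm_congr rfl fun q hq => by rw [hvq q (Finset.ne_of_mem_erase hq)]
  rw [hrest]
  obtain ⟨hRpos, hRv⟩ := padicValNat_lcm_le (hprime p) (A := ∑ q, A p q) (Finset.univ.erase p)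
    (fun q : S => f q (padicValNat q h)) fun q hq =>
      ⟨hpos _ _, (hA p q (Finset.ne_of_mem_erase hq) _).trans
        (Finset.single_le_sum (f := fun q => A p q) (fun _ _ => Nat.zero_le _)
          (Finset.mem_univ q))⟩
  refine lcm_prime_mul (hprime p) (hpos _ _) hRpos (hRv.trans ?_)
  rw [hk, add_assoc, hpow, padicValNat.mul (pow_ne_zero _ (hprime p).ne_zero) (hpos p _).ne',
    padicValNat.prime_pow]
  lia

theorem mem_radii_of_dvd {S : Finset Nat.Primes} {h k : ℕ+} (hh : h ∈ radii S)
    (hk : (k : ℕ) ∣ h) : k ∈ radii S :=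
  mem_radii_iff.2 fun p hp => mem_radii_iff.1 hh p (hp.trans hk)

/-- A function on the radii that does not change when `h` is multiplied by some `p ∈ S` whose
exponent in `h` is large only depends on the greatest common divisor of `h` with a fixed integer. -/
theorem exists_eq_gcd {α : Type*} (S : Finset Nat.Primes) (c : ℕ+ → α) (N : S → ℕ)
    (hc : ∀ (p : S) (h h' : ℕ+), h ∈ radii S → h' ∈ radii S → (h' : ℕ) = p * h →
      N p ≤ padicValNat p h → c h' = c h) :
    ∃ H : ℕ+, ∀ h ∈ radii S, c h = c (PNat.gcd h H) := by
  classical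
  have hH0 : 0 < ∏ p : S, ((p : Nat.Primes) : ℕ) ^ N p :=
    Finset.prod_pos fun p _ => pow_pos p.1.2.pos _
  refine ⟨⟨_, hH0⟩, ?_⟩
  set H : ℕ+ := ⟨_, hH0⟩ with hH
  have hHN : ∀ p : S, N p ≤ padicValNat p H := fun p => by
    rw [← padicValNat_dvd_iff_le H.ne_zero]
    exact Finset.dvd_prod_of_mem (fun p : S => ((p : Nat.Primes) : ℕ) ^ N p) (Finset.mem_univ p)
  intro h
  induction h using PNat.strongInductionOn with | _ h ih =>
  intro hh
  by_cases hdvd : (h : ℕ) ∣ H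
  · have : PNat.gcd h H = h := PNat.eq (by rw [PNat.gcd_coe]; exact Nat.gcd_eq_left hdvd)
    rw [this]
  · obtain ⟨p, hp, hlt⟩ : ∃ p : ℕ, p.Prime ∧ padicValNat p H < padicValNat p h := by
      by_contra! hcon
      apply hdvd
      rw [← Nat.factorization_le_iff_dvd h.ne_zero H.ne_zero]
      intro p
      by_cases hp : p.Prime
      · rw [Nat.factorization_def _ hp, Nat.factorization_def _ hp]
        exact hcon p hp
      · rw [Nat.factorization_eq_zero_of_not_prime _ hp]
        exact Nat.zero_le _
    have hF : Fact p.Prime := ⟨hp⟩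
    have hpd : p ∣ (h : ℕ) := dvd_of_one_le_padicValNat (by lia)
    have hpS : (⟨p, hp⟩ : Nat.Primes) ∈ S := mem_radii_iff.1 hh ⟨p, hp⟩ hpd
    obtain ⟨k, hk⟩ := hpd
    obtain ⟨k, rfl⟩ : ∃ k' : ℕ+, (k' : ℕ) = k :=
      CanLift.prf k (Nat.pos_of_ne_zero fun h0 => h.ne_zero (by rw [hk, h0, mul_zero]))
    have hkd : (k : ℕ) ∣ h := ⟨p, by rw [hk, mul_comm]⟩
    have hkr : k ∈ radii S := mem_radii_of_dvd hh hkd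
    have hkv : padicValNat p h = padicValNat p k + 1 := by
      rw [hk, padicValNat.mul hp.ne_zero k.ne_zero, padicValNat_self, add_comm]
    have hNk : N ⟨⟨p, hp⟩, hpS⟩ ≤ padicValNat p H := hHN ⟨⟨p, hp⟩, hpS⟩
    have hlt' : k < h := by
      rw [← PNat.coe_lt_coe, hk]
      exact lt_mul_of_one_lt_left k.pos hp.one_lt
    have hgcd : PNat.gcd h H = PNat.gcd k H := by
      apply PNat.eq
      rw [PNat.gcd_coe, PNat.gcd_coe]
      apply Nat.dvd_antisymm
      · refine Nat.dvd_gcd ?_ (Nat.gcd_dvd_right _ _)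
        refine dvd_of_dvd_prime_mul hp k.ne_zero (hk ▸ Nat.gcd_dvd_left _ _) ?_
        have : padicValNat p (Nat.gcd h H) ≤ padicValNat p H :=
          (padicValNat_dvd_iff_le H.ne_zero).1 (pow_padicValNat_dvd.trans (Nat.gcd_dvd_right _ _))
        lia
      · exact Nat.dvd_gcd ((Nat.gcd_dvd_left _ _).trans hkd) (Nat.gcd_dvd_right _ _)
    rw [hgcd, ← ih _ hlt' hkr]
    refine hc ⟨⟨p, hp⟩, hpS⟩ k h hkr hh hk ?_
    change _ ≤ padicValNat p k
    lia

theorem finite_and_eventually_const {α : Type*} {S : Finset Nat.Primes} {c : ℕ+ → α} {H : ℕ+}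
    (hc : ∀ h ∈ radii S, c h = c (PNat.gcd h H)) :
    (c '' radii S).Finite ∧
      ∀ u : ℕ → ℕ+, (∀ n, u n ∈ radii S) → (∀ n, (u n : ℕ) ∣ (u (n + 1) : ℕ)) →
        ∃ N : ℕ, ∀ n : ℕ, N ≤ n → c (u n) = c (u N) := by
  constructor
  · refine ((Set.finite_Iic H).image c).subset ?_
    rintro _ ⟨h, hh, rfl⟩
    refine ⟨PNat.gcd h H, ?_, (hc h hh).symm⟩
    exact PNat.le_of_dvd (PNat.gcd_dvd_right h H)
  · intro u hu hdvd
    have hmono : Monotone fun n => (PNat.gcd (u n) H : ℕ) := monotone_nat_of_le_succ fun n => by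
      rw [PNat.gcd_coe, PNat.gcd_coe]
      exact Nat.le_of_dvd (Nat.gcd_pos_of_pos_right _ H.pos)
        (Nat.gcd_dvd_gcd_of_dvd_left _ (hdvd n))
    obtain ⟨N, hN⟩ := exists_forall_eq_of_monotone_of_le hmono (r := H) fun n => by
      rw [PNat.gcd_coe]
      exact Nat.le_of_dvd H.pos (Nat.gcd_dvd_right _ _)
    refine ⟨N, fun n hn => ?_⟩
    rw [hc _ (hu n), hc _ (hu N), PNat.eq (hN n hn)]

/-! #### Upper triangular elements -/

theorem IsUpperTriangular.inv {K : Type*} [Field K] {x : PGL(2, K)} (hx : IsUpperTriangular x) :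
    IsUpperTriangular x⁻¹ := by
  obtain ⟨m, rfl, h⟩ := hx
  refine ⟨m⁻¹, map_inv _ _, ?_⟩
  rw [Matrix.coe_units_inv, Matrix.inv_def, Matrix.adjugate_fin_two]
  simp [h]

theorem IsUpperTriangular.mul {K : Type*} [Field K] {x y : PGL(2, K)} (hx : IsUpperTriangular x)
    (hy : IsUpperTriangular y) : IsUpperTriangular (x * y) := by
  obtain ⟨m, rfl, h⟩ := hx
  obtain ⟨n, rfl, h'⟩ := hy
  refine ⟨m * n, map_mul _ _ _, ?_⟩
  rw [Units.val_mul, Matrix.mul_apply, Fin.sum_univ_two, h, h']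
  ring

theorem IsUpperTriangular.pow {K : Type*} [Field K] {x : PGL(2, K)} (hx : IsUpperTriangular x)
    (n : ℕ) : IsUpperTriangular (x ^ n) := by
  induction n with
  | zero => exact ⟨1, by simp, by simp⟩
  | succ n ih => rw [pow_succ]; exact ih.mul hx

theorem isUpperTriangular_mk_iff {K : Type*} [Field K] {m : GL (Fin 2) K} :
    IsUpperTriangular (ProjGenLinGroup.mk m) ↔ (m : Matrix (Fin 2) (Fin 2) K) 1 0 = 0 := by
  constructor
  · rintro ⟨n, hn, h⟩
    obtain ⟨c, hc, e⟩ := mk_eq_mk_iff_smul.1 hn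
    rw [e, Matrix.smul_apply, h, smul_zero]
  · intro h
    exact ⟨m, rfl, h⟩

theorem eventually_relOrder_of_not_upper {p : ℕ} [Fact p.Prime] {x : PGL(2, ℚ_[p])}
    (hx : ‖normTrace x‖ ≤ 1) (hup : ∀ n, 0 < n → ¬ IsUpperTriangular (x ^ n)) :
    ∃ n₁, ∀ n, n₁ ≤ n → relOrder (levelPow p (n + 1)) x = p * relOrder (levelPow p n) x := by
  induction x using ProjGenLinGroup.induction_on with | mk b =>
  rw [normTrace_mk] at hx
  obtain ⟨r, a, hr, hE, hd⟩ := exists_smul_pow_nearOne b hx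
  refine eventually_relOrder_levelPow hr hE hd fun h0 => hup r hr ?_
  rw [← map_pow, isUpperTriangular_mk_iff, Units.val_pow_eq_pow_val]
  rw [Matrix.smul_apply, smul_eq_mul, mul_eq_zero] at h0
  refine h0.resolve_left ?_
  rintro rfl
  rw [zero_smul, Matrix.det_zero] at hd
  exact zero_ne_one hd

theorem not_upper_of_not_degenerate {S : Finset Nat.Primes} {g : PGL(2, ℝ)} {D : PGL(2, SInt S)}
    {γ : PGL(2, ℤ)} (hγ : IsGammaOf g γ) {e : ℕ} (he : D ^ e = (ofIntPGL S γ)⁻¹) {ω : GS S}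
    (hω : ¬ IsDegenerate S g ω) (p : S) (n : ℕ) (hn : 0 < n) :
    ¬ IsUpperTriangular (((ω p)⁻¹ * padicPlace S p D * ω p) ^ n) := by
  intro hup
  refine hω ⟨γ, hγ, p, n, hn, ?_⟩
  have h1 := (hup.pow e).inv
  have e2 : ((((ω p)⁻¹ * padicPlace S p D * ω p) ^ n) ^ e)⁻¹ =
      (ω p)⁻¹ * (ProjGenLinGroup.map (Int.castRingHom ℚ_[p.1]) γ) ^ n * ω p := by
    rw [← pow_mul, mul_comm, pow_mul, inv_conj_pow, ← map_pow, he, map_inv, padicPlace_ofIntPGL,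
      inv_conj_pow, inv_pow]
    simp [mul_assoc]
  rwa [e2] at h1

/-- The period along a non-degenerate branch, divided by the radius, only depends on the greatest
common divisor of the radius with a fixed number. -/
theorem exists_ratio_eq_gcd {S : Finset Nat.Primes} {g : PGL(2, ℝ)}
    (hg : IsPeriodic (coset GammaInf g)) {ω : GS S} (hω : ω ∈ KS S) (hdeg : ¬ IsDegenerate S g ω) :
    ∃ H : ℕ+, ∀ h ∈ radii S, ratio S g ω h = ratio S g ω (PNat.gcd h H) := by
  obtain ⟨u, D, hu, hDu, hD, hgen⟩ := exists_generator S hg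
  obtain ⟨γ, hγ⟩ := exists_isGammaOf hg
  obtain ⟨e, -, hDe⟩ := exists_pow_eq_gamma hg hDu hgen hγ
  have hD' : ∀ p : S, ‖normTrace ((ω p)⁻¹ * padicPlace S p D * ω p)‖ ≤ 1 := fun p => by
    rw [normTrace_conj]; exact hD p
  obtain ⟨N, hN⟩ := exists_lcm_mul_eq S
    (fun p n => relOrder (levelPow p.1 n) ((ω p)⁻¹ * padicPlace S p D * ω p))
    (fun p n => relOrder_levelPow_pos_of_normTrace (hD' p) n)
    (fun p => eventually_relOrder_of_not_upper (hD' p)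
      (not_upper_of_not_degenerate hγ hDe hdeg p))
  refine exists_eq_gcd S (ratio S g ω) N fun p h h' hh hh' hph hv => ?_
  rw [ratio, ratio, period_branchPoint hu hDu hD hgen hω hh,
    period_branchPoint hu hDu hD hgen hω hh']
  have e1 : branchExponent S D ω h' = p * branchExponent S D ω h := by
    rw [branchExponent, hph]
    exact hN p h h.ne_zero hv
  rw [e1, hph]
  have hp0 : ((p.1 : ℕ) : ℝ) ≠ 0 := by exact_mod_cast p.1.2.ne_zero
  have hh0 : ((h : ℕ) : ℝ) ≠ 0 := by exact_mod_cast h.ne_zero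
  push_cast
  field_simp

/-! ### Row lattices and the index between Hecke friends -/

theorem rowLattice_eq_span (g : GL (Fin 2) ℝ) :
    rowLattice g = (Submodule.span ℤ
      (Set.range fun i => (g : Matrix (Fin 2) (Fin 2) ℝ) i)).toAddSubgroup :=
  (Submodule.span_int_eq_addSubgroupClosure _).symm

theorem rowLattice_le_iff (g g' : GL (Fin 2) ℝ) :
    rowLattice g' ≤ rowLattice g ↔ ∃ m : Matrix (Fin 2) (Fin 2) ℤ,
      (g' : Matrix (Fin 2) (Fin 2) ℝ) = m.map (Int.cast : ℤ → ℝ) * g := by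
  have key : ∀ v, v ∈ rowLattice g ↔ ∃ c : Fin 2 → ℤ,
      ∑ i, c i • (g : Matrix (Fin 2) (Fin 2) ℝ) i = v := fun v => by
    rw [rowLattice_eq_span, Submodule.mem_toAddSubgroup, Submodule.mem_span_range_iff_exists_fun]
  rw [rowLattice, AddSubgroup.closure_le, Set.range_subset_iff]
  simp only [SetLike.mem_coe, key]
  rw [Classical.skolem]
  refine exists_congr fun m => ?_
  rw [← Matrix.ext_iff]
  refine forall_congr' fun i => ?_
  rw [funext_iff]
  refine forall_congr' fun j => ?_
  rw [eq_comm, Matrix.mul_apply]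
  simp only [Finset.sum_apply, zsmul_eq_mul]
  rfl

/-- The rows of an invertible real matrix form a basis of the plane. -/
noncomputable def rowBasis (g : GL (Fin 2) ℝ) : Module.Basis (Fin 2) ℝ (Fin 2 → ℝ) :=
  basisOfLinearIndependentOfCardEqFinrank
    (b := fun i => (g : Matrix (Fin 2) (Fin 2) ℝ) i)
    (Matrix.linearIndependent_rows_iff_isUnit.2 g.isUnit) (by simp)

theorem coe_rowBasis (g : GL (Fin 2) ℝ) :
    ⇑(rowBasis g) = fun i => (g : Matrix (Fin 2) (Fin 2) ℝ) i :=
  coe_basisOfLinearIndependentOfCardEqFinrank _ _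

theorem covolume_span_rowBasis (g : GL (Fin 2) ℝ) :
    ZLattice.covolume (Submodule.span ℤ (Set.range (rowBasis g))) =
      |(g : Matrix (Fin 2) (Fin 2) ℝ).det| := by
  rw [ZLattice.covolume_eq_det _ ((rowBasis g).restrictScalars ℤ)]
  congr 2
  ext i j
  simp [coe_rowBasis]

theorem relIndex_rowLattice {g g' : GL (Fin 2) ℝ} {m : Matrix (Fin 2) (Fin 2) ℤ}
    (h : (g' : Matrix (Fin 2) (Fin 2) ℝ) = m.map (Int.cast : ℤ → ℝ) * g) :
    (rowLattice g').relIndex (rowLattice g) = m.det.natAbs := by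
  have hle := (rowLattice_le_iff g g').2 ⟨m, h⟩
  have hdet : (g : Matrix (Fin 2) (Fin 2) ℝ).det ≠ 0 := det_ne_zero_GL g
  have e : ∀ g : GL (Fin 2) ℝ, rowLattice g =
      (Submodule.span ℤ (Set.range (rowBasis g))).toAddSubgroup := fun g => by
    rw [rowLattice_eq_span, coe_rowBasis]
  rw [e g, e g'] at hle ⊢
  have h1 := ZLattice.covolume_div_covolume_eq_relIndex
    (Submodule.span ℤ (Set.range (rowBasis g'))) (Submodule.span ℤ (Set.range (rowBasis g)))
    hle
  rw [covolume_span_rowBasis, covolume_span_rowBasis, h, Matrix.det_mul, abs_mul,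
    mul_div_cancel_right₀ _ (abs_ne_zero.2 hdet)] at h1
  have h2 : (m.map (Int.cast : ℤ → ℝ)).det = ((m.det : ℤ) : ℝ) := by
    simp [Matrix.det_fin_two]
  rw [h2] at h1
  have h3 : ((m.det.natAbs : ℕ) : ℝ) = |((m.det : ℤ) : ℝ)| := by
    rw [← Int.cast_abs, Int.abs_eq_natAbs, Int.cast_natCast]
  rw [← h3] at h1
  exact_mod_cast h1.symm

/-- The real invertible matrices in the class of `G` are the multiples `c η G` with `η ∈ GL₂(ℤ)`. -/
theorem coset_mk_eq_iff (G G' : GL (Fin 2) ℝ) :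
    coset GammaInf (ProjGenLinGroup.mk G') = coset GammaInf (ProjGenLinGroup.mk G) ↔
      ∃ (η : GL (Fin 2) ℤ) (c : ℝ), c ≠ 0 ∧ (G' : Matrix (Fin 2) (Fin 2) ℝ) =
        c • ((η : Matrix (Fin 2) (Fin 2) ℤ).map (Int.cast : ℤ → ℝ) * G) := by
  rw [eq_comm, coset_eq_iff]
  constructor
  · rintro ⟨_, ⟨r, rfl⟩, h⟩
    obtain ⟨η, rfl⟩ := ProjGenLinGroup.mk_surjective r
    rw [ProjGenLinGroup.map_mk, ← map_mul, mk_eq_mk_iff_smul] at h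
    obtain ⟨c, hc, h⟩ := h
    exact ⟨η, c, hc, h⟩
  · rintro ⟨η, c, hc, h⟩
    refine ⟨_, ⟨ProjGenLinGroup.mk η, rfl⟩, ?_⟩
    rw [ProjGenLinGroup.map_mk, ← map_mul, mk_eq_mk_iff_smul]
    exact ⟨c, hc, h⟩

/-- A class obtained from `G` through `diag(h, 1)` is at distance exactly `h`: an integral matrix
`m'` equivalent to `λ diag(h, 1)` has `λ` as an entry up to units, so `|det m'| = λ² h ≥ h`. -/
theorem ind_eq_of_diag {G G' : GL (Fin 2) ℝ} {h : ℕ}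
    (e : (G' : Matrix (Fin 2) (Fin 2) ℝ) = !![(h : ℝ), 0; 0, 1] * G) :
    HeckeFriends (coset GammaInf (ProjGenLinGroup.mk G)) (coset GammaInf (ProjGenLinGroup.mk G')) ∧
    ind (coset GammaInf (ProjGenLinGroup.mk G)) (coset GammaInf (ProjGenLinGroup.mk G')) = h := by
  have e' : (G' : Matrix (Fin 2) (Fin 2) ℝ) =
      (!![(h : ℤ), 0; 0, 1] : Matrix (Fin 2) (Fin 2) ℤ).map (Int.cast : ℤ → ℝ) * G := by
    rw [e]; congr 1; ext i j; fin_cases i <;> fin_cases j <;> simp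
  have hle := (rowLattice_le_iff G G').2 ⟨_, e'⟩
  have hmem : h ∈ {n : ℕ | ∃ L ∈ lattices (coset GammaInf (ProjGenLinGroup.mk G)),
      ∃ L' ∈ lattices (coset GammaInf (ProjGenLinGroup.mk G')), L' ≤ L ∧ L'.relIndex L = n} :=
    ⟨_, ⟨G, rfl, rfl⟩, _, ⟨G', rfl, rfl⟩, hle, by
      rw [relIndex_rowLattice e']; simp [Matrix.det_fin_two]⟩
  refine ⟨⟨_, ⟨G, rfl, rfl⟩, _, ⟨G', rfl, rfl⟩, hle⟩, le_antisymm (Nat.sInf_le hmem) ?_⟩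
  refine le_csInf ⟨h, hmem⟩ ?_
  rintro n ⟨_, ⟨G₁, hG₁, rfl⟩, _, ⟨G₂, hG₂, rfl⟩, hle, rfl⟩
  obtain ⟨η₁, c₁, hc₁, h₁⟩ := (coset_mk_eq_iff _ _).1 hG₁
  obtain ⟨η₂, c₂, hc₂, h₂⟩ := (coset_mk_eq_iff _ _).1 hG₂
  obtain ⟨m, hm⟩ := (rowLattice_le_iff _ _).1 hle
  rw [relIndex_rowLattice hm]
  set M : Matrix (Fin 2) (Fin 2) ℤ := (η₂⁻¹ : GL (Fin 2) ℤ) * m * (η₁ : Matrix (Fin 2) (Fin 2) ℤ)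
    with hM
  have hmap : ∀ A B : Matrix (Fin 2) (Fin 2) ℤ, (A * B).map (Int.cast : ℤ → ℝ) =
      A.map (Int.cast : ℤ → ℝ) * B.map (Int.cast : ℤ → ℝ) := fun A B =>
    Matrix.map_mul (f := Int.castRingHom ℝ)
  have hinv : ((η₂⁻¹ : GL (Fin 2) ℤ) : Matrix (Fin 2) (Fin 2) ℤ).map (Int.cast : ℤ → ℝ) *
      (η₂ : Matrix (Fin 2) (Fin 2) ℤ).map (Int.cast : ℤ → ℝ) = 1 := by
    rw [← hmap, ← Units.val_mul, inv_mul_cancel]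
    ext i j; fin_cases i <;> fin_cases j <;> simp
  have key : M.map (Int.cast : ℤ → ℝ) = (c₂ / c₁) • !![(h : ℝ), 0; 0, 1] := by
    have h3 : c₂ • ((η₂ : Matrix (Fin 2) (Fin 2) ℤ).map (Int.cast : ℤ → ℝ) *
        (!![(h : ℝ), 0; 0, 1] * G)) = m.map (Int.cast : ℤ → ℝ) *
        (c₁ • ((η₁ : Matrix (Fin 2) (Fin 2) ℤ).map (Int.cast : ℤ → ℝ) * G)) := by
      rw [← e, ← h₂, hm, h₁]
    have h4 := congrArg (fun X => ((η₂⁻¹ : GL (Fin 2) ℤ) : Matrix (Fin 2) (Fin 2) ℤ).map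
      (Int.cast : ℤ → ℝ) * X * ((G⁻¹ : GL (Fin 2) ℝ) : Matrix (Fin 2) (Fin 2) ℝ)) h3
    simp only [Matrix.mul_smul, Matrix.smul_mul, ← Matrix.mul_assoc, hinv, Matrix.one_mul] at h4
    rw [Matrix.mul_assoc, ← Units.val_mul, mul_inv_cancel, Units.val_one, Matrix.mul_one,
      Matrix.mul_assoc, ← Units.val_mul, mul_inv_cancel, Units.val_one, Matrix.mul_one,
      ← hmap, ← hmap, ← hM] at h4
    rw [div_eq_inv_mul, mul_smul, h4, smul_smul, inv_mul_cancel₀ hc₁, one_smul]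
  have hlam : c₂ / c₁ ≠ 0 := div_ne_zero hc₂ hc₁
  have k11 : ((M 1 1 : ℤ) : ℝ) = c₂ / c₁ := by
    have := congrFun (congrFun key 1) 1; simpa using this
  have hdetM : ((M.det : ℤ) : ℝ) = ((M 1 1 : ℤ) : ℝ) ^ 2 * h := by
    have h5 : ((M.det : ℤ) : ℝ) = (M.map (Int.cast : ℤ → ℝ)).det := by simp [Matrix.det_fin_two]
    rw [h5, key, k11]; simp [Matrix.det_fin_two]; ring
  have hdetM' : M.det = (M 1 1) ^ 2 * h := by exact_mod_cast hdetM
  have hne : M 1 1 ≠ 0 := by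
    intro h0; rw [h0] at k11; exact hlam (by rw [← k11]; simp)
  have hu : ∀ η : GL (Fin 2) ℤ, (η : Matrix (Fin 2) (Fin 2) ℤ).det.natAbs = 1 := fun η =>
    Int.isUnit_iff_natAbs_eq.1 ((Matrix.isUnit_iff_isUnit_det _).1 η.isUnit)
  have hnat : M.det.natAbs = m.det.natAbs := by
    rw [hM, Matrix.det_mul, Matrix.det_mul, Int.natAbs_mul, Int.natAbs_mul, hu, hu]; simp
  rw [← hnat, hdetM', Int.natAbs_mul, Int.natAbs_natCast]
  refine Nat.le_mul_of_pos_left _ ?_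
  exact Int.natAbs_pos.2 (pow_ne_zero _ hne)

theorem diagPGL_one_inv {F : Type*} [Field F] (a : Fˣ) : (diagPGL 1 a)⁻¹ = diagPGL a 1 := by
  rw [inv_eq_iff_mul_eq_one, diagPGL, diagPGL, ← map_mul, diagGL_mul, ← map_one ProjGenLinGroup.mk,
    mk_eq_mk_iff_smul]
  refine ⟨(a : F)⁻¹, inv_ne_zero a.ne_zero, ?_⟩
  ext i j; fin_cases i <;> fin_cases j <;> simp [diagGL]

/-- The point of a generalized branch over `x` at radius `h` arises from a representative of `x`
through `diag(h, 1)`. -/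
theorem exists_branchPoint_eq {S : Finset Nat.Primes} (g : PGL(2, ℝ)) {ω : GS S} (hω : ω ∈ KS S)
    {h : ℕ+} (hh : h ∈ radii S) : ∃ G G' : GL (Fin 2) ℝ,
      (G' : Matrix (Fin 2) (Fin 2) ℝ) = !![((h : ℕ) : ℝ), 0; 0, 1] * G ∧
      coset GammaInf (ProjGenLinGroup.mk G) = coset GammaInf g ∧
      branchPoint S g ω h = coset GammaInf (ProjGenLinGroup.mk G') := by
  obtain ⟨d, η, hd, hr⟩ := exists_frame hω hh
  obtain ⟨G₀, rfl⟩ := ProjGenLinGroup.mk_surjective g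
  refine ⟨(Matrix.GeneralLinearGroup.map (Int.castRingHom ℝ) η)⁻¹ * G₀,
    diagGL (radiusUnit ℝ h) 1 * ((Matrix.GeneralLinearGroup.map (Int.castRingHom ℝ) η)⁻¹ * G₀),
    ?_, ?_, ?_⟩
  · rw [Units.val_mul]; congr 1
  · rw [coset_eq_iff]
    refine ⟨_, ⟨ProjGenLinGroup.mk η, rfl⟩, ?_⟩
    rw [ProjGenLinGroup.map_mk, map_mul, map_inv, mul_inv_cancel_left]
  · rw [branchPoint_eq_of_frame _ ω h d hd, hr, diagPGL_one_inv, ProjGenLinGroup.map_mk]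
    simp only [map_mul, map_inv, mul_assoc, diagPGL]

theorem ind_branchPoint {S : Finset Nat.Primes} {g : PGL(2, ℝ)} {ω : GS S} (hω : ω ∈ KS S)
    {h : ℕ+} (hh : h ∈ radii S) :
    HeckeFriends (coset GammaInf g) (branchPoint S g ω h) ∧
      ind (coset GammaInf g) (branchPoint S g ω h) = h := by
  obtain ⟨G, G', e, e1, e2⟩ := exists_branchPoint_eq g hω hh
  rw [← e1, e2]
  exact ind_eq_of_diag e

theorem branchPoint_mem_sphere {S : Finset Nat.Primes} {g : PGL(2, ℝ)} {ω : GS S} (hω : ω ∈ KS S)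
    {h : ℕ+} (hh : h ∈ radii S) : branchPoint S g ω h ∈ sphere S (coset GammaInf g) h := by
  obtain ⟨h1, h2⟩ := ind_branchPoint (g := g) hω hh
  refine ⟨⟨h1, ?_⟩, h2⟩
  rw [h2]; exact hh

theorem branch_inter_sphere {S : Finset Nat.Primes} {g : PGL(2, ℝ)} {ω : GS S} (hω : ω ∈ KS S)
    {h : ℕ+} (hh : h ∈ radii S) :
    branch S g ω ∩ sphere S (coset GammaInf g) h = {branchPoint S g ω h} := by
  refine Set.Subset.antisymm ?_ ?_
  · rintro _ ⟨⟨h', hh', rfl⟩, -, h2⟩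
    rw [(ind_branchPoint hω hh').2] at h2
    rw [Set.mem_singleton_iff, PNat.coe_injective h2]
  · rintro _ rfl
    exact ⟨⟨h, hh, rfl⟩, branchPoint_mem_sphere hω hh⟩

/-! ### Counting the sphere -/

/-- Hermite normal form under left multiplication by `GL₂(ℤ)`. -/
theorem exists_hermite (A : Matrix (Fin 2) (Fin 2) ℤ) (hA : A.det ≠ 0) :
    ∃ (U : GL (Fin 2) ℤ) (a b d : ℕ), b < d ∧ a * d = A.det.natAbs ∧
      (U : Matrix (Fin 2) (Fin 2) ℤ) * A = !![(a : ℤ), (b : ℤ); 0, (d : ℤ)] := by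
  have main : ∀ B : FixedDetMatrix (Fin 2) ℤ A.det,
      ∃ (U : GL (Fin 2) ℤ) (a b d : ℕ), b < d ∧
        (U : Matrix (Fin 2) (Fin 2) ℤ) * B.1 = !![(a : ℤ), (b : ℤ); 0, (d : ℤ)] := by
    intro B
    induction B using (FixedDetMatrices.induction_on hA) with
    | h0 B h10 h00 h01 h11 =>
      rw [abs_of_nonneg h01] at h11
      rcases le_or_gt 0 (B.1 1 1) with h | h
      · refine ⟨1, (B.1 0 0).toNat, (B.1 0 1).toNat, (B.1 1 1).toNat, ?_, ?_⟩
        · rw [abs_of_nonneg h] at h11; omega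
        · rw [Int.toNat_of_nonneg h00.le, Int.toNat_of_nonneg h01, Int.toNat_of_nonneg h]
          ext i j; fin_cases i <;> fin_cases j <;> simp [h10]
      · refine ⟨diagGL 1 (-1), (B.1 0 0).toNat, (B.1 0 1).toNat, (-(B.1 1 1)).toNat, ?_, ?_⟩
        · rw [abs_of_neg h] at h11; omega
        · rw [Int.toNat_of_nonneg h00.le, Int.toNat_of_nonneg h01,
            Int.toNat_of_nonneg (by omega)]
          ext i j; fin_cases i <;> fin_cases j <;> simp [h10, diagGL, Matrix.mul_apply]
    | hS B ih =>
      obtain ⟨U, a, b, d, hbd, hU⟩ := ih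
      refine ⟨U * (ModularGroup.S : GL (Fin 2) ℤ)⁻¹, a, b, d, hbd, ?_⟩
      rw [FixedDetMatrices.smul_coe, ← hU, Units.val_mul, Matrix.mul_assoc]
      congr 1
      rw [← Matrix.mul_assoc]
      have : (((ModularGroup.S : GL (Fin 2) ℤ)⁻¹ : GL (Fin 2) ℤ) : Matrix (Fin 2) (Fin 2) ℤ) *
        (ModularGroup.S : Matrix (Fin 2) (Fin 2) ℤ) = 1 :=
        Units.inv_mul (ModularGroup.S : GL (Fin 2) ℤ)
      rw [this, Matrix.one_mul]
    | hT B ih =>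
      obtain ⟨U, a, b, d, hbd, hU⟩ := ih
      refine ⟨U * (ModularGroup.T : GL (Fin 2) ℤ)⁻¹, a, b, d, hbd, ?_⟩
      rw [FixedDetMatrices.smul_coe, ← hU, Units.val_mul, Matrix.mul_assoc]
      congr 1
      rw [← Matrix.mul_assoc]
      have : (((ModularGroup.T : GL (Fin 2) ℤ)⁻¹ : GL (Fin 2) ℤ) : Matrix (Fin 2) (Fin 2) ℤ) *
        (ModularGroup.T : Matrix (Fin 2) (Fin 2) ℤ) = 1 :=
        Units.inv_mul (ModularGroup.T : GL (Fin 2) ℤ)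
      rw [this, Matrix.one_mul]
  obtain ⟨U, a, b, d, hbd, hU⟩ := main ⟨A, rfl⟩
  refine ⟨U, a, b, d, hbd, ?_, hU⟩
  have h1 := congrArg (fun X : Matrix (Fin 2) (Fin 2) ℤ => X.det.natAbs) hU
  simp only [Matrix.det_mul, Int.natAbs_mul] at h1
  rw [Int.isUnit_iff_natAbs_eq.1 ((Matrix.isUnit_iff_isUnit_det _).1 U.isUnit), one_mul] at h1
  rw [h1, Matrix.det_fin_two]
  simp [Int.natAbs_mul]

/-- The classes of the sublattices of index `h` in the row lattice of `G`. -/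
def indexSet (G : GL (Fin 2) ℝ) (h : ℕ) : Set XInf :=
  {y | ∃ (m : Matrix (Fin 2) (Fin 2) ℤ) (G' : GL (Fin 2) ℝ), m.det.natAbs = h ∧
    (G' : Matrix (Fin 2) (Fin 2) ℝ) = m.map (Int.cast : ℤ → ℝ) * G ∧
    coset GammaInf (ProjGenLinGroup.mk G') = y}

/-- For `i = (d, b)`, the class of the matrix `[[h / d, b], [0, d]] G`. If this matrix is singular,
the class is an arbitrary one. -/
noncomputable def hermiteClass (G : GL (Fin 2) ℝ) (h : ℕ) (i : (_ : ℕ) × ℕ) : XInf :=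
  @Classical.epsilon XInf ⟨coset GammaInf 1⟩ fun y => ∃ G' : GL (Fin 2) ℝ,
    (G' : Matrix (Fin 2) (Fin 2) ℝ) = !![((h / i.1 : ℕ) : ℝ), (i.2 : ℝ); 0, (i.1 : ℝ)] * G ∧
    coset GammaInf (ProjGenLinGroup.mk G') = y

open Classical in
theorem indexSet_subset (G : GL (Fin 2) ℝ) {h : ℕ} (hh : 0 < h) :
    indexSet G h ⊆ ↑((h.divisors.sigma fun d => Finset.range d).image (hermiteClass G h)) := by
  rintro y ⟨m, G', hm, hG', rfl⟩
  have hm0 : m.det ≠ 0 := by intro h0; rw [h0] at hm; simp at hm; omega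
  obtain ⟨U, a, b, d, hbd, had, hU⟩ := exists_hermite m hm0
  rw [hm] at had
  have hd : 0 < d := by omega
  simp only [Finset.coe_image, Set.mem_image, Finset.mem_coe, Finset.mem_sigma,
    Nat.mem_divisors, Finset.mem_range]
  refine ⟨⟨d, b⟩, ⟨⟨⟨a, by rw [← had, mul_comm]⟩, hh.ne'⟩, hbd⟩, ?_⟩
  set G'' : GL (Fin 2) ℝ := Matrix.GeneralLinearGroup.map (Int.castRingHom ℝ) U * G' with hG''
  have e1 : (G'' : Matrix (Fin 2) (Fin 2) ℝ) = !![((h / d : ℕ) : ℝ), (b : ℝ); 0, (d : ℝ)] * G := by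
    have h1 : (U : Matrix (Fin 2) (Fin 2) ℤ).map (Int.cast : ℤ → ℝ) * m.map (Int.cast : ℤ → ℝ) =
        !![(a : ℝ), (b : ℝ); 0, (d : ℝ)] := by
      have h2 := congrArg (fun X : Matrix (Fin 2) (Fin 2) ℤ => X.map (Int.castRingHom ℝ)) hU
      simp only [Matrix.map_mul] at h2
      refine Eq.trans h2 ?_
      ext i j; fin_cases i <;> fin_cases j <;> simp
    rw [← had, Nat.mul_div_cancel _ hd, ← h1, Matrix.mul_assoc, ← hG']
    rfl
  have e2 : coset GammaInf (ProjGenLinGroup.mk G'') = coset GammaInf (ProjGenLinGroup.mk G') := by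
    rw [eq_comm, coset_eq_iff]
    exact ⟨_, ⟨ProjGenLinGroup.mk U, rfl⟩, by rw [ProjGenLinGroup.map_mk, hG'', map_mul]⟩
  have hex : ∃ y, ∃ G' : GL (Fin 2) ℝ, (G' : Matrix (Fin 2) (Fin 2) ℝ) =
    !![((h / d : ℕ) : ℝ), (b : ℝ); 0, (d : ℝ)] * G ∧
    coset GammaInf (ProjGenLinGroup.mk G') = y := ⟨_, G'', e1, rfl⟩
  obtain ⟨G₃, h3, h4⟩ := Classical.epsilon_spec hex
  have : G₃ = G'' := Units.ext (h3.trans e1.symm)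
  rw [hermiteClass, ← h4, this, e2]

theorem finite_indexSet (G : GL (Fin 2) ℝ) {h : ℕ} (hh : 0 < h) : (indexSet G h).Finite := by
  classical
  exact (Finset.finite_toSet _).subset (indexSet_subset G hh)

theorem ncard_indexSet_le (G : GL (Fin 2) ℝ) {h : ℕ} (hh : 0 < h) :
    (indexSet G h).ncard ≤ ∑ d ∈ h.divisors, d := by
  classical
  refine (Set.ncard_le_ncard (indexSet_subset G hh) (Finset.finite_toSet _)).trans ?_
  rw [Set.ncard_coe_finset]
  refine Finset.card_image_le.trans ?_
  simp

theorem sphere_subset_indexSet (S : Finset Nat.Primes) (G : GL (Fin 2) ℝ) (h : ℕ+) :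
    sphere S (coset GammaInf (ProjGenLinGroup.mk G)) h ⊆ indexSet G h := by
  rintro y ⟨⟨hy, -⟩, hi⟩
  have hne : {n : ℕ | ∃ L ∈ lattices (coset GammaInf (ProjGenLinGroup.mk G)), ∃ L' ∈ lattices y,
      L' ≤ L ∧ L'.relIndex L = n}.Nonempty := by
    obtain ⟨L, hL, L', hL', hle⟩ := hy
    exact ⟨_, L, hL, L', hL', hle, rfl⟩
  have hs := Nat.sInf_mem hne
  rw [ind] at hi
  rw [hi] at hs
  obtain ⟨_, ⟨G₁, hG₁, rfl⟩, _, ⟨G₂, rfl, rfl⟩, hle, hn⟩ := hs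
  obtain ⟨m, hm⟩ := (rowLattice_le_iff _ _).1 hle
  rw [relIndex_rowLattice hm] at hn
  obtain ⟨η, c, hc, h1⟩ := (coset_mk_eq_iff _ _).1 hG₁
  have hu : (η : Matrix (Fin 2) (Fin 2) ℤ).det.natAbs = 1 :=
    Int.isUnit_iff_natAbs_eq.1 ((Matrix.isUnit_iff_isUnit_det _).1 η.isUnit)
  refine ⟨m * η, (Matrix.GeneralLinearGroup.scalar (Fin 2) (Units.mk0 c hc))⁻¹ * G₂, ?_, ?_, ?_⟩
  · rw [Matrix.det_mul, Int.natAbs_mul, hu, mul_one, hn]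
  · have h2 : (G₂ : Matrix (Fin 2) (Fin 2) ℝ) =
        c • ((m * (η : Matrix (Fin 2) (Fin 2) ℤ)).map (Int.cast : ℤ → ℝ) * G) := by
      rw [hm, h1, Matrix.mul_smul, ← Matrix.mul_assoc]
      congr 2
      exact (Matrix.map_mul (f := Int.castRingHom ℝ)).symm
    rw [Units.val_mul, h2, ← map_inv]
    ext i j
    simp [Matrix.GeneralLinearGroup.scalar, hc]
  · congr 1
    rw [mk_eq_mk_iff_smul]
    refine ⟨c, hc, ?_⟩
    rw [Units.val_mul, ← map_inv]
    ext i j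
    simp [Matrix.GeneralLinearGroup.scalar, hc]

/-! ### Total growth -/

/-- The sum of the divisors of `h`, divided by `h`, is `∑_{d ∣ h} 1 / d`. For `h ∈ radii S` this is
bounded by the convergent sum of `1 / n` over the integers `n` composed of primes of `S`. -/
theorem sum_divisors_le (S : Finset Nat.Primes) :
    ∃ C : ℝ, 0 < C ∧ ∀ h ∈ radii S, ((∑ d ∈ (h : ℕ).divisors, d : ℕ) : ℝ) ≤ C * (h : ℕ) := by
  classical
  let f : ℕ →* ℝ :=
    { toFun := fun n => (n : ℝ)⁻¹, map_one' := by simp, map_mul' := fun a b => by simp [mul_comm] }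
  have hf : ∀ {p : ℕ}, p.Prime → ‖f p‖ < 1 := fun {p} hp => by
    have : (1 : ℝ) < p := by exact_mod_cast hp.one_lt
    change ‖(p : ℝ)⁻¹‖ < 1
    rw [norm_inv, Real.norm_natCast]
    exact inv_lt_one_of_one_lt₀ this
  set T : Finset ℕ := S.image fun p : Nat.Primes => (p : ℕ) with hT
  obtain ⟨hs, -⟩ :=
    EulerProduct.summable_and_hasSum_factoredNumbers_prod_filter_prime_geometric hf T
  have hs' : Summable fun m : Nat.factoredNumbers T => ((m : ℕ) : ℝ)⁻¹ := by
    refine hs.congr fun m => ?_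
    change ‖((m : ℕ) : ℝ)⁻¹‖ = _
    rw [norm_inv, Real.norm_natCast]
  have hnn : ∀ m : Nat.factoredNumbers T, 0 ≤ ((m : ℕ) : ℝ)⁻¹ := fun m => by positivity
  refine ⟨1 + ∑' m : Nat.factoredNumbers T, ((m : ℕ) : ℝ)⁻¹,
    add_pos_of_pos_of_nonneg one_pos (tsum_nonneg hnn), fun h hh => ?_⟩
  have hmem : ∀ d ∈ (h : ℕ).divisors, d ∈ Nat.factoredNumbers T := fun d hd => by
    rw [Nat.mem_factoredNumbers']
    refine fun p hp hpd => ?_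
    have := mem_radii_iff.1 hh ⟨p, hp⟩ (hpd.trans (Nat.dvd_of_mem_divisors hd))
    exact Finset.mem_image.2 ⟨_, this, rfl⟩
  have e : ((∑ d ∈ (h : ℕ).divisors, d : ℕ) : ℝ) =
      (∑ d ∈ (h : ℕ).divisors, (d : ℝ)⁻¹) * (h : ℕ) := by
    rw [← Nat.sum_div_divisors, Nat.cast_sum, Finset.sum_mul]
    refine Finset.sum_congr rfl fun d hd => ?_
    rw [Nat.cast_div_charZero (Nat.dvd_of_mem_divisors hd), div_eq_inv_mul]
  rw [e]
  refine mul_le_mul_of_nonneg_right ?_ (by positivity)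
  have h2 : ∑ d ∈ (h : ℕ).divisors, (d : ℝ)⁻¹ ≤ ∑' m : Nat.factoredNumbers T, ((m : ℕ) : ℝ)⁻¹ := by
    rw [← Finset.sum_subtype_of_mem (fun d : ℕ => (d : ℝ)⁻¹) hmem]
    exact hs'.sum_le_tsum _ fun m _ => hnn m
  linarith

theorem orbit_translate (x : XInf) (t : ℝ) : orbit (translate x (aInf t)) = orbit x := by
  have key : ∀ (x : XInf) (t : ℝ), orbit (translate x (aInf t)) ⊆ orbit x := by
    rintro x t _ ⟨s, rfl⟩
    exact ⟨t + s, by simp only [translate_translate, aInf_add]⟩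
  refine (key x t).antisymm ?_
  conv_lhs => rw [show x = translate (translate x (aInf t)) (aInf (-t)) by
    rw [translate_translate, ← aInf_add, add_neg_cancel, aInf_zero]
    induction x using Quotient.inductionOn with
    | h g => exact (congrArg (coset GammaInf) (mul_one g)).symm]
  exact key _ _

theorem translate_injective (t : ℝ) : Function.Injective fun x : XInf => translate x (aInf t) := by
  intro x y hxy
  have h2 := congrArg (fun z : XInf => translate z (aInf (-t))) hxy
  simp only [translate_translate, ← aInf_add, add_neg_cancel, aInf_zero] at h2
  have h1 : ∀ z : XInf, translate z 1 = z := fun z => by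
    induction z using Quotient.inductionOn with
    | h g => exact congrArg (coset GammaInf) (mul_one g)
  rwa [h1, h1] at h2

theorem orbitLength_nonneg (q : Quotient orbitSetoid) : 0 ≤ orbitLength q := by
  induction q using Quotient.inductionOn with
  | h x => exact Real.sInf_nonneg fun t ht => ht.1.le

/-- If a finite set is stable under `a_∞(τ)`, then by the pigeonhole principle the orbit of each of
its points is at most `τ` times as long as the number of points of the set on that orbit. -/
theorem orbitLength_le_card_fibre [DecidableEq (Quotient orbitSetoid)] {Y : Finset XInf} {τ : ℝ}
    (hτ : 0 < τ) (hY : ∀ y ∈ Y, translate y (aInf τ) ∈ Y) {y : XInf} (hy : y ∈ Y) :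
    orbitLength (Quotient.mk orbitSetoid y) ≤
      (Y.filter fun z => Quotient.mk orbitSetoid z = Quotient.mk orbitSetoid y).card * τ := by
  set F := Y.filter fun z => Quotient.mk orbitSetoid z = Quotient.mk orbitSetoid y with hF
  have hmaps : ∀ n : ℕ, translate y (aInf (n * τ)) ∈ F := fun n => by
    refine Finset.mem_filter.2 ⟨?_, Quotient.sound (orbit_translate y _)⟩
    induction n with
    | zero =>
      have : translate y (aInf ((0 : ℕ) * τ)) = y := by
        rw [Nat.cast_zero, zero_mul, aInf_zero]
        induction y using Quotient.inductionOn with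
        | h g => exact congrArg (coset GammaInf) (mul_one g)
      rwa [this]
    | succ n ih =>
      have := hY _ ih
      rwa [translate_translate, ← aInf_add, show (n : ℝ) * τ + τ = ((n + 1 : ℕ) : ℝ) * τ by
        push_cast; ring] at this
  have main : ∀ i j : ℕ, i < j → j ≤ F.card →
      translate y (aInf (i * τ)) = translate y (aInf (j * τ)) → period y ≤ F.card * τ := by
    intro i j hij hj h
    have hpos : 0 < ((j - i : ℕ) : ℝ) * τ := mul_pos (by exact_mod_cast Nat.sub_pos_of_lt hij) hτ
    have h3 : translate y (aInf (((j - i : ℕ) : ℝ) * τ)) = y := by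
      refine translate_injective (i * τ) ?_
      simp only
      rw [translate_translate, ← aInf_add, h]
      congr 2
      rw [Nat.cast_sub hij.le]; ring
    refine (period_le hpos h3).trans (mul_le_mul_of_nonneg_right ?_ hτ.le)
    exact_mod_cast (Nat.sub_le _ _).trans hj
  obtain ⟨i, hi, j, hj, hne, h⟩ := Finset.exists_ne_map_eq_of_card_lt_of_maps_to
    (s := Finset.range (F.card + 1)) (t := F) (f := fun n : ℕ => translate y (aInf (n * τ)))
    (by simp) (fun n _ => hmaps n)
  rw [Finset.mem_range] at hi hj
  rcases lt_or_gt_of_ne hne with hlt | hlt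
  · exact main i j hlt (by omega) h
  · exact main j i hlt (by omega) h.symm

theorem finsum_orbitLength_le {Y : Set XInf} (hfin : Y.Finite) {τ : ℝ} (hτ : 0 < τ)
    (hY : ∀ y ∈ Y, translate y (aInf τ) ∈ Y) {Z : Set XInf} (hZ : Z ⊆ Y) :
    ∑ᶠ q ∈ Quotient.mk orbitSetoid '' Z, orbitLength q ≤ Y.ncard * τ := by
  classical
  have hZfin : (Quotient.mk orbitSetoid '' Z).Finite := (hfin.subset hZ).image _
  rw [finsum_mem_eq_finite_toFinset_sum _ hZfin]
  set Y' := hfin.toFinset with hY'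
  have hstab : ∀ y ∈ Y', translate y (aInf τ) ∈ Y' := fun y hy => by
    rw [hY', Set.Finite.mem_toFinset] at hy ⊢; exact hY y hy
  have h1 : ∀ q ∈ hZfin.toFinset, orbitLength q ≤
      (Y'.filter fun z => Quotient.mk orbitSetoid z = q).card * τ := by
    intro q hq
    obtain ⟨y, hy, rfl⟩ := hZfin.mem_toFinset.1 hq
    exact orbitLength_le_card_fibre hτ hstab (hfin.mem_toFinset.2 (hZ hy))
  refine (Finset.sum_le_sum h1).trans ?_
  rw [← Finset.sum_mul, ← Nat.cast_sum, Set.ncard_eq_toFinset_card Y hfin]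
  refine mul_le_mul_of_nonneg_right ?_ hτ.le
  norm_cast
  rw [← Finset.card_biUnion]
  · refine Finset.card_le_card fun z hz => ?_
    obtain ⟨q, -, hz⟩ := Finset.mem_biUnion.1 hz
    exact (Finset.mem_filter.1 hz).1
  · intro q _ q' _ hne
    refine Finset.disjoint_left.2 fun z hz hz' => hne ?_
    rw [← (Finset.mem_filter.1 hz).2, (Finset.mem_filter.1 hz').2]

theorem translate_mem_indexSet {G : GL (Fin 2) ℝ} {h : ℕ} {τ : ℝ}
    (hτ : translate (coset GammaInf (ProjGenLinGroup.mk G)) (aInf τ) =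
      coset GammaInf (ProjGenLinGroup.mk G)) {y : XInf} (hy : y ∈ indexSet G h) :
    translate y (aInf τ) ∈ indexSet G h := by
  obtain ⟨m, G', hm, hG', rfl⟩ := hy
  obtain ⟨a, ha⟩ : ∃ a : GL (Fin 2) ℝ, ProjGenLinGroup.mk a = aInf τ := ⟨_, rfl⟩
  rw [← ha, translate_coset, ← map_mul] at hτ
  obtain ⟨η, c, hc, h1⟩ := (coset_mk_eq_iff _ _).1 hτ
  have hu : (η : Matrix (Fin 2) (Fin 2) ℤ).det.natAbs = 1 :=
    Int.isUnit_iff_natAbs_eq.1 ((Matrix.isUnit_iff_isUnit_det _).1 η.isUnit)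
  refine ⟨m * η, (Matrix.GeneralLinearGroup.scalar (Fin 2) (Units.mk0 c hc))⁻¹ * (G' * a),
    ?_, ?_, ?_⟩
  · rw [Matrix.det_mul, Int.natAbs_mul, hu, mul_one, hm]
  · have h2 : ((G' * a : GL (Fin 2) ℝ) : Matrix (Fin 2) (Fin 2) ℝ) =
        c • ((m * (η : Matrix (Fin 2) (Fin 2) ℤ)).map (Int.cast : ℤ → ℝ) * G) := by
      rw [Units.val_mul, hG', Matrix.mul_assoc, ← Units.val_mul, h1, Matrix.mul_smul,
        ← Matrix.mul_assoc]
      congr 2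
      exact (Matrix.map_mul (f := Int.castRingHom ℝ)).symm
    rw [Units.val_mul, h2, ← map_inv]
    ext i j
    simp [Matrix.GeneralLinearGroup.scalar, hc]
  · rw [← ha, translate_coset, ← map_mul]
    congr 1
    rw [mk_eq_mk_iff_smul]
    refine ⟨c, hc, ?_⟩
    rw [Units.val_mul _ (G' * a), ← map_inv]
    ext i j
    simp [Matrix.GeneralLinearGroup.scalar, hc]

theorem finite_sphere (S : Finset Nat.Primes) (x : XInf) (h : ℕ+) : (sphere S x h).Finite := by
  obtain ⟨g, rfl⟩ := Quotient.exists_rep x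
  obtain ⟨G, rfl⟩ := ProjGenLinGroup.mk_surjective g
  exact (finite_indexSet G h.pos).subset (sphere_subset_indexSet S G h)

theorem exists_totalLength_le (S : Finset Nat.Primes) {x : XInf} (hx : IsPeriodic x) :
    ∃ C : ℝ, 0 < C ∧ ∀ h ∈ radii S, totalLength S x h ≤ C * (h : ℕ) := by
  obtain ⟨C, hC, hle⟩ := sum_divisors_le S
  obtain ⟨g, rfl⟩ := Quotient.exists_rep x
  obtain ⟨G, rfl⟩ := ProjGenLinGroup.mk_surjective g
  change IsPeriodic (coset GammaInf (ProjGenLinGroup.mk G)) at hx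
  set τ := period (coset GammaInf (ProjGenLinGroup.mk G)) with hτ
  have hτ0 : 0 < τ := hx.period_pos
  refine ⟨C * τ, mul_pos hC hτ0, fun h hh => ?_⟩
  refine (finsum_orbitLength_le (finite_indexSet G h.pos) hτ0
    (fun y hy => translate_mem_indexSet hx.isLeast_period.1.2 hy)
    (sphere_subset_indexSet S G h)).trans ?_
  have h1 : ((indexSet G h).ncard : ℝ) ≤ C * (h : ℕ) :=
    le_trans (by exact_mod_cast ncard_indexSet_le G h.pos) (hle h hh)
  calc ((indexSet G h).ncard : ℝ) * τ ≤ C * (h : ℕ) * τ := mul_le_mul_of_nonneg_right h1 hτ0.le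
    _ = C * τ * (h : ℕ) := by ring

theorem period_le_totalLength {S : Finset Nat.Primes} {x y : XInf} {h : ℕ+}
    (hy : y ∈ sphere S x h) : period y ≤ totalLength S x h := by
  have hfin : (Quotient.mk orbitSetoid '' sphere S x h).Finite := (finite_sphere S x h).image _
  rw [totalLength, finsum_mem_eq_finite_toFinset_sum _ hfin]
  exact Finset.single_le_sum (f := orbitLength) (fun q _ => orbitLength_nonneg q)
    (hfin.mem_toFinset.2 ⟨y, hy, rfl⟩)

theorem ratio_pos {S : Finset Nat.Primes} {g : PGL(2, ℝ)} (hg : IsPeriodic (coset GammaInf g))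
    {ω : GS S} (hω : ω ∈ KS S) {h : ℕ+} (hh : h ∈ radii S) : 0 < ratio S g ω h := by
  obtain ⟨u, D, hu, hDu, hD, hgen⟩ := exists_generator S hg
  rw [ratio, period_branchPoint hu hDu hD hgen hω hh]
  exact div_pos (isLeast_period_branchPoint hu hDu hD hgen hω hh).1.1 (by exact_mod_cast h.pos)

/-- The orbit through the single point of a fixed non-degenerate branch already has length of the
order of `h`. -/
theorem exists_le_totalLength {S : Finset Nat.Primes} {g : PGL(2, ℝ)}
    (hg : IsPeriodic (coset GammaInf g)) {ω : GS S} (hω : ω ∈ KS S) (hdeg : ¬ IsDegenerate S g ω) :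
    ∃ c : ℝ, 0 < c ∧ ∀ h ∈ radii S, c * (h : ℕ) ≤ totalLength S (coset GammaInf g) h := by
  obtain ⟨H, hH⟩ := exists_ratio_eq_gcd hg hω hdeg
  have hfin := (finite_and_eventually_const hH).1
  have hne : (ratio S g ω '' radii S).Nonempty := ⟨_, 1, one_mem_radii S, rfl⟩
  obtain ⟨_, ⟨h₀, hh₀, rfl⟩, hmin⟩ := Set.exists_min_image _ id hfin hne
  refine ⟨ratio S g ω h₀, ratio_pos hg hω hh₀, fun h hh => ?_⟩
  have h1 : ratio S g ω h₀ ≤ ratio S g ω h := hmin _ ⟨h, hh, rfl⟩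
  have hpos : (0 : ℝ) < (h : ℕ) := by exact_mod_cast h.pos
  refine (mul_le_mul_of_nonneg_right h1 hpos.le).trans ?_
  rw [ratio, div_mul_cancel₀ _ hpos.ne']
  exact period_le_totalLength (branchPoint_mem_sphere hω hh)

/-! ### Splitting of primes in quadratic fields -/

open NumberField in
theorem coe_smul_ringOfIntegers {K : Type*} [Field K] [NumberField K] (τ : Gal(K/ℚ)) (a : 𝓞 K) :
    ((τ • a : 𝓞 K) : K) = τ a := rfl

section Quadratic

open NumberField
open scoped Pointwise

variable {K : Type*} [Field K] [NumberField K] [Algebra.IsQuadraticExtension ℚ K]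

theorem natCard_gal_quadratic : Nat.card Gal(K/ℚ) = 2 := by
  rw [IsGalois.card_aut_eq_finrank, Algebra.IsQuadraticExtension.finrank_eq_two]

theorem eq_or_eq_of_ne_one {τ : Gal(K/ℚ)} (hτ : τ ≠ 1) (g : Gal(K/ℚ)) : g = 1 ∨ g = τ := by
  obtain ⟨y, -, hy⟩ := (Nat.card_eq_two_iff' (1 : Gal(K/ℚ))).1 natCard_gal_quadratic
  by_cases h : g = 1
  · exact Or.inl h
  · exact Or.inr ((hy g h).trans (hy τ hτ).symm)

theorem mul_self_eq_one_quadratic (τ : Gal(K/ℚ)) : τ * τ = 1 := by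
  have := pow_card_eq_one' (x := τ)
  rwa [natCard_gal_quadratic, pow_two] at this

/-- A prime splits in a quadratic field if and only if it divides the norm but not the trace of
some algebraic integer. -/
theorem ncard_primesOver_eq_two_iff_exists {p : ℕ} [hp : Fact p.Prime] :
    ((Ideal.span {(p : ℤ)}).primesOver (𝓞 K)).ncard = 2 ↔
      ∃ (τ : Gal(K/ℚ)) (α : 𝓞 K) (T N : ℤ), α + τ • α = T ∧ α * τ • α = N ∧
        (p : ℤ) ∣ N ∧ ¬ (p : ℤ) ∣ T := by
  have hmax : (Ideal.span {(p : ℤ)}).IsMaximal := Int.ideal_span_isMaximal_of_prime p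
  have hinv : ∀ τ : Gal(K/ℚ), ∀ a : 𝓞 K, τ • τ • a = a := fun τ a => by
    rw [← mul_smul, mul_self_eq_one_quadratic, one_smul]
  have hinvI : ∀ τ : Gal(K/ℚ), ∀ P : Ideal (𝓞 K), τ • τ • P = P := fun τ P => by
    rw [← mul_smul, mul_self_eq_one_quadratic, one_smul]
  have hdvd : ∀ (P : Ideal (𝓞 K)) [P.LiesOver (Ideal.span {(p : ℤ)})] (n : ℤ),
      (p : ℤ) ∣ n ↔ (n : 𝓞 K) ∈ P := fun P _ n => by
    rw [← Ideal.mem_span_singleton, Ideal.mem_of_liesOver P (Ideal.span {(p : ℤ)})]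
    simp
  constructor
  · intro h
    obtain ⟨P, Q, hne, hPQ⟩ := Set.ncard_eq_two.1 h
    obtain ⟨hP, hPo⟩ : P ∈ (Ideal.span {(p : ℤ)}).primesOver (𝓞 K) := hPQ ▸ Set.mem_insert _ _
    obtain ⟨hQ, hQo⟩ : Q ∈ (Ideal.span {(p : ℤ)}).primesOver (𝓞 K) :=
      hPQ ▸ Set.mem_insert_of_mem _ rfl
    obtain ⟨τ, hτ⟩ := Ideal.exists_smul_eq_of_isGaloisGroup (Ideal.span {(p : ℤ)}) P Q Gal(K/ℚ)
    have hPmax := Ideal.IsMaximal.of_liesOver_isMaximal P (Ideal.span {(p : ℤ)})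
    obtain ⟨α, hαP, hαQ⟩ : ∃ α ∈ P, α ∉ Q := by
      by_contra! hcon
      exact hne (hPmax.eq_of_le hQ.ne_top hcon)
    have hτα : τ • α ∉ P := fun hmem => hαQ (by
      rw [← hinvI τ P, hτ] at hmem
      exact Ideal.smul_mem_pointwise_smul_iff.1 hmem)
    have hτ1 : τ ≠ 1 := by rintro rfl; exact hne (by rw [← hτ, one_smul])
    have hfix : ∀ a : 𝓞 K, τ • a = a → ∃ n : ℤ, a = n := fun a ha => by
      obtain ⟨n, hn⟩ := Algebra.IsInvariant.isInvariant (A := ℤ) (G := Gal(K/ℚ)) a fun g => by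
        rcases eq_or_eq_of_ne_one hτ1 g with rfl | rfl
        · exact one_smul _ _
        · exact ha
      exact ⟨n, by rw [← hn]; simp⟩
    obtain ⟨T, hT⟩ := hfix (α + τ • α) (by rw [smul_add, hinv, add_comm])
    obtain ⟨N, hN⟩ := hfix (α * τ • α) (by rw [smul_mul', hinv, mul_comm])
    refine ⟨τ, α, T, N, hT, hN, ?_, ?_⟩
    · rw [hdvd P, ← hN]; exact P.mul_mem_right _ hαP
    · rw [hdvd P, ← hT]; exact fun hmem => hτα ((P.add_mem_iff_right hαP).1 hmem)
  · rintro ⟨τ, α, T, N, hT, hN, hpN, hpT⟩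
    obtain ⟨Q, hQ, hQo⟩ := (Ideal.span {(p : ℤ)}).nonempty_primesOver (S := 𝓞 K)
    have hnot : ¬ (α ∈ Q ∧ τ • α ∈ Q) := fun ⟨h1, h2⟩ => hpT (by
      rw [hdvd Q, ← hT]; exact Q.add_mem h1 h2)
    have hor : α ∈ Q ∨ τ • α ∈ Q := hQ.mem_or_mem (by rw [hN, ← hdvd Q]; exact hpN)
    have hne : Q ≠ τ • Q := by
      intro heq
      rcases hor with h1 | h1
      · refine hnot ⟨h1, ?_⟩
        rw [heq]; exact Ideal.smul_mem_pointwise_smul_iff.2 h1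
      · refine hnot ⟨?_, h1⟩
        rw [heq, ← hinv τ α]; exact Ideal.smul_mem_pointwise_smul_iff.2 h1
    have hτ1 : τ ≠ 1 := by rintro rfl; exact hne (one_smul _ _).symm
    have hset : (Ideal.span {(p : ℤ)}).primesOver (𝓞 K) = {Q, τ • Q} := by
      ext R
      constructor
      · rintro ⟨hR, hRo⟩
        obtain ⟨g, rfl⟩ :=
          Ideal.exists_smul_eq_of_isGaloisGroup (Ideal.span {(p : ℤ)}) Q R Gal(K/ℚ)
        rcases eq_or_eq_of_ne_one hτ1 g with rfl | rfl
        · exact Or.inl (one_smul _ _)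
        · exact Or.inr rfl
      · rintro (rfl | rfl)
        · exact ⟨hQ, hQo⟩
        · exact ⟨inferInstance, inferInstance⟩
    rw [hset, Set.ncard_pair hne]

/-- Hensel's lemma for `X² - T X + N` at the approximate root `T`. -/
theorem isSquare_disc_of_dvd {p : ℕ} [hp : Fact p.Prime] {T N : ℤ} (hN : (p : ℤ) ∣ N)
    (hT : ¬ (p : ℤ) ∣ T) : ∃ z : ℚ_[p], z ^ 2 = (T : ℚ_[p]) ^ 2 - 4 * N := by
  have hT1 : ‖(T : ℤ_[p])‖ = 1 :=
    le_antisymm (PadicInt.norm_le_one _)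
      (not_lt.1 fun h => hT (PadicInt.norm_int_lt_one_iff_dvd _ |>.1 h))
  have hN1 : ‖(N : ℤ_[p])‖ < 1 := (PadicInt.norm_int_lt_one_iff_dvd _).2 hN
  set F : Polynomial ℤ_[p] := Polynomial.X ^ 2 - Polynomial.C (T : ℤ_[p]) * Polynomial.X +
    Polynomial.C (N : ℤ_[p]) with hF
  obtain ⟨z, hz, -⟩ := hensels_lemma (F := F) (a := (T : ℤ_[p])) (by
    have e1 : Polynomial.aeval (T : ℤ_[p]) F = N := by simp [hF]; ring
    have e2 : Polynomial.aeval (T : ℤ_[p]) (Polynomial.derivative F) = T := by simp [hF]; ring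
    rw [e1, e2, hT1, one_pow]; exact hN1)
  have hz' : z ^ 2 - T * z + N = 0 := by simpa [hF] using hz
  have hz2 : (z : ℚ_[p]) ^ 2 - T * z + N = 0 := by exact_mod_cast congrArg (Subtype.val) hz'
  exact ⟨2 * z - T, by linear_combination 4 * hz2⟩

theorem apply_eq_neg_of_ne_one {s : K} {Δ : ℤ} (hs : s ^ 2 = Δ)
    (hs' : s ∉ Set.range (algebraMap ℚ K)) {τ : Gal(K/ℚ)} (hτ : τ ≠ 1) : τ s = -s := by
  have h1 : (τ s) ^ 2 = s ^ 2 := by rw [← map_pow, hs, map_intCast]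
  rcases sq_eq_sq_iff_eq_or_eq_neg.1 h1 with h | h
  · refine absurd ((IsGalois.mem_range_algebraMap_iff_fixed s).2 fun g => ?_) hs'
    rcases eq_or_eq_of_ne_one hτ g with rfl | rfl
    · rfl
    · exact h
  · exact h

/-- A prime `p` splits in the quadratic field generated by the square root of an integer `Δ` if and
only if `Δ` is a square in `ℚ_p`. -/
theorem ncard_primesOver_eq_two_iff {s : K} {Δ : ℤ} (hs : s ^ 2 = Δ)
    (hs' : s ∉ Set.range (algebraMap ℚ K)) {p : ℕ} [hp : Fact p.Prime] :
    ((Ideal.span {(p : ℤ)}).primesOver (𝓞 K)).ncard = 2 ↔ ∃ r : ℚ_[p], r ^ 2 = Δ := by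
  have hs0 : s ≠ 0 := by rintro rfl; exact hs' ⟨0, map_zero _⟩
  rw [ncard_primesOver_eq_two_iff_exists]
  constructor
  · rintro ⟨τ, α, T, N, hT, hN, hpN, hpT⟩
    have hT' : (α : K) + τ α = T := by
      have := congrArg (fun a : 𝓞 K => (a : K)) hT
      simpa [coe_smul_ringOfIntegers] using this
    have hN' : (α : K) * τ α = N := by
      have := congrArg (fun a : 𝓞 K => (a : K)) hN
      simpa [coe_smul_ringOfIntegers] using this
    have hττ : τ (τ α) = α := by
      rw [← AlgEquiv.mul_apply, mul_self_eq_one_quadratic, AlgEquiv.one_apply]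
    set β : K := α - τ α with hβ
    have hβ2 : β ^ 2 = (T : K) ^ 2 - 4 * N := by rw [← hT', ← hN', hβ]; ring
    have hβ0 : β ≠ 0 := by
      intro h0
      rw [h0] at hβ2
      have h2 : T ^ 2 = 4 * N := by
        have : (T : K) ^ 2 = 4 * N := by linear_combination -hβ2
        exact_mod_cast this
      exact hpT (Int.Prime.dvd_pow' hp.out (h2 ▸ hpN.mul_left 4))
    have hτ1 : τ ≠ 1 := by
      rintro rfl
      exact hβ0 (by rw [hβ, AlgEquiv.one_apply, sub_self])
    have hτs := apply_eq_neg_of_ne_one hs hs' hτ1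
    obtain ⟨q, hq⟩ := (IsGalois.mem_range_algebraMap_iff_fixed (β / s)).2 fun g => by
      rcases eq_or_eq_of_ne_one hτ1 g with rfl | rfl
      · rfl
      · rw [map_div₀, hτs, hβ, map_sub, hττ, div_neg, ← neg_div, neg_sub]
    have hβq : β = algebraMap ℚ K q * s := by rw [hq, div_mul_cancel₀ _ hs0]
    have hq0 : q ≠ 0 := by rintro rfl; exact hβ0 (by rw [hβq, map_zero, zero_mul])
    have hqQ : q ^ 2 * Δ = (T : ℚ) ^ 2 - 4 * N := by
      apply (algebraMap ℚ K).injective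
      rw [hβq, mul_pow, hs] at hβ2
      simpa using hβ2
    obtain ⟨z, hz⟩ := isSquare_disc_of_dvd hpN hpT
    have hqp : (q : ℚ_[p]) ^ 2 * Δ = (T : ℚ_[p]) ^ 2 - 4 * N := by
      exact_mod_cast congrArg (Rat.cast : ℚ → ℚ_[p]) hqQ
    have hq0' : (q : ℚ_[p]) ≠ 0 := by exact_mod_cast hq0
    refine ⟨z / q, ?_⟩
    rw [div_pow, hz, ← hqp, mul_div_cancel_left₀ _ (pow_ne_zero _ hq0')]
  · rintro ⟨r, hr⟩
    have hΔ0 : Δ ≠ 0 := by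
      rintro rfl
      exact hs0 (by simpa using hs)
    have hr1 : ‖r‖ ≤ 1 := by
      have h1 : ‖r‖ ^ 2 ≤ 1 := by rw [← norm_pow, hr]; exact Padic.norm_int_le_one _
      exact (sq_le_one_iff₀ (norm_nonneg _)).1 h1
    have hr0 : r ≠ 0 := by
      rintro rfl
      refine hΔ0 ?_
      have : (Δ : ℚ_[p]) = 0 := by rw [← hr]; simp
      exact_mod_cast this
    obtain ⟨ρ, rfl⟩ : ∃ ρ : ℤ_[p], (ρ : ℚ_[p]) = r := ⟨⟨r, hr1⟩, rfl⟩
    have h2ρ : 2 * ρ ≠ 0 := mul_ne_zero two_ne_zero (by rintro rfl; exact hr0 rfl)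
    -- With `n ≡ ρ mod p ^ (k + 1)`, where `‖2 ρ‖ = p ^ (-k)`, the element `(n - s) / p ^ k` is an
    -- algebraic integer whose trace is prime to `p` and whose norm is divisible by `p`.
    set k := (2 * ρ).valuation with hk
    have hnorm : ‖(2 * ρ : ℚ_[p])‖ = (p : ℝ) ^ (-k : ℤ) := by
      have := PadicInt.norm_eq_zpow_neg_valuation h2ρ
      rw [← hk] at this
      rw [← this, PadicInt.norm_def]; push_cast; rfl
    have hp0 : (0 : ℝ) < p := by exact_mod_cast hp.out.pos
    have hp1 : (1 : ℝ) < p := by exact_mod_cast hp.out.one_lt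
    set n : ℕ := ρ.appr (k + 1) with hn
    have happ : ‖((ρ : ℚ_[p]) - n)‖ ≤ (p : ℝ) ^ (-((k + 1 : ℕ) : ℤ)) := by
      have := (PadicInt.norm_le_pow_iff_mem_span_pow (ρ - (n : ℤ_[p])) (k + 1)).2
        (ρ.appr_spec (k + 1))
      rw [PadicInt.norm_def] at this
      exact_mod_cast this
    have hlt : (p : ℝ) ^ (-((k + 1 : ℕ) : ℤ)) < (p : ℝ) ^ (-k : ℤ) :=
      zpow_lt_zpow_right₀ hp1 (by push_cast; omega)
    have hleft : ∀ {a b : ℚ_[p]}, ‖b‖ < ‖a‖ → ‖a + b‖ = ‖a‖ := fun h => by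
      rw [IsUltrametricDist.norm_add_eq_max_of_norm_ne_norm h.ne', max_eq_left h.le]
    have hsum : ‖((ρ : ℚ_[p]) + n)‖ = (p : ℝ) ^ (-k : ℤ) := by
      rw [show (ρ : ℚ_[p]) + n = 2 * ρ + -(ρ - n) by ring, ← hnorm]
      exact hleft (by rw [norm_neg, hnorm]; exact happ.trans_lt hlt)
    have h2n : ‖(2 * n : ℚ_[p])‖ = (p : ℝ) ^ (-k : ℤ) := by
      rw [show (2 * n : ℚ_[p]) = 2 * ρ + -(2 * (ρ - n)) by ring, ← hnorm]
      refine hleft ?_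
      rw [norm_neg, hnorm, norm_mul]
      refine (mul_le_of_le_one_left (norm_nonneg _) ?_).trans_lt (happ.trans_lt hlt)
      exact_mod_cast Padic.norm_int_le_one (p := p) 2
    obtain ⟨T, hT⟩ : (p : ℤ) ^ k ∣ 2 * n := by
      have := (Padic.norm_int_le_pow_iff_dvd (p := p) (2 * n : ℤ) k).1 (by push_cast; exact h2n.le)
      exact this
    have hpT : ¬ (p : ℤ) ∣ T := by
      rintro ⟨T', rfl⟩
      have h3 : (p : ℤ) ^ (k + 1) ∣ 2 * n := ⟨T', by rw [hT]; ring⟩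
      have h4 := (Padic.norm_int_le_pow_iff_dvd (p := p) (2 * n : ℤ) (k + 1)).2 h3
      push_cast at h4 hlt
      rw [h2n] at h4
      exact absurd h4 (not_le.2 hlt)
    obtain ⟨N, hN⟩ : (p : ℤ) ^ (2 * k + 1) ∣ n ^ 2 - Δ := by
      refine (Padic.norm_int_le_pow_iff_dvd (p := p) (n ^ 2 - Δ : ℤ) (2 * k + 1)).1 ?_
      push_cast
      rw [← hr, show (n : ℚ_[p]) ^ 2 - ρ ^ 2 = -((ρ + n) * (ρ - n)) by ring, norm_neg, norm_mul,
        hsum]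
      refine (mul_le_mul_of_nonneg_left happ (zpow_nonneg hp0.le _)).trans_eq ?_
      rw [← zpow_add₀ hp0.ne']
      congr 1
      push_cast; ring
    have hpk : ((p : ℤ) : K) ^ k ≠ 0 := pow_ne_zero _ (by exact_mod_cast hp.out.ne_zero)
    have hTK : (2 : K) * n = (p : ℤ) ^ k * T := by exact_mod_cast congrArg (Int.cast : ℤ → K) hT
    have hNK : (n : K) ^ 2 - Δ = (p : ℤ) ^ (2 * k + 1) * N := by
      exact_mod_cast congrArg (Int.cast : ℤ → K) hN
    obtain ⟨τ, hτ1, -⟩ := (Nat.card_eq_two_iff' (1 : Gal(K/ℚ))).1 natCard_gal_quadratic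
    have hτs := apply_eq_neg_of_ne_one hs hs' hτ1
    set a : K := ((n : K) - s) / ((p : ℤ) : K) ^ k with ha
    have hτa : τ a = ((n : K) + s) / ((p : ℤ) : K) ^ k := by
      rw [ha, map_div₀, map_sub, hτs, map_natCast, map_pow, map_intCast, sub_neg_eq_add]
    have hadd : a + τ a = T := by
      rw [hτa, ha, ← add_div, div_eq_iff hpk]; linear_combination hTK
    have hmul : a * τ a = ((p * N : ℤ) : K) := by
      rw [hτa, ha, div_mul_div_comm, div_eq_iff (mul_ne_zero hpk hpk)]
      push_cast at hNK ⊢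
      linear_combination hNK - hs
    have hint : IsIntegral ℤ a := by
      refine ⟨Polynomial.X ^ 2 - Polynomial.C T * Polynomial.X + Polynomial.C (p * N), ?_, ?_⟩
      · monicity!
      · simp only [Polynomial.eval₂_add, Polynomial.eval₂_sub, Polynomial.eval₂_mul,
          Polynomial.eval₂_pow, Polynomial.eval₂_X, Polynomial.eval₂_C]
        rw [eq_intCast, eq_intCast, ← hadd, ← hmul]; ring
    refine ⟨τ, ⟨a, hint⟩, T, p * N, ?_, ?_, dvd_mul_right _ _, hpT⟩
    · apply RingOfIntegers.coe_injective
      rw [map_intCast]; exact hadd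
    · apply RingOfIntegers.coe_injective
      rw [map_intCast]; exact hmul

end Quadratic

/-! ### The field of a periodic orbit -/

theorem IsGammaOf.map_mul_eq {g : PGL(2, ℝ)} {γ : PGL(2, ℤ)} (hγ : IsGammaOf g γ) :
    ProjGenLinGroup.map (Int.castRingHom ℝ) γ * g =
      g * aInf (-period (coset GammaInf g)) := by
  rw [IsGammaOf, inv_mul_eq_iff_eq_mul] at hγ
  rw [aInf_neg, eq_mul_inv_iff_mul_eq, mul_assoc, ← hγ]

/-- The number `tr² / det = e ^ t + 2 + e ^ (-t)` of `γ_x` exceeds `4`, which rules out the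
determinant `-1`. -/
theorem trace_sq_of_isGammaOf {g : PGL(2, ℝ)} (hg : IsPeriodic (coset GammaInf g))
    {m : GL (Fin 2) ℤ} (hγ : IsGammaOf g (ProjGenLinGroup.mk m)) :
    (m : Matrix (Fin 2) (Fin 2) ℤ).det = 1 ∧ 4 < (m : Matrix (Fin 2) (Fin 2) ℤ).trace ^ 2 ∧
    (((m : Matrix (Fin 2) (Fin 2) ℤ).trace : ℤ) : ℝ) ^ 2 =
      Real.exp (period (coset GammaInf g)) + 2 + Real.exp (-period (coset GammaInf g)) := by
  have h1 := normTrace_eq_exp hγ.map_mul_eq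
  have hpos := hg.period_pos
  set t := period (coset GammaInf g)
  rw [ProjGenLinGroup.map_mk, normTrace_mk, trace_map_GL, det_map_GL, neg_neg] at h1
  simp only [eq_intCast] at h1
  have h4 : 4 < Real.exp (-t) + 2 + Real.exp t := by
    have := Real.add_one_lt_exp hpos.ne'
    have := Real.add_one_lt_exp (neg_ne_zero.2 hpos.ne')
    linarith
  have hdet : (m : Matrix (Fin 2) (Fin 2) ℤ).det = 1 := by
    rcases Int.isUnit_iff.1 ((Matrix.isUnit_iff_isUnit_det _).1 m.isUnit) with h | h
    · exact h
    · rw [h] at h1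
      push_cast at h1
      have := sq_nonneg (((m : Matrix (Fin 2) (Fin 2) ℤ).trace : ℤ) : ℝ)
      linarith
  rw [hdet, Int.cast_one, div_one] at h1
  refine ⟨hdet, ?_, by rw [h1]; ring⟩
  rw [← h1] at h4
  exact_mod_cast h4

theorem mem_spectrum_iff (m : Matrix (Fin 2) (Fin 2) ℤ) (hm : m.det = 1) (l : ℝ) :
    l ∈ spectrum ℝ (m.map (Int.cast : ℤ → ℝ)) ↔ l ^ 2 - (m.trace : ℤ) * l + 1 = 0 := by
  have hm' : (m 0 0 : ℝ) * m 1 1 - m 0 1 * m 1 0 = 1 := by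
    rw [Matrix.det_fin_two] at hm; exact_mod_cast hm
  rw [spectrum.mem_iff, Matrix.isUnit_iff_isUnit_det, isUnit_iff_ne_zero, not_ne_iff,
    Matrix.det_fin_two, Matrix.trace_fin_two]
  simp only [Matrix.sub_apply, Matrix.algebraMap_matrix_apply, Matrix.map_apply]
  simp only [Fin.isValue, ↓reduceIte, Algebra.algebraMap_self, RingHom.id_apply, zero_ne_one,
    one_ne_zero, zero_sub]
  push_cast
  exact ⟨fun h => by linear_combination h - hm', fun h => by linear_combination h + hm'⟩

/-- The field of a periodic orbit is generated by the square root of the discriminant of `γ_x`. -/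
theorem fieldOf_eq {g : PGL(2, ℝ)} (hg : IsPeriodic (coset GammaInf g))
    {m : GL (Fin 2) ℤ} (hγ : IsGammaOf g (ProjGenLinGroup.mk m)) :
    fieldOf (coset GammaInf g) = IntermediateField.adjoin ℚ
      {Real.sqrt (((m : Matrix (Fin 2) (Fin 2) ℤ).trace ^ 2 - 4 : ℤ) : ℝ)} := by
  obtain ⟨hdet, htr, hexp⟩ := trace_sq_of_isGammaOf hg hγ
  set n := (m : Matrix (Fin 2) (Fin 2) ℤ).trace with hn
  set s := Real.sqrt ((n ^ 2 - 4 : ℤ) : ℝ) with hs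
  have hs2 : s ^ 2 = (n : ℝ) ^ 2 - 4 := by
    rw [hs, Real.sq_sqrt (by exact_mod_cast (by omega : (0 : ℤ) ≤ n ^ 2 - 4))]
    push_cast; ring
  apply le_antisymm
  · rw [fieldOf, IntermediateField.adjoin_le_iff]
    rintro l ⟨g', m', hg', hγ', hl⟩
    obtain ⟨hdet', htr', hexp'⟩ := trace_sq_of_isGammaOf (hg' ▸ hg) hγ'
    rw [hg', ← hexp] at hexp'
    rw [mem_spectrum_iff _ hdet'] at hl
    set n' := (m' : Matrix (Fin 2) (Fin 2) ℤ).trace with hn'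
    have h1 : (2 * l - n') ^ 2 = s ^ 2 := by
      rw [hs2]; linear_combination 4 * hl + hexp'
    have hsK : s ∈ IntermediateField.adjoin ℚ {s} := IntermediateField.mem_adjoin_simple_self ℚ s
    have h2 : (2 * l - n') ∈ IntermediateField.adjoin ℚ {s} := by
      rcases sq_eq_sq_iff_eq_or_eq_neg.1 h1 with h | h
      · rw [h]; exact hsK
      · rw [h]; exact neg_mem hsK
    have h3 : l = ((2 * l - n') + n') / 2 := by ring
    rw [SetLike.mem_coe, h3]
    exact div_mem (add_mem h2 (intCast_mem _ _)) (ofNat_mem _ 2)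
  · rw [IntermediateField.adjoin_le_iff, Set.singleton_subset_iff, SetLike.mem_coe]
    have h1 : (n + s) / 2 ∈ fieldOf (coset GammaInf g) := by
      refine IntermediateField.subset_adjoin _ _ ⟨g, m, rfl, hγ, ?_⟩
      rw [mem_spectrum_iff _ hdet]
      linear_combination hs2 / 4
    have h2 : s = 2 * ((n + s) / 2) - n := by ring
    rw [h2]
    exact sub_mem (mul_mem (ofNat_mem _ 2) h1) (intCast_mem _ _)

theorem not_isSquare_sq_sub_four {n : ℤ} (hn : 4 < n ^ 2) : ¬ IsSquare (n ^ 2 - 4) := by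
  rintro ⟨k, hk⟩
  rw [← sq_abs n] at hn hk
  rw [← abs_mul_abs_self k] at hk
  have h0 := abs_nonneg n
  have h1 := abs_nonneg k
  have h2 : 3 ≤ |n| := by nlinarith
  have h3 : |k| ≤ |n| - 1 := by nlinarith
  nlinarith

/-- A periodic class splits for `S` exactly if the discriminant of `γ_x` is a square in `ℚ_p` for
some `p ∈ S`. -/
theorem isSplit_iff {g : PGL(2, ℝ)} (hg : IsPeriodic (coset GammaInf g))
    {m : GL (Fin 2) ℤ} (hγ : IsGammaOf g (ProjGenLinGroup.mk m)) (S : Finset Nat.Primes) :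
    IsSplit S (coset GammaInf g) ↔ ∃ p ∈ S, ∃ r : ℚ_[p],
      r ^ 2 = (((m : Matrix (Fin 2) (Fin 2) ℤ).trace ^ 2 - 4 : ℤ) : ℚ_[p]) := by
  obtain ⟨hdet, htr, hexp⟩ := trace_sq_of_isGammaOf hg hγ
  have hF := fieldOf_eq hg hγ
  rw [IsSplit]
  generalize fieldOf (coset GammaInf g) = K at hF ⊢
  set Δ : ℤ := (m : Matrix (Fin 2) (Fin 2) ℤ).trace ^ 2 - 4 with hΔ
  have hs2 : Real.sqrt (Δ : ℝ) ^ 2 = Δ :=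
    Real.sq_sqrt (by exact_mod_cast (by omega : (0 : ℤ) ≤ Δ))
  have hnsq : ∀ q : ℚ, q ^ 2 ≠ Δ := fun q hq =>
    not_isSquare_sq_sub_four htr (Rat.isSquare_intCast_iff.1 ⟨q, by rw [← hq, pow_two]⟩)
  subst hF
  set s := Real.sqrt (Δ : ℝ) with hs
  have hirr : Irreducible (Polynomial.X ^ 2 - Polynomial.C (Δ : ℚ)) :=
    X_pow_sub_C_irreducible_of_prime Nat.prime_two hnsq
  have hroot : Polynomial.aeval s (Polynomial.X ^ 2 - Polynomial.C (Δ : ℚ)) = 0 := by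
    simp [hs2]
  have hmonic : (Polynomial.X ^ 2 - Polynomial.C (Δ : ℚ)).Monic :=
    Polynomial.monic_X_pow_sub_C _ two_ne_zero
  have hsint : IsIntegral ℚ s := ⟨_, hmonic, hroot⟩
  have hfin : FiniteDimensional ℚ (IntermediateField.adjoin ℚ {s}) :=
    IntermediateField.adjoin.finiteDimensional hsint
  have : NumberField (IntermediateField.adjoin ℚ {s}) := ⟨⟩
  have : Algebra.IsQuadraticExtension ℚ (IntermediateField.adjoin ℚ {s}) :=
    { finrank_eq_two' := by
        rw [IntermediateField.adjoin.finrank hsint,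
          ← minpoly.eq_of_irreducible_of_monic hirr hroot hmonic,
          Polynomial.natDegree_X_pow_sub_C] }
  refine exists_congr fun p => and_congr_right fun _ => ?_
  refine ncard_primesOver_eq_two_iff (s := IntermediateField.AdjoinSimple.gen ℚ s) ?_ ?_
  · apply Subtype.ext
    push_cast
    simpa using hs2
  · rintro ⟨q, hq⟩
    refine hnsq q ?_
    have h1 : (q : ℝ) = s := by simpa using congrArg Subtype.val hq
    have h2 : (q : ℝ) ^ 2 = Δ := by rw [h1, hs2]
    exact_mod_cast h2

/-! ### Primitive vectors and the lower left entry of a conjugate -/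

/-- The binary quadratic form `v ↦ det (v, A v)`. For the first column `v` of an invertible matrix
`k` it is, up to `det k`, the lower left entry of `k⁻¹ A k`; its zeros are the eigenvectors
of `A`. -/
def lowerForm {R : Type*} [CommRing R] (A : Matrix (Fin 2) (Fin 2) R) (x y : R) : R :=
  A 1 0 * x ^ 2 + (A 1 1 - A 0 0) * x * y - A 0 1 * y ^ 2

theorem det_mul_conj_apply {R : Type*} [CommRing R] (k : GL (Fin 2) R)
    (A : Matrix (Fin 2) (Fin 2) R) :
    (k : Matrix (Fin 2) (Fin 2) R).det * (((k⁻¹ : GL (Fin 2) R) : Matrix (Fin 2) (Fin 2) R) * A *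
      (k : Matrix (Fin 2) (Fin 2) R)) 1 0 =
    lowerForm A ((k : Matrix (Fin 2) (Fin 2) R) 0 0) ((k : Matrix (Fin 2) (Fin 2) R) 1 0) := by
  set B := ((k⁻¹ : GL (Fin 2) R) : Matrix (Fin 2) (Fin 2) R) * A * (k : Matrix (Fin 2) (Fin 2) R)
    with hB
  have h : (k : Matrix (Fin 2) (Fin 2) R) * B = A * k := by
    rw [hB, ← Matrix.mul_assoc, ← Matrix.mul_assoc, ← Units.val_mul, mul_inv_cancel,
      Units.val_one, Matrix.one_mul]
  have h0 := congrFun (congrFun h 0) 0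
  have h1 := congrFun (congrFun h 1) 0
  rw [Matrix.mul_apply, Matrix.mul_apply, Fin.sum_univ_two, Fin.sum_univ_two] at h0 h1
  rw [Matrix.det_fin_two, lowerForm]
  linear_combination (k : Matrix (Fin 2) (Fin 2) R) 0 0 * h1 -
    (k : Matrix (Fin 2) (Fin 2) R) 1 0 * h0

/-- A zero of the quadratic form makes the discriminant a square. -/
theorem exists_sq_eq_of_lowerForm_eq_zero {K : Type*} [Field K] {A : Matrix (Fin 2) (Fin 2) K}
    {x y : K} (hxy : x ≠ 0 ∨ y ≠ 0) (h : lowerForm A x y = 0) :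
    ∃ r, r ^ 2 = A.trace ^ 2 - 4 * A.det := by
  rw [Matrix.trace_fin_two, Matrix.det_fin_two]
  rw [lowerForm] at h
  by_cases hy : y = 0
  · have hx : x ≠ 0 := hxy.resolve_right (not_not.2 hy)
    have hc : A 1 0 = 0 := by
      rw [hy] at h
      have : A 1 0 * x ^ 2 = 0 := by linear_combination h
      exact (mul_eq_zero.1 this).resolve_right (pow_ne_zero _ hx)
    exact ⟨A 1 1 - A 0 0, by rw [hc]; ring⟩
  · refine ⟨(2 * A 1 0 * x + (A 1 1 - A 0 0) * y) / y, ?_⟩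
    rw [div_pow, div_eq_iff (pow_ne_zero _ hy)]
    linear_combination 4 * A 1 0 * h

/-- If `s ≠ 0`, then `A ^ n` has the same eigenvectors as `A`. -/
theorem lowerForm_pow {R : Type*} [CommRing R] {A : Matrix (Fin 2) (Fin 2) R} {n : ℕ} {r s : R}
    (h : A ^ n = r • (1 : Matrix (Fin 2) (Fin 2) R) + s • A) (x y : R) :
    lowerForm (A ^ n) x y = s * lowerForm A x y := by
  rw [h, lowerForm, lowerForm]
  simp
  ring

section Padic

variable {p : ℕ} [hp : Fact p.Prime]

/-- A vector of `ℤ_p²` is primitive if one of its entries is a unit. -/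
def IsPrimitive (x y : ℤ_[p]) : Prop := ‖x‖ = 1 ∨ ‖y‖ = 1

theorem IsPrimitive.ne_zero {x y : ℤ_[p]} (h : IsPrimitive x y) :
    (x : ℚ_[p]) ≠ 0 ∨ (y : ℚ_[p]) ≠ 0 := by
  rcases h with h | h
  · left
    intro h0
    rw [PadicInt.norm_def, h0, norm_zero] at h
    exact zero_ne_one h
  · right
    intro h0
    rw [PadicInt.norm_def, h0, norm_zero] at h
    exact zero_ne_one h

theorem exists_gl_of_isPrimitive {x y : ℤ_[p]} (h : IsPrimitive x y) :
    ∃ k : GL (Fin 2) ℤ_[p], (k : Matrix (Fin 2) (Fin 2) ℤ_[p]) 0 0 = x ∧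
      (k : Matrix (Fin 2) (Fin 2) ℤ_[p]) 1 0 = y := by
  rcases h with h | h
  · have hdet : IsUnit (!![x, 0; y, 1] : Matrix (Fin 2) (Fin 2) ℤ_[p]).det := by
      rw [Matrix.det_fin_two]; simpa [PadicInt.isUnit_iff] using h
    exact ⟨Matrix.GeneralLinearGroup.mk'' _ hdet, rfl, rfl⟩
  · have hdet : IsUnit (!![x, -1; y, 0] : Matrix (Fin 2) (Fin 2) ℤ_[p]).det := by
      rw [Matrix.det_fin_two]; simpa [PadicInt.isUnit_iff] using h
    exact ⟨Matrix.GeneralLinearGroup.mk'' _ hdet, rfl, rfl⟩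

theorem norm_det_gl (k : GL (Fin 2) ℤ_[p]) :
    ‖(k : Matrix (Fin 2) (Fin 2) ℤ_[p]).det‖ = 1 :=
  PadicInt.isUnit_iff.1 ((Matrix.isUnit_iff_isUnit_det _).1 k.isUnit)

theorem isPrimitive_of_gl (k : GL (Fin 2) ℤ_[p]) :
    IsPrimitive ((k : Matrix (Fin 2) (Fin 2) ℤ_[p]) 0 0)
      ((k : Matrix (Fin 2) (Fin 2) ℤ_[p]) 1 0) := by
  by_contra hcon
  rw [IsPrimitive, not_or] at hcon
  have h0 := lt_of_le_of_ne (PadicInt.norm_le_one _) hcon.1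
  have h1 := lt_of_le_of_ne (PadicInt.norm_le_one _) hcon.2
  have hm : ∀ a b : ℤ_[p], ‖a‖ < 1 → ‖a * b‖ < 1 := fun a b h => by
    rw [norm_mul]
    exact mul_lt_one_of_nonneg_of_lt_one_left (norm_nonneg _) h (PadicInt.norm_le_one _)
  have := norm_det_gl k
  rw [Matrix.det_fin_two, mul_comm ((k : Matrix (Fin 2) (Fin 2) ℤ_[p]) 0 1), sub_eq_add_neg] at this
  have h2 := (PadicInt.nonarchimedean ((k : Matrix (Fin 2) (Fin 2) ℤ_[p]) 0 0 *
    (k : Matrix (Fin 2) (Fin 2) ℤ_[p]) 1 1) (-((k : Matrix (Fin 2) (Fin 2) ℤ_[p]) 1 0 *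
    (k : Matrix (Fin 2) (Fin 2) ℤ_[p]) 0 1))).trans_lt
    (max_lt (hm _ _ h0) (by rw [norm_neg]; exact hm _ _ h1))
  rw [this] at h2
  exact lt_irrefl _ h2

/-- An integral matrix, viewed over `ℚ_p`. -/
noncomputable abbrev toQp (k : GL (Fin 2) ℤ_[p]) : GL (Fin 2) ℚ_[p] :=
  Matrix.GeneralLinearGroup.map (algebraMap ℤ_[p] ℚ_[p]) k

theorem toQp_apply (k : GL (Fin 2) ℤ_[p]) (i j : Fin 2) :
    (toQp k : Matrix (Fin 2) (Fin 2) ℚ_[p]) i j =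
      ((k : Matrix (Fin 2) (Fin 2) ℤ_[p]) i j : ℚ_[p]) := rfl

theorem norm_det_toQp (k : GL (Fin 2) ℤ_[p]) :
    ‖(toQp k : Matrix (Fin 2) (Fin 2) ℚ_[p]).det‖ = 1 := by
  rw [det_map_GL]; exact norm_det_gl k

theorem norm_conj_apply (k : GL (Fin 2) ℤ_[p]) (A : Matrix (Fin 2) (Fin 2) ℚ_[p]) :
    ‖((((toQp k)⁻¹ : GL (Fin 2) ℚ_[p]) : Matrix (Fin 2) (Fin 2) ℚ_[p]) * A *
      (toQp k : Matrix (Fin 2) (Fin 2) ℚ_[p])) 1 0‖ =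
    ‖lowerForm A ((k : Matrix (Fin 2) (Fin 2) ℤ_[p]) 0 0 : ℚ_[p])
      ((k : Matrix (Fin 2) (Fin 2) ℤ_[p]) 1 0 : ℚ_[p])‖ := by
  rw [← toQp_apply, ← toQp_apply, ← det_mul_conj_apply, norm_mul, norm_det_toQp, one_mul]

theorem isUpperTriangular_conj_iff (k : GL (Fin 2) ℤ_[p]) (M : GL (Fin 2) ℚ_[p]) :
    IsUpperTriangular ((ProjGenLinGroup.mk (toQp k))⁻¹ * ProjGenLinGroup.mk M *
      ProjGenLinGroup.mk (toQp k)) ↔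
    lowerForm (M : Matrix (Fin 2) (Fin 2) ℚ_[p])
      ((k : Matrix (Fin 2) (Fin 2) ℤ_[p]) 0 0 : ℚ_[p])
      ((k : Matrix (Fin 2) (Fin 2) ℤ_[p]) 1 0 : ℚ_[p]) = 0 := by
  rw [← map_inv, ← map_mul, ← map_mul, isUpperTriangular_mk_iff, Units.val_mul, Units.val_mul,
    ← norm_eq_zero, norm_conj_apply, norm_eq_zero]

theorem NearOne.conj {E : Matrix (Fin 2) (Fin 2) ℚ_[p]} (hE : NearOne E) (k : GL (Fin 2) ℤ_[p]) :
    NearOne ((((toQp k)⁻¹ : GL (Fin 2) ℚ_[p]) : Matrix (Fin 2) (Fin 2) ℚ_[p]) * E *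
      (toQp k : Matrix (Fin 2) (Fin 2) ℚ_[p])) := by
  intro i j
  have e : (((toQp k)⁻¹ : GL (Fin 2) ℚ_[p]) : Matrix (Fin 2) (Fin 2) ℚ_[p]) * E *
      (toQp k : Matrix (Fin 2) (Fin 2) ℚ_[p]) - 1 =
      (((toQp k)⁻¹ : GL (Fin 2) ℚ_[p]) : Matrix (Fin 2) (Fin 2) ℚ_[p]) * (E - 1) *
      (toQp k : Matrix (Fin 2) (Fin 2) ℚ_[p]) := by
    rw [Matrix.mul_sub, Matrix.sub_mul, Matrix.mul_one, ← Units.val_mul, inv_mul_cancel,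
      Units.val_one]
  rw [e, ← map_inv]
  have hint : ∀ (k : GL (Fin 2) ℤ_[p]) (a b : Fin 2),
      ‖(toQp k : Matrix (Fin 2) (Fin 2) ℚ_[p]) a b‖ ≤ 1 := fun k a b => PadicInt.norm_le_one _
  have h1 : ∀ a b, ‖((toQp k⁻¹ : Matrix (Fin 2) (Fin 2) ℚ_[p]) * (E - 1)) a b‖ ≤
      (p : ℝ) ^ (-2 : ℤ) := fun a b => by
    rw [Matrix.mul_apply, Fin.sum_univ_two]
    refine norm_add_le_of_le ?_ ?_
    · rw [norm_mul]; exact (mul_le_of_le_one_left (norm_nonneg _) (hint _ _ _)).trans (hE _ _)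
    · rw [norm_mul]; exact (mul_le_of_le_one_left (norm_nonneg _) (hint _ _ _)).trans (hE _ _)
  rw [Matrix.mul_apply, Fin.sum_univ_two]
  refine norm_add_le_of_le ?_ ?_
  · rw [norm_mul]; exact (mul_le_of_le_one_right (norm_nonneg _) (hint _ _ _)).trans (h1 _ _)
  · rw [norm_mul]; exact (mul_le_of_le_one_right (norm_nonneg _) (hint _ _ _)).trans (h1 _ _)

/-- If the discriminant is a square, then there is a primitive eigenvector. -/
theorem exists_isPrimitive_lowerForm_eq_zero {A : Matrix (Fin 2) (Fin 2) ℚ_[p]} {r : ℚ_[p]}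
    (hr : r ^ 2 = A.trace ^ 2 - 4 * A.det) :
    ∃ x y : ℤ_[p], IsPrimitive x y ∧ lowerForm A (x : ℚ_[p]) (y : ℚ_[p]) = 0 := by
  rw [Matrix.trace_fin_two, Matrix.det_fin_two] at hr
  by_cases hc : A 1 0 = 0
  · exact ⟨1, 0, Or.inl (by simp), by simp [lowerForm, hc]⟩
  · set X : ℚ_[p] := (r - (A 1 1 - A 0 0)) / (2 * A 1 0) with hX
    have h1 : A 1 0 * X ^ 2 + (A 1 1 - A 0 0) * X - A 0 1 = 0 := by
      rw [hX]
      field_simp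
      linear_combination hr
    by_cases hX1 : ‖X‖ ≤ 1
    · refine ⟨⟨X, hX1⟩, 1, Or.inr (by simp), ?_⟩
      rw [lowerForm]
      push_cast
      linear_combination h1
    · have hX0 : X ≠ 0 := by rintro h0; rw [h0, norm_zero] at hX1; exact hX1 zero_le_one
      have hX2 : ‖X⁻¹‖ ≤ 1 := by
        rw [norm_inv]; exact inv_le_one_of_one_le₀ (not_le.1 hX1).le
      refine ⟨1, ⟨X⁻¹, hX2⟩, Or.inl (by simp), ?_⟩
      rw [lowerForm]
      push_cast
      field_simp
      linear_combination h1

/-- Close to a primitive eigenvector `v` there are primitive vectors that are not eigenvectors, at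
which the form is small but nonzero: a non-degenerate form cannot vanish at all of `v`, `v + z w`
and `v - z w` if `v` and `w` form a basis. -/
theorem exists_isPrimitive_near {A : Matrix (Fin 2) (Fin 2) ℚ_[p]} (hA : ∀ i j, ‖A i j‖ ≤ 1)
    (hdisc : A.trace ^ 2 - 4 * A.det ≠ 0) {x y : ℤ_[p]} (hxy : IsPrimitive x y)
    (h0 : lowerForm A (x : ℚ_[p]) (y : ℚ_[p]) = 0) (N : ℕ) :
    ∃ x' y' : ℤ_[p], IsPrimitive x' y' ∧ lowerForm A (x' : ℚ_[p]) (y' : ℚ_[p]) ≠ 0 ∧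
      ‖lowerForm A (x' : ℚ_[p]) (y' : ℚ_[p])‖ ≤ (p : ℝ) ^ (-N : ℤ) := by
  rw [Matrix.trace_fin_two, Matrix.det_fin_two] at hdisc
  rw [lowerForm] at h0
  set z : ℤ_[p] := (p : ℤ_[p]) ^ N with hz
  have hz0 : (z : ℚ_[p]) ≠ 0 := by
    rw [hz]; push_cast; exact pow_ne_zero _ (by exact_mod_cast hp.1.ne_zero)
  have hznorm : ‖(z : ℚ_[p])‖ = (p : ℝ) ^ (-N : ℤ) := by
    rw [hz]; push_cast; rw [norm_pow, Padic.norm_p, inv_pow, zpow_neg, zpow_natCast]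
  have hN : ∀ B C : ℚ_[p], ‖B‖ ≤ 1 → ‖C‖ ≤ 1 →
      ∀ w : ℚ_[p], w = z * (B + z * C) ∨ w = z * (-B + z * C) → ‖w‖ ≤ (p : ℝ) ^ (-N : ℤ) := by
    intro B C hB hC w hw
    have hzC : ‖(z : ℚ_[p]) * C‖ ≤ 1 := by
      rw [norm_mul]; exact mul_le_one₀ (PadicInt.norm_le_one z) (norm_nonneg _) hC
    rcases hw with rfl | rfl
    · rw [norm_mul, hznorm]
      exact mul_le_of_le_one_right (by positivity) (norm_add_le_of_le hB hzC)
    · rw [norm_mul, hznorm]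
      exact mul_le_of_le_one_right (by positivity)
        (norm_add_le_of_le (by rwa [norm_neg]) hzC)
  have hm : ∀ a b : ℚ_[p], ‖a‖ ≤ 1 → ‖b‖ ≤ 1 → ‖a * b‖ ≤ 1 := fun a b ha hb => by
    rw [norm_mul]; exact mul_le_one₀ ha (norm_nonneg _) hb
  have h2 : ‖(2 : ℚ_[p])‖ ≤ 1 := by exact_mod_cast Padic.norm_int_le_one (p := p) 2
  have hx1 : ‖(x : ℚ_[p])‖ ≤ 1 := PadicInt.norm_le_one x
  have hy1 : ‖(y : ℚ_[p])‖ ≤ 1 := PadicInt.norm_le_one y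
  have hdiff : ‖A 1 1 - A 0 0‖ ≤ 1 := by
    rw [sub_eq_add_neg]; exact norm_add_le_of_le (hA _ _) (by rw [norm_neg]; exact hA _ _)
  have hcases : ∀ B C : ℚ_[p], ¬ (B = 0 ∧ C = 0) → B + z * C ≠ 0 ∨ -B + z * C ≠ 0 := by
    intro B C hBC
    by_contra! hcon
    have hB : 2 * B = 0 := by linear_combination hcon.1 - hcon.2
    have hB0 : B = 0 := (mul_eq_zero.1 hB).resolve_left two_ne_zero
    refine hBC ⟨hB0, ?_⟩
    have hC : (z : ℚ_[p]) * C = 0 := by linear_combination hcon.1 - hB0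
    exact (mul_eq_zero.1 hC).resolve_left hz0
  rcases hxy with hx | hy
  · have hx0 : (x : ℚ_[p]) ≠ 0 := fun h => by
      rw [PadicInt.norm_def, h, norm_zero] at hx; exact zero_ne_one hx
    -- move `v` along the axis that keeps its unit entry
    set B := (A 1 1 - A 0 0) * x - 2 * A 0 1 * y with hB
    set C := -A 0 1 with hC
    have hB1 : ‖B‖ ≤ 1 := by
      rw [hB, sub_eq_add_neg]
      exact norm_add_le_of_le (hm _ _ hdiff hx1)
        (by rw [norm_neg]; exact hm _ _ (hm _ _ h2 (hA _ _)) hy1)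
    have hC1 : ‖C‖ ≤ 1 := by rw [hC, norm_neg]; exact hA _ _
    have hBC : ¬ (B = 0 ∧ C = 0) := by
      rintro ⟨hB0, hC0⟩
      have hb : A 0 1 = 0 := neg_eq_zero.1 hC0
      rw [hB, hb] at hB0
      have hd : A 1 1 - A 0 0 = 0 :=
        (mul_eq_zero.1
          (by linear_combination hB0 : (A 1 1 - A 0 0) * (x : ℚ_[p]) = 0)).resolve_right hx0
      exact hdisc (by rw [hb]; linear_combination (A 1 1 - A 0 0) * hd)
    rcases hcases B C hBC with h | h
    · have e : lowerForm A (x : ℚ_[p]) ((y + z : ℤ_[p]) : ℚ_[p]) = z * (B + z * C) := by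
        rw [lowerForm, hB, hC]; push_cast; linear_combination h0
      exact ⟨x, y + z, Or.inl hx, by rw [e]; exact mul_ne_zero hz0 h, hN B C hB1 hC1 _ (Or.inl e)⟩
    · have e : lowerForm A (x : ℚ_[p]) ((y - z : ℤ_[p]) : ℚ_[p]) = z * (-B + z * C) := by
        rw [lowerForm, hB, hC]; push_cast; linear_combination h0
      exact ⟨x, y - z, Or.inl hx, by rw [e]; exact mul_ne_zero hz0 h, hN B C hB1 hC1 _ (Or.inr e)⟩
  · have hy0 : (y : ℚ_[p]) ≠ 0 := fun h => by
      rw [PadicInt.norm_def, h, norm_zero] at hy; exact zero_ne_one hy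
    -- move `v` along the axis that keeps its unit entry
    set B := (A 1 1 - A 0 0) * y + 2 * A 1 0 * x with hB
    set C := A 1 0 with hC
    have hB1 : ‖B‖ ≤ 1 := by
      rw [hB]
      exact norm_add_le_of_le (hm _ _ hdiff hy1) (hm _ _ (hm _ _ h2 (hA _ _)) hx1)
    have hC1 : ‖C‖ ≤ 1 := hA _ _
    have hBC : ¬ (B = 0 ∧ C = 0) := by
      rintro ⟨hB0, hC0⟩
      rw [hB, hC0] at hB0
      have hd : A 1 1 - A 0 0 = 0 :=
        (mul_eq_zero.1
          (by linear_combination hB0 : (A 1 1 - A 0 0) * (y : ℚ_[p]) = 0)).resolve_right hy0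
      exact hdisc (by rw [hC0]; linear_combination (A 1 1 - A 0 0) * hd)
    rcases hcases B C hBC with h | h
    · have e : lowerForm A ((x + z : ℤ_[p]) : ℚ_[p]) (y : ℚ_[p]) = z * (B + z * C) := by
        rw [lowerForm, hB, ← hC]; push_cast; linear_combination h0
      exact ⟨x + z, y, Or.inr hy, by rw [e]; exact mul_ne_zero hz0 h, hN B C hB1 hC1 _ (Or.inl e)⟩
    · have e : lowerForm A ((x - z : ℤ_[p]) : ℚ_[p]) (y : ℚ_[p]) = z * (-B + z * C) := by
        rw [lowerForm, hB, ← hC]; push_cast; linear_combination h0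
      exact ⟨x - z, y, Or.inr hy, by rw [e]; exact mul_ne_zero hz0 h, hN B C hB1 hC1 _ (Or.inr e)⟩

theorem exists_isPrimitive_lowerForm_ne_zero {A : Matrix (Fin 2) (Fin 2) ℚ_[p]}
    (hA : ∀ i j, ‖A i j‖ ≤ 1) (hdisc : A.trace ^ 2 - 4 * A.det ≠ 0) :
    ∃ x y : ℤ_[p], IsPrimitive x y ∧ lowerForm A (x : ℚ_[p]) (y : ℚ_[p]) ≠ 0 := by
  by_cases h : lowerForm A ((1 : ℤ_[p]) : ℚ_[p]) ((0 : ℤ_[p]) : ℚ_[p]) = 0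
  · obtain ⟨x, y, h1, h2, -⟩ := exists_isPrimitive_near hA hdisc (Or.inl (by simp)) h 0
    exact ⟨x, y, h1, h2⟩
  · exact ⟨1, 0, Or.inl (by simp), h⟩

/-- By compactness of the set of primitive vectors, a form without primitive zeros is bounded away
from `0` on them. -/
theorem exists_le_norm_lowerForm {A : Matrix (Fin 2) (Fin 2) ℚ_[p]}
    (h : ∀ x y : ℤ_[p], IsPrimitive x y → lowerForm A (x : ℚ_[p]) (y : ℚ_[p]) ≠ 0) :
    ∃ e : ℕ, ∀ x y : ℤ_[p], IsPrimitive x y →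
      (p : ℝ) ^ (-e : ℤ) ≤ ‖lowerForm A (x : ℚ_[p]) (y : ℚ_[p])‖ := by
  have hclosed : IsClosed {v : ℤ_[p] × ℤ_[p] | IsPrimitive v.1 v.2} := by
    have h1 : IsClosed {v : ℤ_[p] × ℤ_[p] | ‖v.1‖ = 1} :=
      isClosed_eq (continuous_fst.norm) continuous_const
    have h2 : IsClosed {v : ℤ_[p] × ℤ_[p] | ‖v.2‖ = 1} :=
      isClosed_eq (continuous_snd.norm) continuous_const
    exact h1.union h2
  have hcont : Continuous fun v : ℤ_[p] × ℤ_[p] => ‖lowerForm A (v.1 : ℚ_[p]) (v.2 : ℚ_[p])‖ := by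
    have hc : Continuous fun a : ℤ_[p] => (a : ℚ_[p]) := continuous_subtype_val
    have h1 : Continuous fun v : ℤ_[p] × ℤ_[p] => (v.1 : ℚ_[p]) := hc.comp continuous_fst
    have h2 : Continuous fun v : ℤ_[p] × ℤ_[p] => (v.2 : ℚ_[p]) := hc.comp continuous_snd
    exact (((continuous_const.mul (h1.pow 2)).add ((continuous_const.mul h1).mul h2)).sub
      (continuous_const.mul (h2.pow 2))).norm
  obtain ⟨v, hv, hmin⟩ := hclosed.isCompact.exists_isMinOn
    ⟨((1 : ℤ_[p]), (0 : ℤ_[p])), Or.inl (by simp)⟩ hcont.continuousOn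
  have hpos : 0 < ‖lowerForm A (v.1 : ℚ_[p]) (v.2 : ℚ_[p])‖ := norm_pos_iff.2 (h _ _ hv)
  have hp1 : ((p : ℝ))⁻¹ < 1 := inv_lt_one_of_one_lt₀ (by exact_mod_cast hp.1.one_lt)
  obtain ⟨e, he⟩ := exists_pow_lt_of_lt_one hpos hp1
  refine ⟨e, fun x y hxy => ?_⟩
  rw [zpow_neg, zpow_natCast, ← inv_pow]
  exact he.le.trans (isMinOn_iff.1 hmin (x, y) hxy)

end Padic

/-! ### Degenerate branches and eigenvectors of `γ_x` -/

theorem IsGammaOf.unique {g : PGL(2, ℝ)} {γ γ' : PGL(2, ℤ)} (h : IsGammaOf g γ)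
    (h' : IsGammaOf g γ') : γ' = γ := by
  have e := mul_right_cancel (Eq.trans h' (Eq.symm h))
  exact pgl_map_injective _ Int.cast_injective (inv_injective e)

section Local

variable {p : ℕ} [hp : Fact p.Prime]

theorem toQp_map_int (m : GL (Fin 2) ℤ) :
    toQp (Matrix.GeneralLinearGroup.map (Int.castRingHom ℤ_[p]) m) =
      Matrix.GeneralLinearGroup.map (Int.castRingHom ℚ_[p]) m := by
  ext i j
  simp [toQp]

theorem exists_toQp_of_mem_intPGL {x : PGL(2, ℚ_[p])} (hx : x ∈ intPGL p) :
    ∃ k : GL (Fin 2) ℤ_[p], ProjGenLinGroup.mk (toQp k) = x := by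
  obtain ⟨r, rfl⟩ := hx
  obtain ⟨k, rfl⟩ := ProjGenLinGroup.mk_surjective r
  exact ⟨k, rfl⟩

theorem mk_toQp_mem_intPGL (k : GL (Fin 2) ℤ_[p]) : ProjGenLinGroup.mk (toQp k) ∈ intPGL p :=
  ⟨ProjGenLinGroup.mk k, rfl⟩

/-- The discriminant of `γ_x` over `ℚ_p`. -/
theorem disc_map_int {m : GL (Fin 2) ℤ} (hm : (m : Matrix (Fin 2) (Fin 2) ℤ).det = 1) :
    (Matrix.GeneralLinearGroup.map (Int.castRingHom ℚ_[p]) m :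
      Matrix (Fin 2) (Fin 2) ℚ_[p]).trace ^ 2 -
      4 * (Matrix.GeneralLinearGroup.map (Int.castRingHom ℚ_[p]) m :
        Matrix (Fin 2) (Fin 2) ℚ_[p]).det =
      (((m : Matrix (Fin 2) (Fin 2) ℤ).trace ^ 2 - 4 : ℤ) : ℚ_[p]) := by
  rw [trace_map_GL, det_map_GL, hm]
  simp

/-- No positive power of `γ_x` is scalar, so its powers have the same eigenvectors as `γ_x`. -/
theorem lowerForm_eq_zero_of_pow {g : PGL(2, ℝ)} (hg : IsPeriodic (coset GammaInf g))
    {m : GL (Fin 2) ℤ} (hγ : IsGammaOf g (ProjGenLinGroup.mk m)) (k : GL (Fin 2) ℤ_[p]) {n : ℕ}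
    (hn : 0 < n) (h : IsUpperTriangular ((ProjGenLinGroup.mk (toQp k))⁻¹ *
      (ProjGenLinGroup.map (Int.castRingHom ℚ_[p]) (ProjGenLinGroup.mk m)) ^ n *
      ProjGenLinGroup.mk (toQp k))) :
    lowerForm (Matrix.GeneralLinearGroup.map (Int.castRingHom ℚ_[p]) m :
        Matrix (Fin 2) (Fin 2) ℚ_[p])
      ((k : Matrix (Fin 2) (Fin 2) ℤ_[p]) 0 0 : ℚ_[p])
      ((k : Matrix (Fin 2) (Fin 2) ℤ_[p]) 1 0 : ℚ_[p]) = 0 := by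
  obtain ⟨r, s, e⟩ := exists_pow_eq_smul_one_add_smul (m : Matrix (Fin 2) (Fin 2) ℤ) n
  have hmap : ∀ {K : Type} [Field K] (f : ℤ →+* K),
      (Matrix.GeneralLinearGroup.map f m : Matrix (Fin 2) (Fin 2) K) ^ n =
      f r • (1 : Matrix (Fin 2) (Fin 2) K) + f s • (Matrix.GeneralLinearGroup.map f m :
        Matrix (Fin 2) (Fin 2) K) := by
    intro K _ f
    have h1 := congrArg (fun X : Matrix (Fin 2) (Fin 2) ℤ => X.map f) e
    simp only [Matrix.map_pow] at h1
    refine Eq.trans h1 ?_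
    ext i j
    simp only [Matrix.map_apply, Matrix.add_apply, Matrix.smul_apply, smul_eq_mul, map_add,
      map_mul, Matrix.one_apply, apply_ite f, map_one, map_zero]
    rfl
  have hs : s ≠ 0 := by
    rintro rfl
    have h1 := pow_mul_eq_mul_pow hγ.map_mul_eq n
    have h2 := hmap (Int.castRingHom ℝ)
    rw [map_zero, zero_smul, add_zero] at h2
    have hr : (Int.castRingHom ℝ r) ≠ 0 := by
      intro h0
      rw [h0, zero_smul, ← Units.val_pow_eq_pow_val] at h2
      exact det_ne_zero_GL (Matrix.GeneralLinearGroup.map (Int.castRingHom ℝ) m ^ n)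
        (by rw [h2, Matrix.det_zero])
    have h3 : (ProjGenLinGroup.map (Int.castRingHom ℝ) (ProjGenLinGroup.mk m)) ^ n = 1 := by
      rw [ProjGenLinGroup.map_mk, ← map_pow, ← map_one ProjGenLinGroup.mk, eq_comm,
        mk_eq_mk_iff_smul]
      exact ⟨_, hr, by rw [Units.val_pow_eq_pow_val, h2, Units.val_one]⟩
    rw [h3, one_mul, eq_comm, mul_eq_left, ← aInf_nsmul, ← aInf_zero] at h1
    have h4 := aInf_injective h1
    have hpos := hg.period_pos
    have hn' : (0 : ℝ) < n := by exact_mod_cast hn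
    have := mul_pos hn' hpos
    linarith
  rw [ProjGenLinGroup.map_mk, ← map_pow, isUpperTriangular_conj_iff, Units.val_pow_eq_pow_val,
    lowerForm_pow (hmap _)] at h
  refine (mul_eq_zero.1 h).resolve_left ?_
  simpa using hs

end Local

theorem isDegenerate_iff {S : Finset Nat.Primes} {g : PGL(2, ℝ)}
    (hg : IsPeriodic (coset GammaInf g)) {m : GL (Fin 2) ℤ}
    (hγ : IsGammaOf g (ProjGenLinGroup.mk m)) {ω : GS S} {k : (p : S) → GL (Fin 2) ℤ_[p.1]}
    (hk : ∀ p, ProjGenLinGroup.mk (toQp (k p)) = ω p) :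
    IsDegenerate S g ω ↔ ∃ p : S,
      lowerForm (Matrix.GeneralLinearGroup.map (Int.castRingHom ℚ_[p.1]) m :
        Matrix (Fin 2) (Fin 2) ℚ_[p.1])
        ((k p : Matrix (Fin 2) (Fin 2) ℤ_[p.1]) 0 0 : ℚ_[p.1])
        ((k p : Matrix (Fin 2) (Fin 2) ℤ_[p.1]) 1 0 : ℚ_[p.1]) = 0 := by
  constructor
  · rintro ⟨γ, hγ', p, n, hn, h⟩
    rw [hγ.unique hγ', ← hk] at h
    exact ⟨p, lowerForm_eq_zero_of_pow hg hγ (k p) hn h⟩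
  · rintro ⟨p, h⟩
    refine ⟨_, hγ, p, 1, one_pos, ?_⟩
    rw [pow_one, ← hk, ProjGenLinGroup.map_mk, isUpperTriangular_conj_iff]
    exact h

theorem norm_map_int_le_one {p : ℕ} [Fact p.Prime] (m : GL (Fin 2) ℤ) (i j : Fin 2) :
    ‖(Matrix.GeneralLinearGroup.map (Int.castRingHom ℚ_[p]) m :
        Matrix (Fin 2) (Fin 2) ℚ_[p]) i j‖ ≤ 1 :=
  Padic.norm_int_le_one _

theorem disc_map_int_ne_zero {p : ℕ} [Fact p.Prime] {g : PGL(2, ℝ)}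
    (hg : IsPeriodic (coset GammaInf g)) {m : GL (Fin 2) ℤ}
    (hγ : IsGammaOf g (ProjGenLinGroup.mk m)) :
    (Matrix.GeneralLinearGroup.map (Int.castRingHom ℚ_[p]) m :
      Matrix (Fin 2) (Fin 2) ℚ_[p]).trace ^ 2 -
      4 * (Matrix.GeneralLinearGroup.map (Int.castRingHom ℚ_[p]) m :
        Matrix (Fin 2) (Fin 2) ℚ_[p]).det ≠ 0 := by
  obtain ⟨hdet, htr, -⟩ := trace_sq_of_isGammaOf hg hγ
  rw [disc_map_int hdet]
  exact_mod_cast (by omega : (m : Matrix (Fin 2) (Fin 2) ℤ).trace ^ 2 - 4 ≠ 0)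

theorem exists_isGammaOf_mk {g : PGL(2, ℝ)} (hg : IsPeriodic (coset GammaInf g)) :
    ∃ m : GL (Fin 2) ℤ, IsGammaOf g (ProjGenLinGroup.mk m) := by
  obtain ⟨γ, hγ⟩ := exists_isGammaOf hg
  obtain ⟨m, rfl⟩ := ProjGenLinGroup.mk_surjective γ
  exact ⟨m, hγ⟩

theorem exists_not_isDegenerate (S : Finset Nat.Primes) {g : PGL(2, ℝ)}
    (hg : IsPeriodic (coset GammaInf g)) : ∃ ω ∈ KS S, ¬ IsDegenerate S g ω := by
  obtain ⟨m, hγ⟩ := exists_isGammaOf_mk hg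
  have h1 : ∀ p : S, ∃ k : GL (Fin 2) ℤ_[p.1],
      lowerForm (Matrix.GeneralLinearGroup.map (Int.castRingHom ℚ_[p.1]) m :
        Matrix (Fin 2) (Fin 2) ℚ_[p.1])
        ((k : Matrix (Fin 2) (Fin 2) ℤ_[p.1]) 0 0 : ℚ_[p.1])
        ((k : Matrix (Fin 2) (Fin 2) ℤ_[p.1]) 1 0 : ℚ_[p.1]) ≠ 0 := fun p => by
    obtain ⟨x, y, hxy, h⟩ := exists_isPrimitive_lowerForm_ne_zero (p := p.1)
      (norm_map_int_le_one m) (disc_map_int_ne_zero hg hγ)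
    obtain ⟨k, rfl, rfl⟩ := exists_gl_of_isPrimitive hxy
    exact ⟨k, h⟩
  choose k hk using h1
  refine ⟨fun p => ProjGenLinGroup.mk (toQp (k p)),
    mem_KS_iff.2 fun p => mk_toQp_mem_intPGL (k p), ?_⟩
  rw [isDegenerate_iff hg hγ fun p => rfl]
  rintro ⟨p, h⟩
  exact hk p h

/-! ### The split case -/

/-- If `ω_p⁻¹ γ_x ω_p` is upper triangular modulo `h` for all `p ∈ S`, then `γ_x` stabilizes
`x_{ω,h}`, whose orbit is therefore at most as long as that of `x`. -/
theorem period_branchPoint_le {S : Finset Nat.Primes} {g : PGL(2, ℝ)}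
    (hg : IsPeriodic (coset GammaInf g)) {m : GL (Fin 2) ℤ}
    (hγ : IsGammaOf g (ProjGenLinGroup.mk m)) {h : ℕ+} (hh : h ∈ radii S)
    {k : (p : S) → GL (Fin 2) ℤ_[p.1]}
    (hk : ∀ p : S, ‖lowerForm (Matrix.GeneralLinearGroup.map (Int.castRingHom ℚ_[p.1]) m :
        Matrix (Fin 2) (Fin 2) ℚ_[p.1])
        ((k p : Matrix (Fin 2) (Fin 2) ℤ_[p.1]) 0 0 : ℚ_[p.1])
        ((k p : Matrix (Fin 2) (Fin 2) ℤ_[p.1]) 1 0 : ℚ_[p.1])‖ ≤ ‖((h : ℕ) : ℚ_[p.1])‖) :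
    period (branchPoint S g (fun p => ProjGenLinGroup.mk (toQp (k p))) h) ≤
      period (coset GammaInf g) := by
  have hω : (fun p : S => ProjGenLinGroup.mk (toQp (k p))) ∈ KS S :=
    mem_KS_iff.2 fun p => mk_toQp_mem_intPGL (k p)
  refine period_le hg.period_pos ?_
  rw [translate_branchPoint_iff g hω hh]
  refine ⟨(ofIntPGL S (ProjGenLinGroup.mk m))⁻¹, by rw [map_inv, realPlace_ofIntPGL]; exact hγ,
    fun p => ?_⟩
  have h1 := level_of_int (radiusUnit ℚ_[p.1] h) (norm_radius_le_one _ h)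
    ((k p)⁻¹ * Matrix.GeneralLinearGroup.map (Int.castRingHom ℤ_[p.1]) m * k p) (by
      refine le_trans (le_of_eq ?_) (hk p)
      rw [← norm_conj_apply, ← toQp_map_int]
      rw [← Units.val_mul, ← Units.val_mul, toQp, ← map_inv, ← map_mul, ← map_mul]
      rfl)
  convert inv_mem h1 using 1
  rw [map_inv, padicPlace_ofIntPGL]
  have e : ProjGenLinGroup.map (algebraMap ℤ_[p.1] ℚ_[p.1]) (ProjGenLinGroup.mk
      ((k p)⁻¹ * Matrix.GeneralLinearGroup.map (Int.castRingHom ℤ_[p.1]) m * k p)) =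
      (ProjGenLinGroup.mk (toQp (k p)))⁻¹ *
        ProjGenLinGroup.map (Int.castRingHom ℚ_[p.1]) (ProjGenLinGroup.mk m) *
        ProjGenLinGroup.mk (toQp (k p)) := by
    rw [ProjGenLinGroup.map_mk, ProjGenLinGroup.map_mk, ← toQp_map_int]
    simp only [toQp, map_mul, map_inv]
  rw [e]
  group

theorem exists_ratio_le_of_sq {S : Finset Nat.Primes} {g : PGL(2, ℝ)}
    (hg : IsPeriodic (coset GammaInf g)) {m : GL (Fin 2) ℤ}
    (hγ : IsGammaOf g (ProjGenLinGroup.mk m)) {p : Nat.Primes} (hp : p ∈ S) {r : ℚ_[p]}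
    (hr : r ^ 2 = (((m : Matrix (Fin 2) (Fin 2) ℤ).trace ^ 2 - 4 : ℤ) : ℚ_[p])) (N : ℕ) :
    ∃ ω ∈ KS S, ¬ IsDegenerate S g ω ∧ ∃ h ∈ radii S,
      ratio S g ω h ≤ period (coset GammaInf g) / (p : ℕ) ^ N := by
  obtain ⟨hdet, -, -⟩ := trace_sq_of_isGammaOf hg hγ
  set h : ℕ+ := ⟨(p : ℕ) ^ N, pow_pos p.2.pos N⟩ with hh
  have hcoe : (h : ℕ) = (p : ℕ) ^ N := rfl
  have hrad : h ∈ radii S := by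
    rw [mem_radii_iff]
    intro q hq
    rw [hcoe] at hq
    have := (Nat.prime_dvd_prime_iff_eq q.2 p.2).1 (q.2.dvd_of_dvd_pow hq)
    rwa [show q = p from Subtype.ext this]
  have h1 : ∀ q : S, ∃ k : GL (Fin 2) ℤ_[q.1],
      lowerForm (Matrix.GeneralLinearGroup.map (Int.castRingHom ℚ_[q.1]) m :
        Matrix (Fin 2) (Fin 2) ℚ_[q.1])
        ((k : Matrix (Fin 2) (Fin 2) ℤ_[q.1]) 0 0 : ℚ_[q.1])
        ((k : Matrix (Fin 2) (Fin 2) ℤ_[q.1]) 1 0 : ℚ_[q.1]) ≠ 0 ∧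
      ‖lowerForm (Matrix.GeneralLinearGroup.map (Int.castRingHom ℚ_[q.1]) m :
        Matrix (Fin 2) (Fin 2) ℚ_[q.1])
        ((k : Matrix (Fin 2) (Fin 2) ℤ_[q.1]) 0 0 : ℚ_[q.1])
        ((k : Matrix (Fin 2) (Fin 2) ℤ_[q.1]) 1 0 : ℚ_[q.1])‖ ≤ ‖((h : ℕ) : ℚ_[q.1])‖ := by
    rintro ⟨q, hq⟩
    by_cases hqp : q = p
    · subst hqp
      rw [← disc_map_int hdet] at hr
      obtain ⟨x₀, y₀, hxy₀, h₀⟩ := exists_isPrimitive_lowerForm_eq_zero hr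
      obtain ⟨x, y, hxy, h1, h2⟩ := exists_isPrimitive_near (norm_map_int_le_one m)
        (disc_map_int_ne_zero hg hγ) hxy₀ h₀ N
      obtain ⟨k, rfl, rfl⟩ := exists_gl_of_isPrimitive hxy
      refine ⟨k, h1, h2.trans_eq ?_⟩
      rw [hcoe, Nat.cast_pow, norm_pow, Padic.norm_p, inv_pow, zpow_neg, zpow_natCast]
    · obtain ⟨x, y, hxy, h1⟩ := exists_isPrimitive_lowerForm_ne_zero (p := q)
        (norm_map_int_le_one m) (disc_map_int_ne_zero hg hγ)
      obtain ⟨k, rfl, rfl⟩ := exists_gl_of_isPrimitive hxy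
      refine ⟨k, h1, ?_⟩
      have h2 : ‖((h : ℕ) : ℚ_[q])‖ = 1 := by
        rw [Padic.norm_natCast_eq_one_iff, hcoe]
        exact ((Nat.coprime_primes q.2 p.2).2 fun e => hqp (Subtype.ext e)).pow_right N
      change _ ≤ ‖((h : ℕ) : ℚ_[q])‖
      rw [h2, ← norm_conj_apply, ← toQp_map_int, ← Units.val_mul, ← Units.val_mul, toQp, ← map_inv,
        ← map_mul, ← map_mul]
      exact PadicInt.norm_le_one _
  choose k hk0 hk using h1
  refine ⟨fun q => ProjGenLinGroup.mk (toQp (k q)),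
    mem_KS_iff.2 fun q => mk_toQp_mem_intPGL (k q), ?_, h, hrad, ?_⟩
  · rw [isDegenerate_iff hg hγ fun q => rfl]
    rintro ⟨q, hq⟩
    exact hk0 q hq
  · rw [ratio, hcoe, Nat.cast_pow]
    exact div_le_div_of_nonneg_right (period_branchPoint_le hg hγ hrad hk) (by positivity)

/-! ### The non-split case -/

/-- If no power of `b` has an eigenvector, then the exponents of the powers of `b` that fix a vertex
at distance `v` are divisible by `p ^ v` up to a bounded factor, uniformly over all branches. -/
theorem exists_pow_dvd_of_relOrder_dvd {p : ℕ} [hp : Fact p.Prime] {b : GL (Fin 2) ℚ_[p]}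
    (hb : ‖normTrace (ProjGenLinGroup.mk b)‖ ≤ 1)
    (hno : ∀ r, 0 < r → ∀ x y : ℤ_[p], IsPrimitive x y →
      lowerForm ((b : Matrix (Fin 2) (Fin 2) ℚ_[p]) ^ r) (x : ℚ_[p]) (y : ℚ_[p]) ≠ 0) :
    ∃ e : ℕ, ∀ (k : GL (Fin 2) ℤ_[p]) (v j : ℕ),
      relOrder (levelPow p v) ((ProjGenLinGroup.mk (toQp k))⁻¹ * ProjGenLinGroup.mk b *
        ProjGenLinGroup.mk (toQp k)) ∣ j → p ^ v ∣ j * p ^ e := by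
  rw [normTrace_mk] at hb
  obtain ⟨r, a, hr, hE, hd⟩ := exists_smul_pow_nearOne b hb
  have ha : a ≠ 0 := by
    rintro rfl
    rw [zero_smul, Matrix.det_zero] at hd
    exact zero_ne_one hd
  set E := a • (b : Matrix (Fin 2) (Fin 2) ℚ_[p]) ^ r with hEdef
  obtain ⟨e, he⟩ := exists_le_norm_lowerForm (A := E) fun x y hxy h0 => hno r hr x y hxy (by
    have : lowerForm E (x : ℚ_[p]) (y : ℚ_[p]) =
        a * lowerForm ((b : Matrix (Fin 2) (Fin 2) ℚ_[p]) ^ r) (x : ℚ_[p]) (y : ℚ_[p]) := by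
      rw [hEdef, lowerForm, lowerForm]
      simp only [Matrix.smul_apply, smul_eq_mul]
      ring
    rw [this] at h0
    exact (mul_eq_zero.1 h0).resolve_left ha)
  refine ⟨e, fun k v j hj => ?_⟩
  set c : GL (Fin 2) ℚ_[p] := (toQp k)⁻¹ * b * toQp k with hc
  have hcE : a • (c : Matrix (Fin 2) (Fin 2) ℚ_[p]) ^ r =
      (((toQp k)⁻¹ : GL (Fin 2) ℚ_[p]) : Matrix (Fin 2) (Fin 2) ℚ_[p]) * E *
        (toQp k : Matrix (Fin 2) (Fin 2) ℚ_[p]) := by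
    rw [← Units.val_pow_eq_pow_val, hc, inv_conj_pow, Units.val_mul, Units.val_mul, hEdef,
      Units.val_pow_eq_pow_val, Matrix.mul_smul, Matrix.smul_mul]
  have hcd : (a • (c : Matrix (Fin 2) (Fin 2) ℚ_[p]) ^ r).det = 1 := by
    rw [hcE, Matrix.det_mul, Matrix.det_mul, hd, mul_one, ← Matrix.det_mul, ← Units.val_mul,
      inv_mul_cancel, Units.val_one, Matrix.det_one]
  have hcN : NearOne (a • (c : Matrix (Fin 2) (Fin 2) ℚ_[p]) ^ r) := by
    rw [hcE]; exact hE.conj k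
  rw [← map_inv, ← map_mul, ← map_mul, ← hc] at hj
  have h1 := (relOrder_levelPow_dvd_iff hcN hcd v j).1 (hj.mul_left r)
  rw [hcE, norm_conj_apply] at h1
  have h2 := he _ _ (isPrimitive_of_gl k)
  have h3 : (p : ℝ) ^ (-e : ℤ) * ‖(j : ℚ_[p])‖ ≤ (p : ℝ) ^ (-v : ℤ) :=
    (mul_le_mul_of_nonneg_right h2 (norm_nonneg _)).trans h1
  have h4 : ((p : ℤ) ^ v) ∣ ((j * p ^ e : ℕ) : ℤ) := by
    rw [← Padic.norm_int_le_pow_iff_dvd]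
    push_cast
    rw [norm_mul, norm_pow, Padic.norm_p, inv_pow, ← zpow_natCast, ← zpow_neg, mul_comm]
    exact h3
  exact_mod_cast h4

theorem exists_le_ratio {S : Finset Nat.Primes} {g : PGL(2, ℝ)}
    (hg : IsPeriodic (coset GammaInf g)) {m : GL (Fin 2) ℤ}
    (hγ : IsGammaOf g (ProjGenLinGroup.mk m))
    (hns : ∀ p ∈ S, ∀ r : ℚ_[p],
      r ^ 2 ≠ (((m : Matrix (Fin 2) (Fin 2) ℤ).trace ^ 2 - 4 : ℤ) : ℚ_[p])) :
    ∃ c : ℝ, 0 < c ∧ ∀ ω ∈ KS S, ∀ h ∈ radii S, c ≤ ratio S g ω h := by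
  obtain ⟨hdet, -, -⟩ := trace_sq_of_isGammaOf hg hγ
  obtain ⟨u, D, hu, hDu, hD, hgen⟩ := exists_generator S hg
  obtain ⟨e, -, hDe⟩ := exists_pow_eq_gamma hg hDu hgen hγ
  have key : ∀ p : S, ∃ e : ℕ, ∀ (k : GL (Fin 2) ℤ_[p.1]) (v j : ℕ),
      relOrder (levelPow p.1 v) ((ProjGenLinGroup.mk (toQp k))⁻¹ * padicPlace S p D *
        ProjGenLinGroup.mk (toQp k)) ∣ j → (p.1 : ℕ) ^ v ∣ j * (p.1 : ℕ) ^ e := by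
    intro p
    have hDp := hD p
    obtain ⟨b, hb⟩ := ProjGenLinGroup.mk_surjective (padicPlace S p D)
    rw [← hb] at hDp ⊢
    refine exists_pow_dvd_of_relOrder_dvd hDp fun r hr x y hxy h0 => ?_
    obtain ⟨k, rfl, rfl⟩ := exists_gl_of_isPrimitive hxy
    rw [← Units.val_pow_eq_pow_val, ← isUpperTriangular_conj_iff, map_pow, hb] at h0
    have h1 := (h0.pow e).inv
    have e2 : (((ProjGenLinGroup.mk (toQp k))⁻¹ * padicPlace S p D ^ r *
        ProjGenLinGroup.mk (toQp k)) ^ e)⁻¹ = (ProjGenLinGroup.mk (toQp k))⁻¹ *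
        (ProjGenLinGroup.map (Int.castRingHom ℚ_[p.1]) (ProjGenLinGroup.mk m)) ^ r *
        ProjGenLinGroup.mk (toQp k) := by
      rw [inv_conj_pow, ← pow_mul, mul_comm, pow_mul, ← map_pow, hDe, map_inv,
        padicPlace_ofIntPGL, inv_pow]
      simp [mul_assoc]
    rw [e2] at h1
    obtain ⟨z, hz⟩ := exists_sq_eq_of_lowerForm_eq_zero hxy.ne_zero
      (lowerForm_eq_zero_of_pow hg hγ k hr h1)
    rw [disc_map_int hdet] at hz
    exact hns p p.2 z hz
  choose ε hε using key
  set Q : ℕ := ∏ p : S, (p.1 : ℕ) ^ ε p with hQ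
  have hQpos : 0 < Q := Finset.prod_pos fun p _ => pow_pos p.1.2.pos _
  refine ⟨u / Q, div_pos hu (by exact_mod_cast hQpos), fun ω hω h hh => ?_⟩
  rw [ratio, period_branchPoint hu hDu hD hgen hω hh]
  have hJ := branchExponent_pos hD ω h
  have hdvd : (h : ℕ) ∣ branchExponent S D ω h * Q := by
    rw [Nat.dvd_iff_prime_pow_dvd_dvd]
    intro q v hq hv
    by_cases hv0 : v = 0
    · rw [hv0, pow_zero]; exact one_dvd _
    obtain ⟨P, rfl⟩ : ∃ P : S, (P.1 : ℕ) = q :=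
      ⟨⟨⟨q, hq⟩, mem_radii_iff.1 hh ⟨q, hq⟩ ((dvd_pow_self q hv0).trans hv)⟩, rfl⟩
    obtain ⟨k, hk⟩ := exists_toQp_of_mem_intPGL (mem_KS_iff.1 hω P)
    have h1 : relOrder (levelPow P.1 (padicValNat P.1 h)) ((ω P)⁻¹ * padicPlace S P D * ω P) ∣
        branchExponent S D ω h :=
      Finset.dvd_lcm (f := fun p : S => relOrder (levelPow p.1 (padicValNat p.1 h))
        ((ω p)⁻¹ * padicPlace S p D * ω p)) (Finset.mem_univ P)
    rw [← hk] at h1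
    have hvle : v ≤ padicValNat P.1 h := (padicValNat_dvd_iff_le h.ne_zero).1 hv
    refine ((pow_dvd_pow _ hvle).trans (hε P k _ _ h1)).trans (mul_dvd_mul_left _ ?_)
    exact Finset.dvd_prod_of_mem (fun p : S => (p.1 : ℕ) ^ ε p) (Finset.mem_univ P)
  have hle : ((h : ℕ) : ℝ) ≤ branchExponent S D ω h * Q := by
    exact_mod_cast Nat.le_of_dvd (mul_pos hJ hQpos) hdvd
  have hh0 : (0 : ℝ) < (h : ℕ) := by exact_mod_cast h.pos
  rw [div_le_div_iff₀ (by exact_mod_cast hQpos) hh0]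
  calc u * (h : ℕ) ≤ u * (branchExponent S D ω h * Q) := mul_le_mul_of_nonneg_left hle hu.le
    _ = branchExponent S D ω h * u * Q := by ring

/-- A change of the representative `g` of the class can be absorbed into `ω`. -/
theorem branchPoint_map_mul (S : Finset Nat.Primes) (r : PGL(2, ℤ)) (g : PGL(2, ℝ)) (ω : GS S)
    (h : ℕ+) : branchPoint S (ProjGenLinGroup.map (Int.castRingHom ℝ) r * g) ω h =
      branchPoint S g (fun p => (ProjGenLinGroup.map (Int.castRingHom ℚ_[p.1]) r)⁻¹ * ω p) h := by
  have e : coset (GammaS S) (ProjGenLinGroup.map (Int.castRingHom ℝ) r * g, ω) =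
      coset (GammaS S)
        (g, fun p : S => (ProjGenLinGroup.map (Int.castRingHom ℚ_[p.1]) r)⁻¹ * ω p) := by
    rw [coset_GammaS_eq_iff]
    refine ⟨(ofIntPGL S r)⁻¹, ?_, fun p => ?_⟩
    · rw [map_inv, realPlace_ofIntPGL, inv_mul_cancel_left]
    · rw [map_inv, padicPlace_ofIntPGL]
  rw [branchPoint, e, branchPoint]

theorem ratio_nonneg (S : Finset Nat.Primes) (g : PGL(2, ℝ)) (ω : GS S) (h : ℕ+) :
    0 ≤ ratio S g ω h :=
  div_nonneg (Real.sInf_nonneg fun _ ht => ht.1.le) (by positivity)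

/-- The branches through `x` start from arbitrary representatives `g' = ρ g`. Absorbing `ρ` into `ω`
reduces them to the branches `ℒ_{g,ω}`, to which the bounds for the ratios apply. -/
theorem not_isSplit_iff_sInf_pos {S : Finset Nat.Primes} {g : PGL(2, ℝ)}
    (hg : IsPeriodic (coset GammaInf g)) :
    ¬ IsSplit S (coset GammaInf g) ↔
      0 < sInf {c : ℝ | ∃ (g' : PGL(2, ℝ)) (ω : GS S) (h : ℕ+),
        coset GammaInf g' = coset GammaInf g ∧
        ω ∈ KS S ∧ ¬ IsDegenerate S g' ω ∧ h ∈ radii S ∧ c = ratio S g' ω h} := by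
  obtain ⟨m, hγ⟩ := exists_isGammaOf_mk hg
  rw [isSplit_iff hg hγ S]
  constructor
  · intro hns
    obtain ⟨c, hc, hle⟩ := exists_le_ratio (S := S) hg hγ fun p hp r hr => hns ⟨p, hp, r, hr⟩
    refine lt_of_lt_of_le hc (le_csInf ?_ ?_)
    · obtain ⟨ω, hω, hdeg⟩ := exists_not_isDegenerate S hg
      exact ⟨_, g, ω, 1, rfl, hω, hdeg, one_mem_radii S, rfl⟩
    · rintro _ ⟨g', ω, h, hg', hω, -, hh, rfl⟩
      obtain ⟨_, ⟨r, rfl⟩, rfl⟩ := coset_eq_iff.1 hg'.symm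
      rw [ratio, branchPoint_map_mul]
      exact hle _ (mem_KS_iff.2 fun p =>
        mul_mem (inv_mem (map_int_mem_intPGL r)) (mem_KS_iff.1 hω p)) h hh
  · rintro hpos ⟨p, hp, r, hr⟩
    have ht := hg.period_pos
    set t := period (coset GammaInf g)
    have hp1 : ((p : ℕ) : ℝ)⁻¹ < 1 := inv_lt_one_of_one_lt₀ (by exact_mod_cast p.2.one_lt)
    obtain ⟨N, hN⟩ := exists_pow_lt_of_lt_one (div_pos hpos ht) hp1
    obtain ⟨ω, hω, hdeg, h, hh, hle⟩ := exists_ratio_le_of_sq hg hγ hp hr N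
    rw [lt_div_iff₀ ht, inv_pow, inv_mul_eq_div] at hN
    refine hN.not_ge (le_trans (csInf_le ?_ ?_) hle)
    · refine ⟨0, ?_⟩
      rintro _ ⟨g', ω, h, -, -, -, -, rfl⟩
      exact ratio_nonneg S g' ω h
    · exact ⟨g, ω, h, rfl, hω, hdeg, hh, rfl⟩

end HeckeGraph

theorem lemma5p1 (S : Finset Nat.Primes) (x : XInf) (hx : IsPeriodic x) :
    -- the point of the generalized branch on the sphere of radius `h` is well defined
    (∀ g : PGL(2, ℝ), coset GammaInf g = x → ∀ ω ∈ KS S, ∀ h ∈ radii S,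
      branch S g ω ∩ sphere S x h = {branchPoint S g ω h}) ∧
    -- total growth
    (∃ c C : ℝ, 0 < c ∧ 0 < C ∧ ∀ h ∈ radii S,
      c * (h : ℕ) ≤ totalLength S x h ∧ totalLength S x h ≤ C * (h : ℕ)) ∧
    -- individual growth along a non-degenerate generalized branch
    (∀ g : PGL(2, ℝ), coset GammaInf g = x → ∀ ω ∈ KS S, ¬ IsDegenerate S g ω →
      (ratio S g ω '' radii S).Finite ∧
      ∀ u : ℕ → ℕ+, (∀ n, u n ∈ radii S) → (∀ n, (u n : ℕ) ∣ (u (n + 1) : ℕ)) →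
        ∃ N : ℕ, ∀ n : ℕ, N ≤ n → ratio S g ω (u n) = ratio S g ω (u N)) ∧
    -- the non-split criterion
    (¬ IsSplit S x ↔
      0 < sInf {c : ℝ | ∃ (g : PGL(2, ℝ)) (ω : GS S) (h : ℕ+), coset GammaInf g = x ∧
        ω ∈ KS S ∧ ¬ IsDegenerate S g ω ∧ h ∈ radii S ∧ c = ratio S g ω h}) := by
  obtain ⟨g₀, rfl⟩ := Quotient.exists_rep x
  change IsPeriodic (coset GammaInf g₀) at hx
  refine ⟨?_, ?_, ?_, ?_⟩
  · intro g hg ω hω h hh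
    rw [← hg]
    exact branch_inter_sphere hω hh
  · obtain ⟨ω, hω, hdeg⟩ := exists_not_isDegenerate S hx
    obtain ⟨c, hc, hle⟩ := exists_le_totalLength hx hω hdeg
    obtain ⟨C, hC, hge⟩ := exists_totalLength_le S hx
    exact ⟨c, C, hc, hC, fun h hh => ⟨hle h hh, hge h hh⟩⟩
  · intro g hg ω hω hdeg
    obtain ⟨H, hH⟩ := exists_ratio_eq_gcd (hg ▸ hx) hω hdeg
    exact finite_and_eventually_const hH
  · exact not_isSplit_iff_sInf_pos hx
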